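/- Let $A\in\mathbb Q^{m_A\times n}$ and $B\in\mathbb Q^{m_B\times n}$ with $\operatorname{rank}\binom AB=n$ (so that every nonempty polyhedron $P=\{x\in\mathbb R^n: Ax=b,\ Bx\le d\}$ is pointed), and put $D=\binom AB$. Let $\mathcal C(A,B)$ be the set of circuits of $P$: all $g\in\ker(A)\setminus\{0\}$ with coprime integer components such that $Bg$ is support-minimal over $\{Bx: x\in\ker(A)\setminus\{0\}\}$. Vectors $x,y$ are sign-compatible with respect to $B$ if $(Bx)_j(By)_j\ge 0$ for all $j$. Consider the following (nondeterministic) algorithm on input $A,B$ and $u\in\ker(A)\setminus\{0\}$. Start with $w:=u$, $i:=1$. In each pass, let $Z(w)=\{j:(Dw)_j=0\}$ and let $D_{Z(w)}$ be the row submatrix of $D$ indexed by $Z(w)$. - If $\operatorname{rank}(D_{Z(w)})=n-1$, let $g_i$ be the circuit in $\mathcal C(A,B)$ of which $w$ is a positive multiple, let $\lambda_i:=\|w\|/\|g_i\|$, and return $g_1,\dots,g_i,\lambda_1,\dots,\lambda_i$. - Otherwise let $g_i$ be any circuit $g\in\mathcal C(A,B)$ that is sign-compatible with $w$ with respect to $B$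 and satisfies $\operatorname{supp}(Bg)\subsetneq\operatorname{supp}(Bw)$, let $\lambda_i:=\min\{(Bw)_j/(Bg_i)_j : (Bw)_j(Bg_i)_j>0\}$, replace $w$ by $w-\lambda_ig_i$ and $i$ by $i+1$, and repeat. Then: 1. For every real $u\in\ker(A)\setminus\{0\}$ and every choice of the circuits $g_i$, the algorithm never gets stuck, stops after at most $n-\operatorname{rank}(A)$ passes, and returns a sign-compatible sum of circuits $u=\sum_{i=1}^t\lambda_ig_i$ with $t\le n-\operatorname{rank}(A)$; that is, $g_i\in\mathcal C(A,B)$, $\lambda_i\ge 0$, and the $g_i$ are sign-compatible with $u$ and with each other with respect to $B$. 2. For rational $u$ the algorithm can be implemented in polynomial time: there are one program and one polynomial $p$ such that, for all $n,m_A,m_B$, all $A,B$ as above and all $u\in\mathbb Q^n\cap\ker(A)\setminus\{0\}$, the program, given $(A,B,u)$, halts within $p(L)$ bit operations, where $L$ is the bit size of $(A,B,u)$, and outputs the result of a run of the algorithm, hence a sum as in 1. -/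

import Mathlib

namespace CircuitSum

/-! ### Circuits of a polyhedron `{x | A x = b, B x ≤ d}` -/

/-- A rational matrix, regarded as a real matrix. -/
def realMat {m n : ℕ} (M : Matrix (Fin m) (Fin n) ℚ) : Matrix (Fin m) (Fin n) ℝ :=
  M.map (fun q => (q : ℝ))

/-- A rational vector, regarded as a real vector. -/
def realVec {n : ℕ} (v : Fin n → ℚ) : Fin n → ℝ := fun i => (v i : ℝ)

/-- An integer vector, regarded as a real vector. -/
def intVec {n : ℕ} (g : Fin n → ℤ) : Fin n → ℝ := fun i => (g i : ℝ)

section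
variable {n mA mB : ℕ}

/-- The stacked constraint matrix `D = (A over B)`. -/
def stacked (A : Matrix (Fin mA) (Fin n) ℝ) (B : Matrix (Fin mB) (Fin n) ℝ) :
    Matrix (Fin mA ⊕ Fin mB) (Fin n) ℝ :=
  Matrix.fromRows A B

/-- The standing assumption `rank (A over B) = n` that makes `{x | A x = b, B x ≤ d}` pointed. -/
def IsPointed (A : Matrix (Fin mA) (Fin n) ℝ) (B : Matrix (Fin mB) (Fin n) ℝ) : Prop :=
  (stacked A B).rank = n

/-- The set of circuits `𝒞(A,B)`: the nonzero `g ∈ ker A` with coprime integer components such that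
`B g` is support-minimal over `{B x | x ∈ ker A, x ≠ 0}`. -/
def circuits (A : Matrix (Fin mA) (Fin n) ℝ) (B : Matrix (Fin mB) (Fin n) ℝ) :
    Set (Fin n → ℤ) :=
  {g | A.mulVec (intVec g) = 0 ∧ intVec g ≠ 0 ∧ Finset.univ.gcd g = 1 ∧
    ∀ x : Fin n → ℝ, A.mulVec x = 0 → x ≠ 0 →
      ¬ Function.support (B.mulVec x) ⊂ Function.support (B.mulVec (intVec g))}

/-- `x` and `y` are sign-compatible with respect to `B`: `B x` and `B y` lie in a common
orthant. -/
def SignCompatible (B : Matrix (Fin mB) (Fin n) ℝ) (x y : Fin n → ℝ) : Prop :=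
  ∀ j, 0 ≤ B.mulVec x j * B.mulVec y j

/-- The list `(g₁, l₁), …, (g_t, l_t)` describes a sign-compatible sum `u = ∑ l_i g_i` of circuits:
`l_i ≥ 0`, `g_i ∈ 𝒞(A,B)`, and the `g_i` are sign-compatible (with respect to `B`) with `u` and
with each other. -/
def IsSignCompatibleSum (A : Matrix (Fin mA) (Fin n) ℝ) (B : Matrix (Fin mB) (Fin n) ℝ)
    (u : Fin n → ℝ) (out : List ((Fin n → ℤ) × ℝ)) : Prop :=
  (∀ e ∈ out, e.1 ∈ circuits A B ∧ 0 ≤ e.2 ∧ SignCompatible B (intVec e.1) u) ∧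
  (∀ e ∈ out, ∀ e' ∈ out, SignCompatible B (intVec e.1) (intVec e'.1)) ∧
  u = (out.map fun e => e.2 • intVec e.1).sum

/-! ### The algorithm, as a nondeterministic transition system -/

/-- `rank D_{Z(w)}`, where `Z(w) = {j | (D w)_j = 0}` and `D_{Z(w)}` is the corresponding row
submatrix of `D = (A over B)`. -/
noncomputable def zeroRank (A : Matrix (Fin mA) (Fin n) ℝ) (B : Matrix (Fin mB) (Fin n) ℝ)
    (w : Fin n → ℝ) : ℕ :=
  ((stacked A B).submatrix
    (Subtype.val : {j // (stacked A B).mulVec w j = 0} → Fin mA ⊕ Fin mB) id).rank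

/-- Configurations: inside the main loop, with the current vector `w` and the terms found so far, or
halted with the returned terms. -/
inductive Config (n : ℕ) : Type
  | main (w : Fin n → ℝ) (out : List ((Fin n → ℤ) × ℝ)) : Config n
  | halt (out : List ((Fin n → ℤ) × ℝ)) : Config n

/-- One pass through the main loop of the algorithm.

* `finish`: if `rank D_{Z(w)} = n - 1`, append the circuit `g` with direction `w`, with coefficient
  `‖w‖ / ‖g‖` (the same number for every norm, since `w` is a multiple of `g`), and return.
* `reduce`: otherwise, append any circuit `g` with `supp (B g) ⊊ supp (B w)` that is
  sign-compatible with `w`, with coefficient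
  `l = min {(B w)_j / (B g)_j | (B w)_j (B g)_j > 0}`, and replace `w` by `w - l g`. -/
inductive Step (A : Matrix (Fin mA) (Fin n) ℝ) (B : Matrix (Fin mB) (Fin n) ℝ) :
    Config n → Config n → Prop
  | finish (w : Fin n → ℝ) (out : List ((Fin n → ℤ) × ℝ)) (g : Fin n → ℤ)
      (hrank : zeroRank A B w = n - 1)
      (hg : g ∈ circuits A B)
      (hdir : ∃ a : ℝ, 0 < a ∧ w = a • intVec g) :
      Step A B (.main w out) (.halt (out ++ [(g, ‖w‖ / ‖intVec g‖)]))
  | reduce (w : Fin n → ℝ) (out : List ((Fin n → ℤ) × ℝ)) (g : Fin n → ℤ) (l : ℝ)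
      (hrank : zeroRank A B w ≠ n - 1)
      (hg : g ∈ circuits A B)
      (hsupp : Function.support (B.mulVec (intVec g)) ⊂ Function.support (B.mulVec w))
      (hsign : SignCompatible B (intVec g) w)
      (hl : IsLeast {r : ℝ | ∃ j, 0 < B.mulVec w j * B.mulVec (intVec g) j ∧
        r = B.mulVec w j / B.mulVec (intVec g) j} l) :
      Step A B (.main w out) (.main (w - l • intVec g) (out ++ [(g, l)]))

/-- `c 0, …, c k` are the first configurations of a run of the algorithm on input `(A, B, u)`. -/
def IsRun (A : Matrix (Fin mA) (Fin n) ℝ) (B : Matrix (Fin mB) (Fin n) ℝ) (u : Fin n → ℝ)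
    (k : ℕ) (c : ℕ → Config n) : Prop :=
  c 0 = .main u [] ∧ ∀ i < k, Step A B (c i) (c (i + 1))

end

/-! ### A model of computation with bit costs

Programs of a small first-order language over integers of arbitrary length, pairs and lists, with
conditionals and unbounded loops.  Every operation is charged for the bit lengths of all the data it
touches, so costs agree with Turing machine running times up to a polynomial. -/

/-- Data types. -/
inductive Ty : Type
  | int : Ty
  | prod : Ty → Ty → Ty
  | list : Ty → Ty

/-- The data of a given type. -/
@[reducible] def Ty.Val : Ty → Type
  | .int => ℤ
  | .prod a b => a.Val × b.Val
  | .list a => List a.Val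

/-- The bit size of a datum: binary length for integers (plus one for the sign), plus one for each
pair and each list cell. -/
def Ty.size : (a : Ty) → a.Val → ℕ
  | .int, z => Nat.size (Int.natAbs z) + 1
  | .prod a b, x => a.size x.1 + b.size x.2 + 1
  | .list a, l => (l.map fun x => a.size x + 1).sum + 1

/-- Primitive operations. -/
inductive Prim : Ty → Ty → Type
  | id (a : Ty) : Prim a a
  | fst (a b : Ty) : Prim (.prod a b) a
  | snd (a b : Ty) : Prim (.prod a b) b
  | const (a : Ty) (z : ℤ) : Prim a .int
  | add : Prim (.prod .int .int) .int
  | sub : Prim (.prod .int .int) .int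
  | mul : Prim (.prod .int .int) .int
  | div : Prim (.prod .int .int) .int
  | le : Prim (.prod .int .int) .int
  | nil (a b : Ty) : Prim a (.list b)
  | cons (a : Ty) : Prim (.prod a (.list a)) (.list a)

/-- The meaning of the primitive operations; `div` is integer division with remainder (giving `0`
for divisor `0`) and `le` returns `1` for true and `0` for false. -/
def Prim.apply : {a b : Ty} → Prim a b → a.Val → b.Val
  | _, _, .id _, x => x
  | _, _, .fst _ _, x => x.1
  | _, _, .snd _ _, x => x.2
  | _, _, .const _ z, _ => z
  | _, _, .add, x => (x.1 + x.2 : ℤ)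
  | _, _, .sub, x => (x.1 - x.2 : ℤ)
  | _, _, .mul, x => (x.1 * x.2 : ℤ)
  | _, _, .div, x => (x.1 / x.2 : ℤ)
  | _, _, .le, x => if (x.1 : ℤ) ≤ x.2 then (1 : ℤ) else 0
  | _, _, .nil _ _, _ => []
  | _, _, .cons _, x => x.1 :: x.2

/-- Programs. -/
inductive Prog : Ty → Ty → Type
  /-- a primitive operation -/
  | prim {a b : Ty} (o : Prim a b) : Prog a b
  /-- first `f`, then `g` -/
  | comp {a b c : Ty} (g : Prog b c) (f : Prog a b) : Prog a c
  /-- `x ↦ (f x, g x)` -/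
  | pair {a b c : Ty} (f : Prog a b) (g : Prog a c) : Prog a (.prod b c)
  /-- if `test x ≠ 0` then `f x` else `g x` -/
  | ite {a b : Ty} (test : Prog a .int) (f g : Prog a b) : Prog a b
  /-- `(x, []) ↦ f x` and `(x, h :: t) ↦ g (x, (h, t))` -/
  | listCase {a b c : Ty} (f : Prog a c) (g : Prog (.prod a (.prod b (.list b))) c) :
      Prog (.prod a (.list b)) c
  /-- while `test x ≠ 0` do `x := f x`; return `x` -/
  | loop {a : Ty} (test : Prog a .int) (f : Prog a a) : Prog a a

/-- `f.Eval x y t`: on input `x` the program `f` halts with output `y`, at bit cost `t`.  A primitive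
operation costs the square of the total size of its input and output (the schoolbook bound for
multiplication and division); control structures cost the size of the data they copy or inspect. -/
inductive Prog.Eval : {a b : Ty} → Prog a b → a.Val → b.Val → ℕ → Prop
  | prim {a b : Ty} (o : Prim a b) (x : a.Val) :
      Prog.Eval (.prim o) x (o.apply x) ((a.size x + b.size (o.apply x)) ^ 2)
  | comp {a b c : Ty} {g : Prog b c} {f : Prog a b} {x : a.Val} {y : b.Val} {z : c.Val}
      {s t : ℕ} (hf : Prog.Eval f x y s) (hg : Prog.Eval g y z t) :
      Prog.Eval (.comp g f) x z (s + t + 1)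
  | pair {a b c : Ty} {f : Prog a b} {g : Prog a c} {x : a.Val} {y : b.Val} {z : c.Val}
      {s t : ℕ} (hf : Prog.Eval f x y s) (hg : Prog.Eval g x z t) :
      Prog.Eval (.pair f g) x (y, z) (s + t + a.size x)
  | ite_true {a b : Ty} {test : Prog a .int} {f g : Prog a b} {x : a.Val} {v : ℤ} {y : b.Val}
      {s t : ℕ} (htest : Prog.Eval test x v s) (hv : v ≠ 0) (hf : Prog.Eval f x y t) :
      Prog.Eval (.ite test f g) x y (s + t + a.size x)
  | ite_false {a b : Ty} {test : Prog a .int} {f g : Prog a b} {x : a.Val} {v : ℤ} {y : b.Val}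
      {s t : ℕ} (htest : Prog.Eval test x v s) (hv : v = 0) (hg : Prog.Eval g x y t) :
      Prog.Eval (.ite test f g) x y (s + t + a.size x)
  | listCase_nil {a b c : Ty} {f : Prog a c} {g : Prog (.prod a (.prod b (.list b))) c}
      {x : a.Val} {y : c.Val} {t : ℕ} (hf : Prog.Eval f x y t) :
      Prog.Eval (.listCase f g) (x, []) y (t + a.size x + 1)
  | listCase_cons {a b c : Ty} {f : Prog a c} {g : Prog (.prod a (.prod b (.list b))) c}
      {x : a.Val} {h : b.Val} {l : List b.Val} {y : c.Val} {t : ℕ}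
      (hg : Prog.Eval g (x, (h, l)) y t) :
      Prog.Eval (.listCase f g) (x, h :: l) y (t + a.size x + (Ty.list b).size (h :: l))
  | loop_done {a : Ty} {test : Prog a .int} {f : Prog a a} {x : a.Val} {v : ℤ} {s : ℕ}
      (htest : Prog.Eval test x v s) (hv : v = 0) :
      Prog.Eval (.loop test f) x x (s + a.size x)
  | loop_step {a : Ty} {test : Prog a .int} {f : Prog a a} {x y z : a.Val} {v : ℤ} {s t r : ℕ}
      (htest : Prog.Eval test x v s) (hv : v ≠ 0) (hf : Prog.Eval f x y t)
      (hrest : Prog.Eval (.loop test f) y z r) :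
      Prog.Eval (.loop test f) x z (s + t + r + a.size x)

/-! ### Encoding of inputs and outputs -/

/-- Rational numbers are pairs (numerator, denominator). -/
abbrev Ty.rat : Ty := .prod .int .int

/-- Inputs `(A, (B, u))`: two matrices, as lists of rows, and a vector. -/
abbrev Ty.input : Ty := .prod (.list (.list .rat)) (.prod (.list (.list .rat)) (.list .rat))

/-- Outputs: lists of terms `(g, l)` with `g` an integer vector and `l` a rational number. -/
abbrev Ty.output : Ty := .list (.prod (.list .int) .rat)

/-- A rational number in lowest terms, with positive denominator. -/
def encodeRat (q : ℚ) : Ty.rat.Val := (q.num, (q.den : ℤ))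

def encodeVec {n : ℕ} (v : Fin n → ℚ) : (Ty.list .rat).Val := List.ofFn fun i => encodeRat (v i)

def encodeMat {m n : ℕ} (M : Matrix (Fin m) (Fin n) ℚ) : (Ty.list (.list .rat)).Val :=
  List.ofFn fun i => encodeVec (M i)

def encodeInput {n mA mB : ℕ} (A : Matrix (Fin mA) (Fin n) ℚ) (B : Matrix (Fin mB) (Fin n) ℚ)
    (u : Fin n → ℚ) : Ty.input.Val :=
  (encodeMat A, (encodeMat B, encodeVec u))

def encodeOutput {n : ℕ} (out : List ((Fin n → ℤ) × ℚ)) : Ty.output.Val :=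
  out.map fun e => (List.ofFn e.1, encodeRat e.2)

/-- A list of terms with rational coefficients, regarded as one with real coefficients. -/
def realOut {n : ℕ} (out : List ((Fin n → ℤ) × ℚ)) : List ((Fin n → ℤ) × ℝ) :=
  out.map fun e => (e.1, (e.2 : ℝ))

end CircuitSum

open CircuitSum

/-! For a nonzero w in ker A let T(w) be the kernel of D_{Z(w)} (`tightSpace`). It contains w, lies
in ker A and has dimension n - rank D_{Z(w)}. If supp(Bx) is strictly contained in supp(Bw), then
T(x) is strictly smaller than T(w), so the rank is strictly larger (`zeroRank_lt`). A reduction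
makes some inequality tight without reversing any sign, and its result is nonzero because supp(Bg)
misses a coordinate of supp(Bw) (`reduce_spec`). Hence the rank starts at rank A or more, grows with
each reduction and never exceeds n - 1, which bounds the number of passes. All circuits found are
conformal to u; conformality, unlike sign-compatibility, is transitive, and vectors conformal to the
same u are sign-compatible with each other.

The algorithm is never stuck. If T(w) is a line, it is the solution space of integer equations, so
it contains a primitive integer vector in direction w, which is a circuit (`exists_circuit`).
Otherwise take y in T(w) that is not a multiple of w and subtract from w the multiple of y of least
absolute value that makes a coordinate of By tight. The result is nonzero, conformal to w and of
smaller support; iteration ends at a conformal circuit (`exists_conformal_circuit`).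

For polynomial time the same descent is carried out on integer vectors. One round computes a
spanning set of T(x) and moves along each of its members. If the support survives the round, every
member is a multiple of x and T(x) is a line; otherwise the rank has grown. So n rounds suffice
(`descend_spec_aux`).

The difficulty is the length of the numbers, and two facts control it. The spanning vectors come
from elimination with primitive integer vectors; each is determined up to scaling by the pivot rows
and one free coordinate, so Siegel's lemma yields a small integer multiple of it and a bound
depending on A and B only (`IsEliminated.natAbs_le`); the circuits used obey the same bound
(`bounded_of_mem_circuits`). Moreover a move replaces x by q²x - pqy with p = r·x and q = r·y for a
row r, and p is linear in x, so the number of bits added does not depend on x (`subMul_bound`). Bit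
lengths therefore add up over polynomially many moves instead of multiplying.

The programs are never written out: `PolyTime` is closed under the basic constructions, and under
folds whose intermediate accumulators have polynomial size (`PolyTime.foldl`). -/

namespace CircuitSum

/-! ### Functions computable in polynomial time -/

/-- `f` is computed on `S` by a program whose bit cost is polynomial in the size of the input. -/
def PolyTime {a b : Ty} (S : Set a.Val) (f : a.Val → b.Val) : Prop :=
  ∃ (P : Prog a b) (p : Polynomial ℕ), ∀ x ∈ S, ∃ c, P.Eval x (f x) c ∧ c ≤ p.eval (a.size x)

/-- Natural coefficients make every cost polynomial monotone, so size bounds can be substituted into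
it. -/
theorem eval_le_eval (p : Polynomial ℕ) {m n : ℕ} (h : m ≤ n) : p.eval m ≤ p.eval n := by
  simp only [Polynomial.eval_eq_sum_range]
  gcongr

/-! ### Bit sizes of data -/

theorem Ty.size_pos : ∀ (a : Ty) (x : a.Val), 0 < a.size x
  | .int, _ => Nat.succ_pos _
  | .prod _ _, _ => Nat.succ_pos _
  | .list _, _ => Nat.succ_pos _

theorem Ty.size_prod {a b : Ty} (x : (Ty.prod a b).Val) :
    (Ty.prod a b).size x = a.size x.1 + b.size x.2 + 1 := rfl

theorem Ty.size_nil {a : Ty} : (Ty.list a).size [] = 1 := rfl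

theorem Ty.size_cons {a : Ty} (x : a.Val) (l : List a.Val) :
    (Ty.list a).size (x :: l) = a.size x + 1 + (Ty.list a).size l := by
  simp [Ty.size]; ring

theorem Ty.size_append {a : Ty} (l l' : List a.Val) :
    (Ty.list a).size (l ++ l') + 1 = (Ty.list a).size l + (Ty.list a).size l' := by
  simp [Ty.size]; ring

theorem Ty.size_reverse {a : Ty} (l : List a.Val) :
    (Ty.list a).size l.reverse = (Ty.list a).size l := by
  simp only [Ty.size, List.map_reverse, List.sum_reverse]

theorem Ty.length_le_size {a : Ty} (l : List a.Val) : l.length ≤ (Ty.list a).size l := by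
  induction l with
  | nil => simp
  | cons x l ih => rw [Ty.size_cons, List.length_cons]; omega

theorem Ty.size_le_of_mem {a : Ty} {x : a.Val} {l : List a.Val} (h : x ∈ l) :
    a.size x ≤ (Ty.list a).size l := by
  induction l with
  | nil => simp at h
  | cons y l ih =>
    rw [Ty.size_cons]
    rcases List.mem_cons.1 h with rfl | h
    · omega
    · have := ih h; omega

theorem Ty.size_le_of_forall {a : Ty} {l : List a.Val} {n m : ℕ} (hl : l.length ≤ n)
    (h : ∀ x ∈ l, a.size x ≤ m) : (Ty.list a).size l ≤ n * (m + 1) + 1 := by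
  induction l generalizing n with
  | nil => rw [Ty.size_nil]; omega
  | cons y l ih =>
    rw [Ty.size_cons]
    obtain ⟨n, rfl⟩ : ∃ k, n = k + 1 := ⟨n - 1, by simp at hl; omega⟩
    have := ih (n := n) (by simpa using hl) fun x hx => h x (List.mem_cons_of_mem _ hx)
    have := h y List.mem_cons_self
    rw [Nat.succ_mul]; omega

theorem Ty.size_int_le_iff {z : ℤ} {e : ℕ} : Ty.int.size z ≤ e + 1 ↔ z.natAbs < 2 ^ e := by
  rw [← Nat.size_le]; simp [Ty.size]

theorem Ty.natAbs_lt_two_pow_size (z : ℤ) : z.natAbs < 2 ^ Ty.int.size z :=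
  (Nat.lt_size_self _).trans_le (Nat.pow_le_pow_right (by norm_num) (Nat.le_succ _))

theorem Ty.size_int_le_of_natAbs_le {z : ℤ} {e : ℕ} (h : z.natAbs ≤ 2 ^ e) :
    Ty.int.size z ≤ e + 2 := by
  rw [Ty.size_int_le_iff, pow_succ]
  have := Nat.two_pow_pos e
  omega

theorem Ty.size_mono {y z : ℤ} (h : y.natAbs ≤ z.natAbs) : Ty.int.size y ≤ Ty.int.size z :=
  Nat.succ_le_succ (Nat.size_le_size h)

theorem Ty.size_mul (y z : ℤ) : Ty.int.size (y * z) ≤ Ty.int.size y + Ty.int.size z := by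
  have h : (y * z).natAbs < 2 ^ (Nat.size y.natAbs + Nat.size z.natAbs) := by
    rw [Int.natAbs_mul, pow_add]
    exact Nat.mul_lt_mul'' (Nat.lt_size_self _) (Nat.lt_size_self _)
  have := Ty.size_int_le_iff.2 h
  simp only [Ty.size] at this ⊢
  omega

theorem Ty.size_add (y z : ℤ) : Ty.int.size (y + z) ≤ Ty.int.size y + Ty.int.size z := by
  have h : (y + z).natAbs < 2 ^ (Nat.size y.natAbs + Nat.size z.natAbs + 1) := by
    have h1 := Nat.lt_size_self y.natAbs
    have h2 := Nat.lt_size_self z.natAbs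
    have h3 : 2 ^ Nat.size y.natAbs ≤ 2 ^ (Nat.size y.natAbs + Nat.size z.natAbs) :=
      Nat.pow_le_pow_right (by norm_num) (by omega)
    have h4 : 2 ^ Nat.size z.natAbs ≤ 2 ^ (Nat.size y.natAbs + Nat.size z.natAbs) :=
      Nat.pow_le_pow_right (by norm_num) (by omega)
    have := Int.natAbs_add_le y z
    rw [pow_succ]; omega
  have := Ty.size_int_le_iff.2 h
  simp only [Ty.size] at this ⊢
  omega

theorem Ty.size_neg (z : ℤ) : Ty.int.size (-z) = Ty.int.size z := by simp [Ty.size]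

theorem Ty.size_sub (y z : ℤ) : Ty.int.size (y - z) ≤ Ty.int.size y + Ty.int.size z := by
  rw [sub_eq_add_neg, ← Ty.size_neg z]; exact Ty.size_add _ _

/-- Every evaluation rule pays for the output it produces. A time bound is thus also a bound on the
output size, which is what composition needs. -/
theorem Prog.Eval.size_le {a b : Ty} {P : Prog a b} {x : a.Val} {y : b.Val} {c : ℕ}
    (h : P.Eval x y c) : b.size y ≤ c := by
  induction h with
  | prim o x =>
    exact (Nat.le_add_left _ _).trans (Nat.le_self_pow two_ne_zero _)
  | comp _ _ _ ih => omega
  | @pair a _ _ _ _ x _ _ _ _ _ _ ih₁ ih₂ => have := a.size_pos x; simp only [Ty.size_prod]; omega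
  | ite_true => omega
  | ite_false => omega
  | listCase_nil => omega
  | listCase_cons => omega
  | loop_done => omega
  | loop_step => omega

/-! ### Closure properties of polynomial-time functions -/

namespace PolyTime

variable {a b c d : Ty} {S : Set a.Val}

theorem size_le {f : a.Val → b.Val} (hf : PolyTime S f) :
    ∃ p : Polynomial ℕ, ∀ x ∈ S, b.size (f x) ≤ p.eval (a.size x) := by
  obtain ⟨P, p, h⟩ := hf
  refine ⟨p, fun x hx => ?_⟩
  obtain ⟨c, hc, hp⟩ := h x hx
  exact hc.size_le.trans hp

theorem mono {T : Set a.Val} {f : a.Val → b.Val} (hf : PolyTime T f) (h : S ⊆ T) :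
    PolyTime S f := by
  obtain ⟨P, p, h'⟩ := hf
  exact ⟨P, p, fun x hx => h' x (h hx)⟩

theorem congr {f g : a.Val → b.Val} (hf : PolyTime S f) (h : ∀ x ∈ S, f x = g x) :
    PolyTime S g := by
  obtain ⟨P, p, h'⟩ := hf
  exact ⟨P, p, fun x hx => h x hx ▸ h' x hx⟩

theorem of_prim (o : Prim a b) (p : Polynomial ℕ)
    (h : ∀ x, b.size (o.apply x) ≤ p.eval (a.size x)) : PolyTime S o.apply := by
  refine ⟨.prim o, (Polynomial.X + p) ^ 2, fun x _ => ⟨_, .prim o x, ?_⟩⟩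
  simp only [Polynomial.eval_pow, Polynomial.eval_add, Polynomial.eval_X]
  have := h x
  gcongr

/-- The cost of `g` is a polynomial in the size of `f x`, and that size is at most the cost of `f`.
The set `T` allows for functions that are polynomial only on well-formed data. -/
theorem comp {T : Set b.Val} {g : b.Val → c.Val} {f : a.Val → b.Val} (hg : PolyTime T g)
    (hf : PolyTime S f) (h : ∀ x ∈ S, f x ∈ T) : PolyTime S (fun x => g (f x)) := by
  obtain ⟨P, p, hP⟩ := hf
  obtain ⟨Q, q, hQ⟩ := hg
  refine ⟨.comp Q P, p + q.comp p + 1, fun x hx => ?_⟩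
  obtain ⟨s, hs, hsp⟩ := hP x hx
  obtain ⟨t, ht, htq⟩ := hQ _ (h x hx)
  refine ⟨_, .comp hs ht, ?_⟩
  simp only [Polynomial.eval_add, Polynomial.eval_comp, Polynomial.eval_one]
  have := htq.trans (eval_le_eval q (hs.size_le.trans hsp))
  omega

theorem comp_univ {g : b.Val → c.Val} {f : a.Val → b.Val} (hg : PolyTime Set.univ g)
    (hf : PolyTime S f) : PolyTime S (fun x => g (f x)) :=
  hg.comp hf fun _ _ => trivial

theorem pair {f : a.Val → b.Val} {g : a.Val → c.Val} (hf : PolyTime S f) (hg : PolyTime S g) :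
    PolyTime (b := .prod b c) S (fun x => (f x, g x)) := by
  obtain ⟨P, p, hP⟩ := hf
  obtain ⟨Q, q, hQ⟩ := hg
  refine ⟨.pair P Q, p + q + Polynomial.X, fun x hx => ?_⟩
  obtain ⟨s, hs, hsp⟩ := hP x hx
  obtain ⟨t, ht, htq⟩ := hQ x hx
  refine ⟨_, .pair hs ht, ?_⟩
  simp only [Polynomial.eval_add, Polynomial.eval_X]
  omega

theorem id' : PolyTime S (fun x : a.Val => x) :=
  of_prim (.id a) .X fun x => by simp [Prim.apply]

theorem const_int (z : ℤ) : PolyTime (b := .int) S (fun _ => z) :=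
  of_prim (.const a z) (Polynomial.C (Ty.int.size z)) fun x => by simp [Prim.apply]

theorem nil : PolyTime (b := .list b) S (fun _ => []) :=
  of_prim (.nil a b) 1 fun x => by simp [Prim.apply, Ty.size]

theorem fst {f : a.Val → (Ty.prod b c).Val} (hf : PolyTime S f) : PolyTime S (fun x => (f x).1) :=
  comp_univ (of_prim (.fst b c) .X fun x => by simp [Prim.apply, Ty.size]; omega) hf

theorem snd {f : a.Val → (Ty.prod b c).Val} (hf : PolyTime S f) : PolyTime S (fun x => (f x).2) :=
  comp_univ (of_prim (.snd b c) .X fun x => by simp [Prim.apply, Ty.size]; omega) hf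

theorem cons {f : a.Val → b.Val} {g : a.Val → List b.Val} (hf : PolyTime S f)
    (hg : PolyTime (b := .list b) S g) : PolyTime (b := .list b) S (fun x => f x :: g x) :=
  comp_univ (of_prim (.cons b) .X fun x => by
    simp only [Prim.apply, Ty.size_cons, Polynomial.eval_X]
    simp only [Ty.size_prod]; omega) (hf.pair hg)

theorem binary {o : Prim (.prod .int .int) .int}
    (h : ∀ x, Ty.int.size (o.apply x) ≤ (Ty.prod .int .int).size x + 1) {f g : a.Val → ℤ}
    (hf : PolyTime (b := .int) S f) (hg : PolyTime (b := .int) S g) :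
    PolyTime (b := .int) S (fun x => o.apply (f x, g x)) :=
  comp_univ (of_prim o (.X + 1) fun x => by simpa using h x) (hf.pair hg)


theorem add {f g : a.Val → ℤ} (hf : PolyTime (b := .int) S f) (hg : PolyTime (b := .int) S g) :
    PolyTime (b := .int) S (fun x => f x + g x) :=
  binary (o := .add) (fun x => by
    have := Ty.size_add x.1 x.2
    simp only [Prim.apply, Ty.size] at this ⊢; omega) hf hg

theorem sub {f g : a.Val → ℤ} (hf : PolyTime (b := .int) S f) (hg : PolyTime (b := .int) S g) :
    PolyTime (b := .int) S (fun x => f x - g x) :=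
  binary (o := .sub) (fun x => by
    have := Ty.size_sub x.1 x.2
    simp only [Prim.apply, Ty.size] at this ⊢; omega) hf hg

theorem mul {f g : a.Val → ℤ} (hf : PolyTime (b := .int) S f) (hg : PolyTime (b := .int) S g) :
    PolyTime (b := .int) S (fun x => f x * g x) :=
  binary (o := .mul) (fun x => by
    have := Ty.size_mul x.1 x.2
    simp only [Prim.apply, Ty.size] at this ⊢; omega) hf hg

theorem div {f g : a.Val → ℤ} (hf : PolyTime (b := .int) S f) (hg : PolyTime (b := .int) S g) :
    PolyTime (b := .int) S (fun x => f x / g x) :=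
  binary (o := .div) (fun x => by
    have := Ty.size_mono (Int.natAbs_ediv_le_natAbs x.1 x.2)
    simp only [Prim.apply, Ty.size] at this ⊢; omega) hf hg

theorem le {f g : a.Val → ℤ} (hf : PolyTime (b := .int) S f) (hg : PolyTime (b := .int) S g) :
    PolyTime (b := .int) S (fun x => if f x ≤ g x then 1 else 0) :=
  binary (o := .le) (fun x => by
    simp only [Prim.apply]
    split_ifs <;> simp [Ty.size]) hf hg

theorem ite {t : a.Val → ℤ} {f g : a.Val → b.Val} (ht : PolyTime (b := .int) S t)
    (hf : PolyTime {x ∈ S | t x ≠ 0} f) (hg : PolyTime {x ∈ S | t x = 0} g) :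
    PolyTime S (fun x => if t x = 0 then g x else f x) := by
  obtain ⟨P, p, hP⟩ := ht
  obtain ⟨Q, q, hQ⟩ := hf
  obtain ⟨R, r, hR⟩ := hg
  refine ⟨.ite P Q R, p + q + r + .X, fun x hx => ?_⟩
  obtain ⟨s, hs, hsp⟩ := hP x hx
  simp only [Polynomial.eval_add, Polynomial.eval_X]
  by_cases h : t x = 0
  · obtain ⟨k, hk, hkr⟩ := hR x ⟨hx, h⟩
    simp only [h, if_true] at hs ⊢
    exact ⟨_, .ite_false hs rfl hk, by omega⟩
  · obtain ⟨k, hk, hkr⟩ := hQ x ⟨hx, h⟩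
    simp only [h, if_false] at hs ⊢
    exact ⟨_, .ite_true hs h hk, by omega⟩

theorem ite_eq_zero {t : a.Val → ℤ} {f g : a.Val → b.Val} (ht : PolyTime (b := .int) S t)
    (hf : PolyTime S f) (hg : PolyTime S g) :
    PolyTime S (fun x => if t x = 0 then f x else g x) :=
  ite ht (hg.mono (Set.sep_subset _ _)) (hf.mono (Set.sep_subset _ _))

theorem ite_le {t s : a.Val → ℤ} {f g : a.Val → b.Val} (ht : PolyTime (b := .int) S t)
    (hs : PolyTime (b := .int) S s) (hf : PolyTime S f) (hg : PolyTime S g) :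
    PolyTime S (fun x => if t x ≤ s x then f x else g x) :=
  (ite_eq_zero (le ht hs) hg hf).congr fun x _ => by split_ifs <;> simp_all

theorem listCase {l : a.Val → List b.Val} {f : a.Val → c.Val}
    {g : (Ty.prod a (.prod b (.list b))).Val → c.Val} (hl : PolyTime (b := .list b) S l)
    {T : Set (Ty.prod a (.prod b (.list b))).Val}
    (hf : PolyTime {x ∈ S | l x = []} f) (hg : PolyTime T g)
    (h : ∀ x ∈ S, ∀ y t, l x = y :: t → (x, (y, t)) ∈ T) :
    PolyTime S (fun x => match l x with
      | [] => f x
      | y :: t => g (x, (y, t))) := by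
  obtain ⟨P, p, hP⟩ := hf
  obtain ⟨Q, q, hQ⟩ := hg
  -- The program receives a pair of `x` and a list; on the graph of `l` the hypotheses about the two
  -- branches become available.
  have key : PolyTime {x : (Ty.prod a (.list b)).Val | x.1 ∈ S ∧ x.2 = l x.1}
      (fun x : (Ty.prod a (.list b)).Val => match x.2 with
      | [] => f x.1
      | y :: t => g (x.1, (y, t))) := by
    refine ⟨.listCase P Q, p + q + .X, fun x hx => ?_⟩
    obtain ⟨x, m⟩ := x
    obtain ⟨hx, hm⟩ := hx
    simp only [Polynomial.eval_add, Polynomial.eval_X] at hm ⊢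
    cases m with
    | nil =>
      obtain ⟨s, hs, hsp⟩ := hP x ⟨hx, hm.symm⟩
      refine ⟨_, .listCase_nil hs, ?_⟩
      simp only [Ty.size_prod, Ty.size_nil]
      have := eval_le_eval p (m := a.size x) (n := a.size x + 1 + 1) (by omega)
      omega
    | cons y t =>
      obtain ⟨s, hs, hsp⟩ := hQ _ (h x hx y t hm.symm)
      refine ⟨_, .listCase_cons hs, ?_⟩
      have h1 : (Ty.prod a (.prod b (.list b))).size (x, (y, t)) =
        (Ty.prod a (.list b)).size (x, y :: t) := by
        simp only [Ty.size_prod, Ty.size_cons]; omega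
      rw [h1] at hsp
      have : (Ty.prod a (.list b)).size (x, y :: t) = a.size x + (Ty.list b).size (y :: t) + 1 :=
        rfl
      omega
  exact key.comp (id'.pair hl) fun x hx => ⟨hx, rfl⟩

/-- The left fold of `F`, with context `x`: all intermediate accumulators have to be of polynomial
size. -/
theorem foldl {F : (Ty.prod a (.prod c b)).Val → c.Val} {i : a.Val → c.Val}
    {l : a.Val → List b.Val} {T : Set (Ty.prod a (.prod c b)).Val} (hF : PolyTime T F)
    (hi : PolyTime S i) (hl : PolyTime (b := .list b) S l) (q : Polynomial ℕ)
    (hT : ∀ x ∈ S, ∀ l₁ y l₂, l x = l₁ ++ y :: l₂ →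
      (x, (l₁.foldl (fun s y => F (x, (s, y))) (i x), y)) ∈ T)
    (hq : ∀ x ∈ S, ∀ l₁ l₂, l x = l₁ ++ l₂ →
      c.size (l₁.foldl (fun s y => F (x, (s, y))) (i x)) ≤ q.eval (a.size x)) :
    PolyTime S (fun x => (l x).foldl (fun s y => F (x, (s, y))) (i x)) := by
  -- Loop state: context and accumulator, together with the part of the list still to be read.
  let st : Ty := .prod (.prod a c) (.list b)
  have h1 : PolyTime (a := st) (b := .int) Set.univ (fun x => match x.2 with
      | [] => (0 : ℤ)
      | _ :: _ => 1) :=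
    listCase (b := b) (c := .int) (g := fun _ => (1 : ℤ)) (T := Set.univ) id'.snd (const_int 0)
      (const_int 1) (by simp)
  have h2 : PolyTime (a := st) (b := st) {x | ∀ y t, x.2 = y :: t → (x.1.1, (x.1.2, y)) ∈ T}
      (fun x => match x.2 with
      | [] => x
      | y :: t => ((x.1.1, F (x.1.1, (x.1.2, y))), t)) := by
    refine listCase (a := st) (b := b) (c := st)
      (g := fun x => ((x.1.1.1, F (x.1.1.1, (x.1.1.2, x.2.1))), x.2.2))
      (T := {x | (x.1.1.1, (x.1.1.2, x.2.1)) ∈ T}) id'.snd id' ?_ ?_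
    · exact (id'.fst.fst.fst.pair
        (hF.comp (id'.fst.fst.fst.pair (id'.fst.fst.snd.pair id'.snd.fst)) fun x hx => hx)).pair
        id'.snd.snd
    · intro x hx y t hy
      exact hx y t hy
  obtain ⟨Pt, pt, hPt⟩ := h1
  obtain ⟨Pb, pb, hPb⟩ := h2
  have h3 : PolyTime (a := st) (b := st) {x | x.1.1 ∈ S ∧ x.1.2 = i x.1.1 ∧ x.2 = l x.1.1}
      (fun x => ((x.1.1, x.2.foldl (fun s y => F (x.1.1, (s, y))) x.1.2), [])) := by
    -- `M` bounds the size of every loop state: context, accumulator, remaining list, and 2 for the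
    -- two pairs. Each round costs at most one test, one body and one state; the factor `.X + 1`
    -- counts the list cells plus the final test.
    let M : Polynomial ℕ := .X + q + .X + 2
    refine ⟨.loop Pt Pb, (.X + 1) * (pt.comp M + pb.comp M + M), ?_⟩
    rintro ⟨⟨x, s₀⟩, m⟩ ⟨hx, hs, hm⟩
    simp only at hx hs hm
    have key : ∀ l₂ l₁, l x = l₁ ++ l₂ → ∃ k, (Prog.loop Pt Pb).Eval
        ((x, l₁.foldl (fun s y => F (x, (s, y))) (i x)), l₂)
        ((x, (l x).foldl (fun s y => F (x, (s, y))) (i x)), []) k ∧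
        k ≤ (l₂.length + 1) * (pt.comp M + pb.comp M + M).eval (st.size ((x, s₀), m)) := by
      intro l₂
      induction l₂ with
      | nil =>
        intro l₁ h
        obtain ⟨k, hk, hkp⟩ := hPt ((x, l₁.foldl (fun s y => F (x, (s, y))) (i x)), []) trivial
        rw [show l x = l₁ by simpa using h]
        refine ⟨_, .loop_done hk rfl, ?_⟩
        have h4 := hq x hx _ _ h
        have h5 : st.size ((x, l₁.foldl (fun s y => F (x, (s, y))) (i x)), []) ≤
            M.eval (st.size ((x, s₀), m)) := by
          have h6 : a.size x ≤ st.size ((x, s₀), m) := by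
            simp only [st, Ty.size_prod]; omega
          have h7 := eval_le_eval q h6
          simp only [st, Ty.size_prod, Ty.size_nil, M, Polynomial.eval_add, Polynomial.eval_X,
            Polynomial.eval_ofNat] at h6 h7 ⊢
          omega
        have h8 := eval_le_eval pt h5
        simp only [Polynomial.eval_add, Polynomial.eval_comp, List.length_nil]
        omega
      | cons y l₂ ih =>
        intro l₁ h
        obtain ⟨k, hk, hkp⟩ :=
          hPt ((x, l₁.foldl (fun s y => F (x, (s, y))) (i x)), y :: l₂) trivial
        obtain ⟨j, hj, hjp⟩ :=
          hPb ((x, l₁.foldl (fun s y => F (x, (s, y))) (i x)), y :: l₂) (by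
            intro y' t' hyt
            obtain ⟨rfl, rfl⟩ := List.cons.inj hyt
            exact hT x hx _ _ _ h)
        obtain ⟨r, hr, hrp⟩ := ih (l₁ ++ [y]) (by simpa using h)
        rw [List.foldl_append] at hr
        refine ⟨_, .loop_step hk one_ne_zero hj hr, ?_⟩
        have h4 := hq x hx _ _ h
        have h5 : st.size ((x, l₁.foldl (fun s y => F (x, (s, y))) (i x)), y :: l₂) ≤
            M.eval (st.size ((x, s₀), m)) := by
          have h6 : a.size x ≤ st.size ((x, s₀), m) := by
            simp only [st, Ty.size_prod]; omega
          have h7 := eval_le_eval q h6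
          have h8 : (Ty.list b).size (y :: l₂) ≤ (Ty.list b).size m := by
            have := Ty.size_append l₁ (y :: l₂)
            rw [hm, h]
            have := (Ty.list b).size_pos l₁
            omega
          simp only [st, Ty.size_prod, M, Polynomial.eval_add, Polynomial.eval_X,
            Polynomial.eval_ofNat] at h6 h7 ⊢
          omega
        have h8 := eval_le_eval pt h5
        have h9 := eval_le_eval pb h5
        simp only [Polynomial.eval_add, Polynomial.eval_comp, List.length_cons] at hrp ⊢
        rw [Nat.succ_mul (l₂.length + 1)]
        omega
    obtain ⟨k, hk, hkp⟩ := key m [] (by simpa using hm.symm)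
    subst hs hm
    refine ⟨k, hk, hkp.trans ?_⟩
    simp only [Polynomial.eval_mul, Polynomial.eval_add, Polynomial.eval_X, Polynomial.eval_one]
    gcongr
    have := Ty.length_le_size (l x)
    simp only [st, Ty.size_prod]
    omega
  have h4 : PolyTime (b := st) S
      (fun x => ((x, (l x).foldl (fun s y => F (x, (s, y))) (i x)), [])) :=
    h3.comp ((id'.pair hi).pair hl) fun x hx => ⟨hx, rfl, rfl⟩
  exact h4.fst.snd

/-- A left fold where each step increases the size of the accumulator by a polynomial in the sizes
of the context and the list element. -/
theorem foldl_of_size_le {F : (Ty.prod a (.prod c b)).Val → c.Val} {i : a.Val → c.Val}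
    {l : a.Val → List b.Val} {T : Set (Ty.prod a b).Val}
    (hF : PolyTime {x : (Ty.prod a (.prod c b)).Val | (x.1, x.2.2) ∈ T} F)
    (hi : PolyTime S i) (hl : PolyTime (b := .list b) S l) (q : Polynomial ℕ)
    (hT : ∀ x ∈ S, ∀ y ∈ l x, (x, y) ∈ T)
    (hq : ∀ x s y, (x, y) ∈ T →
      c.size (F (x, (s, y))) ≤ c.size s + q.eval ((Ty.prod a b).size (x, y))) :
    PolyTime S (fun x => (l x).foldl (fun s y => F (x, (s, y))) (i x)) := by
  obtain ⟨p, hp⟩ := hi.size_le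
  obtain ⟨r, hr⟩ := hl.size_le
  -- The start value has size at most `p`; there are at most `r` steps, and each adds at most `q` at
  -- the size of a pair (x, y), which is at most `.X + r + 1`.
  refine foldl hF hi hl (p + r * q.comp (.X + r + 1)) ?_ ?_
  · intro x hx l₁ y l₂ h
    exact hT x hx y (by simp [h])
  · intro x hx l₁ l₂ h
    simp only [Polynomial.eval_add, Polynomial.eval_mul, Polynomial.eval_comp, Polynomial.eval_X,
      Polynomial.eval_one]
    have key : ∀ (l₁ : List b.Val) (s : c.Val), (∀ y ∈ l₁, y ∈ l x) →
        c.size (l₁.foldl (fun s y => F (x, (s, y))) s) ≤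
          c.size s + l₁.length * q.eval (a.size x + r.eval (a.size x) + 1) := by
      intro l₁
      induction l₁ with
      | nil => simp
      | cons y l₁ ih =>
        intro s h
        have h1 := ih (F (x, (s, y))) fun z hz => h z (List.mem_cons_of_mem _ hz)
        have hy := h y List.mem_cons_self
        have h2 := hq x s y (hT x hx y hy)
        have h3 : (Ty.prod a b).size (x, y) ≤ a.size x + r.eval (a.size x) + 1 := by
          have := hr x hx
          have := Ty.size_le_of_mem hy
          simp only [Ty.size_prod]; omega
        have h4 := eval_le_eval q h3
        rw [List.foldl_cons, List.length_cons, Nat.succ_mul]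
        omega
    refine (key l₁ (i x) fun y hy => by simp [h, hy]).trans ?_
    have := hp x hx
    gcongr
    calc l₁.length ≤ (l x).length := by simp [h]
      _ ≤ _ := Ty.length_le_size _
      _ ≤ _ := hr x hx

theorem reverse {f : a.Val → List b.Val} (hf : PolyTime (b := .list b) S f) :
    PolyTime (b := .list b) S (fun x => (f x).reverse) := by
  have : PolyTime (b := .list b) S
      (fun x => (f x).foldl (fun s y => (fun z : (Ty.prod a (.prod (.list b) b)).Val =>
        z.2.2 :: z.2.1) (x, (s, y))) []) :=
    foldl_of_size_le (T := Set.univ) (id'.snd.snd.cons id'.snd.fst) nil hf .X (by simp)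
      fun x s y _ => by
        simp only [Ty.size_cons, Polynomial.eval_X, Ty.size_prod]; omega
  refine this.congr fun x _ => ?_
  rw [← List.foldr_reverse]
  simp

theorem map {F : (Ty.prod a b).Val → c.Val} {f : a.Val → List b.Val} {T : Set (Ty.prod a b).Val}
    (hF : PolyTime T F) (hf : PolyTime (b := .list b) S f)
    (hT : ∀ x ∈ S, ∀ y ∈ f x, (x, y) ∈ T) :
    PolyTime (b := .list c) S (fun x => (f x).map fun y => F (x, y)) := by
  obtain ⟨q, hq⟩ := hF.size_le
  have : PolyTime (b := .list c) S
      (fun x => (f x).foldl (fun s y => (fun z : (Ty.prod a (.prod (.list c) b)).Val =>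
        F (z.1, z.2.2) :: z.2.1) (x, (s, y))) []) :=
    foldl_of_size_le (c := .list c) (T := T)
      (F := fun z : (Ty.prod a (.prod (.list c) b)).Val => F (z.1, z.2.2) :: z.2.1)
      ((hF.comp (id'.fst.pair id'.snd.snd) fun x hx => hx).cons id'.snd.fst) nil hf (q + 1) hT
      fun x s y h => by
        have := hq _ h
        simp only [Ty.size_cons, Polynomial.eval_add, Polynomial.eval_one]; omega
  refine this.reverse.congr fun x _ => ?_
  rw [← List.foldr_reverse]
  simp

theorem map_univ {F : (Ty.prod a b).Val → c.Val} {f : a.Val → List b.Val}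
    (hF : PolyTime Set.univ F) (hf : PolyTime (b := .list b) S f) :
    PolyTime (b := .list c) S (fun x => (f x).map fun y => F (x, y)) :=
  map hF hf fun _ _ _ _ => trivial

end PolyTime

/-! ### Euclid's algorithm and zipping -/

namespace PolyTime

variable {a b c d : Ty} {S : Set a.Val}

/-- Euclid's algorithm (x, y) ↦ (y, x mod y). For 0 < y ≤ x one has 2 (x mod y) ≤ x, so the product
of the two entries at least halves in each round. Since it is initially below 2 to the power of
twice the input size, the number of rounds is linear in the input size. The entries never grow, so a
single bound `M` on their size serves all rounds. -/
theorem gcd_of_le : PolyTime (a := .prod .int .int) (b := .int) {x | 0 ≤ x.2 ∧ x.2 ≤ x.1}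
    (fun x => (Int.gcd x.1 x.2 : ℤ)) := by
  let st : Ty := .prod .int .int
  have h1 : PolyTime (a := st) (b := .int) Set.univ (fun x => x.2) := id'.snd
  have h2 : PolyTime (a := st) (b := st) Set.univ
      (fun x => (x.2, (x.1 - x.2 * (x.1 / x.2) : ℤ))) :=
    id'.snd.pair (id'.fst.sub (id'.snd.mul (id'.fst.div id'.snd)))
  obtain ⟨Pt, pt, hPt⟩ := h1
  obtain ⟨Pb, pb, hPb⟩ := h2
  have key : ∀ (M e : ℕ) (x y : ℤ), 0 ≤ y → y ≤ x → x * y < 2 ^ e → Ty.int.size x ≤ M →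
      ∃ k, (Prog.loop Pt Pb).Eval (x, y) ((Int.gcd x y : ℤ), (0 : ℤ)) k ∧
        k ≤ (e + 1) * (pt.eval (2 * M + 1) + pb.eval (2 * M + 1) + (2 * M + 1)) := by
    intro M e
    induction e with
    | zero =>
      intro x y hy hyx hxy hM
      have hy0 : y = 0 := by
        by_contra h
        have : 0 < y := by omega
        nlinarith
      subst hy0
      obtain ⟨k, hk, hkp⟩ := hPt (x, (0 : ℤ)) trivial
      have hs : st.size (x, (0 : ℤ)) ≤ 2 * M + 1 := by
        have := Ty.size_mono (y := 0) (z := x) (by simp)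
        simp only [st, Ty.size_prod]; omega
      have h3 := eval_le_eval pt hs
      refine ⟨k + st.size (x, (0 : ℤ)), ?_, by omega⟩
      have h4 : (Int.gcd x 0 : ℤ) = x := by simp; omega
      rw [h4]
      exact .loop_done hk rfl
    | succ e ih =>
      intro x y hy hyx hxy hM
      obtain ⟨k, hk, hkp⟩ := hPt (x, y) trivial
      have hsy := Ty.size_mono (y := y) (z := x) (by omega)
      have hs : st.size (x, y) ≤ 2 * M + 1 := by simp only [st, Ty.size_prod]; omega
      have h3 := eval_le_eval pt hs
      by_cases hy0 : y = 0
      · subst hy0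
        refine ⟨k + st.size (x, (0 : ℤ)), ?_, ?_⟩
        · have h4 : (Int.gcd x 0 : ℤ) = x := by simp; omega
          rw [h4]
          exact .loop_done hk rfl
        · rw [Nat.succ_mul]; omega
      · obtain ⟨j, hj, hjp⟩ := hPb (x, y) trivial
        have h5 := eval_le_eval pb hs
        have hy' : 0 < y := by omega
        have hmod : x - y * (x / y) = x % y := by have := Int.mul_ediv_add_emod x y; omega
        have hm0 := Int.emod_nonneg x hy0
        have hm1 := Int.emod_lt_of_pos x hy'
        have hq : 1 ≤ x / y := Int.le_ediv_of_mul_le hy' (by omega)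
        have hm2 : 2 * (x % y) ≤ x := by nlinarith [Int.mul_ediv_add_emod x y]
        obtain ⟨r, hr, hrp⟩ := ih y (x % y) hm0 hm1.le (by rw [pow_succ] at hxy; nlinarith)
          (by omega)
        have h6 : (Int.gcd x y : ℤ) = Int.gcd y (x % y) := by
          rw [Int.gcd_comm y, Int.gcd_emod]
        rw [← hmod] at hr
        refine ⟨k + j + r + st.size (x, y), ?_, ?_⟩
        · rw [h6, ← hmod]
          exact .loop_step hk hy0 hj hr
        · rw [Nat.succ_mul (e + 1)]; omega
  have h3 : PolyTime (a := st) (b := st) {x | 0 ≤ x.2 ∧ x.2 ≤ x.1}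
      (fun x => ((Int.gcd x.1 x.2 : ℤ), (0 : ℤ))) := by
    let M : Polynomial ℕ := 2 * .X + 1
    refine ⟨.loop Pt Pb, (2 * .X + 1) * (pt.comp M + pb.comp M + M), ?_⟩
    rintro ⟨x, y⟩ ⟨h0, h1⟩
    have hx : Ty.int.size x ≤ st.size (x, y) := by simp only [st, Ty.size_prod]; omega
    simp only at h0 h1
    obtain ⟨k, hk, hkp⟩ := key (st.size (x, y)) (2 * st.size (x, y)) x y h0 h1 (by
      have h4 := (Ty.natAbs_lt_two_pow_size x).trans_le (Nat.pow_le_pow_right (by norm_num) hx)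
      have h5 : x < 2 ^ st.size (x, y) := by zify at h4; rwa [abs_of_nonneg (h0.trans h1)] at h4
      rw [two_mul, pow_add]
      nlinarith) hx
    refine ⟨k, hk, hkp.trans (le_of_eq ?_)⟩
    simp [M, st]
  exact h3.fst

theorem abs {f : a.Val → ℤ} (hf : PolyTime (b := .int) S f) :
    PolyTime (b := .int) S (fun x => |f x|) :=
  (ite_le (const_int 0) hf hf ((const_int 0).sub hf)).congr fun x _ => by
    split_ifs with h
    · rw [abs_of_nonneg h]
    · rw [abs_of_neg (lt_of_not_ge h), zero_sub]

/-- Passing to |f| + |g| and |g| keeps the gcd and puts the arguments into the order that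
`gcd_of_le` requires. -/
theorem gcd {f g : a.Val → ℤ} (hf : PolyTime (b := .int) S f) (hg : PolyTime (b := .int) S g) :
    PolyTime (b := .int) S (fun x => (Int.gcd (f x) (g x) : ℤ)) := by
  refine (gcd_of_le.comp ((hf.abs.add hg.abs).pair hg.abs) fun x _ => ?_).congr fun x _ => ?_
  · exact ⟨abs_nonneg _, by simp⟩
  · have h : Int.gcd (|f x| + |g x|) |g x| = Int.gcd |f x| |g x| := by simp
    rw [h]
    simp only [Int.gcd, Int.natAbs_abs]

theorem zip {f : a.Val → List b.Val} {g : a.Val → List c.Val} (hf : PolyTime (b := .list b) S f)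
    (hg : PolyTime (b := .list c) S g) :
    PolyTime (b := .list (.prod b c)) S (fun x => (f x).zip (g x)) := by
  let ac : Ty := .prod (.list c) (.list (.prod b c))
  -- The accumulator holds the unread part of the second list and the zipped pairs in reverse order.
  let F : (Ty.prod a (.prod ac b)).Val → ac.Val := fun z => match z.2.1.1 with
    | [] => z.2.1
    | y :: t => (t, (z.2.2, y) :: z.2.1.2)
  have hF : PolyTime Set.univ F :=
    listCase (a := .prod a (.prod ac b)) (c := ac)
      (g := fun z => (z.2.2, (z.1.2.2, z.2.1) :: z.1.2.1.2)) (T := Set.univ)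
      id'.snd.fst.fst id'.snd.fst
      (id'.snd.snd.pair ((id'.fst.snd.snd.pair id'.snd.fst).cons id'.fst.snd.fst.snd))
      (by simp)
  have h : PolyTime (b := ac) S (fun x => (f x).foldl (fun s y => F (x, (s, y))) (g x, [])) := by
    refine foldl_of_size_le (T := Set.univ) (by simpa using hF) (hg.pair nil) hf (.X + 1)
      (by simp) fun x s y _ => ?_
    obtain ⟨s, l⟩ := s
    cases s with
    | nil => simp [F]
    | cons z s =>
      have := Ty.size_cons (a := .prod b c) (y, z) l
      simp only [F, ac, Ty.size_prod, Ty.size_cons, Polynomial.eval_add, Polynomial.eval_X,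
        Polynomial.eval_one] at this ⊢
      omega
  refine h.snd.reverse.congr fun x _ => ?_
  have key : ∀ (l : List b.Val) (m : List c.Val) (o : List (b.Val × c.Val)),
      (l.foldl (fun s y => F (x, (s, y))) (m, o)).2 = (l.zip m).reverse ++ o := by
    intro l
    induction l with
    | nil => simp
    | cons y l ih =>
      intro m o
      cases m with
      | nil => simpa [F] using ih [] o
      | cons z m => simpa [F] using ih m ((y, z) :: o)
  rw [key]; simp

end PolyTime

/-! ### Integer linear algebra on lists -/

/-- The dot product. -/
def dot (x y : List ℤ) : ℤ := (x.zip y).foldl (fun s p => s + p.1 * p.2) 0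

/-- The linear combination `c x - d y`. -/
def comb (c d : ℤ) (x y : List ℤ) : List ℤ := (x.zip y).map fun p => c * p.1 - d * p.2

/-- The greatest common divisor of the entries. -/
def content (x : List ℤ) : ℤ := x.foldl (fun s z => (Int.gcd s z : ℤ)) 0

/-- The vector divided by the greatest common divisor of its entries. -/
def primPart (x : List ℤ) : List ℤ := x.map fun z => z / content x

/-- The first vector in `K` not orthogonal to `r`, if there is one. -/
def pivot (r : List ℤ) (K : List (List ℤ)) : List ℤ :=
  K.foldl (fun p k => if dot r p = 0 then k else p) []

/-- Replace a spanning set `K` of a space by one of its intersection with the orthogonal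
complement of `r`. -/
def elim (r : List ℤ) (K : List (List ℤ)) : List (List ℤ) :=
  if dot r (pivot r K) = 0 then K
  else K.map fun k => primPart (comb (dot r (pivot r K)) (dot r k) k (pivot r K))

/-- Process those rows of a matrix that are orthogonal to `x`. -/
def elimRows (x : List ℤ) (M : List (List ℤ)) (K : List (List ℤ)) : List (List ℤ) :=
  M.foldl (fun K r => if dot r x = 0 then elim r K else K) K

/-- The identity matrix of the size of the list. -/
def identity (l : List ℤ) : List (List ℤ) :=
  l.foldl (fun I _ => (1 :: I.map fun _ => 0) :: I.map fun r => 0 :: r) []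

/-- A spanning set for the space of the vectors orthogonal to those rows of `A` and `B` to which `x`
is orthogonal. -/
def kernelSpan (A B : List (List ℤ)) (x : List ℤ) : List (List ℤ) :=
  elimRows x B (elimRows x A (identity x))

/-- Numerator and denominator of the ratio `(B x)_j / (B y)_j` of least absolute value. -/
def minRatio (B : List (List ℤ)) (x y : List ℤ) : ℤ × ℤ :=
  B.foldl (fun s r => if (s.1 * dot r y) * (s.1 * dot r y) ≤ (s.2 * dot r x) * (s.2 * dot r x)
    then s else (dot r x, dot r y)) (1, 0)

/-- A positive multiple of `x - (p / q) y`. -/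
def subMul (p q : ℤ) (x y : List ℤ) : List ℤ := comb (q * q) (p * q) x y

/-- Move from `x` in direction `y` until an inequality becomes tight, unless this leads to `0`. -/
def moveTo (B : List (List ℤ)) (x y : List ℤ) : List ℤ :=
  if content (subMul (minRatio B x y).1 (minRatio B x y).2 x y) = 0 then x
  else subMul (minRatio B x y).1 (minRatio B x y).2 x y

/-- Successive moves. -/
def moves (B : List (List ℤ)) (x : List ℤ) (K : List (List ℤ)) : List ℤ :=
  K.foldl (fun x y => moveTo B x y) x

/-- Move from `w` to a positive multiple of a circuit. -/
def descend (A B : List (List ℤ)) (w : List ℤ) : List ℤ :=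
  w.foldl (fun x _ => moves B x (kernelSpan A B x)) w

/-- Lowest terms. -/
def lowest (x y : ℤ) : ℤ × ℤ := (x / Int.gcd x y, y / Int.gcd x y)

/-- One pass of the algorithm; the current vector is `s.1 / s.2.1`, and `s.2.2` are the terms found
so far, in reverse order. -/
def pass (A B : List (List ℤ)) (s : List ℤ × ℤ × List (List ℤ × ℤ × ℤ)) :
    List ℤ × ℤ × List (List ℤ × ℤ × ℤ) :=
  if content s.1 = 0 then s
  else
    let g := primPart (descend A B s.1)
    let m := minRatio B s.1 g
    (subMul m.1 m.2 s.1 g, m.2 * m.2 * s.2.1,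
      (g, lowest (m.1 * m.2) (m.2 * m.2 * s.2.1)) :: s.2.2)

/-- The product of the denominators. -/
def denProd (r : List (ℤ × ℤ)) : ℤ := r.foldl (fun s z => s * z.2) 1

/-- A rational vector multiplied by the product of the denominators of its entries. -/
def clear (r : List (ℤ × ℤ)) : List ℤ := r.map fun z => z.1 * (denProd r / z.2)

/-- The whole algorithm. -/
def decompose (A B : List (List (ℤ × ℤ))) (u : List (ℤ × ℤ)) : List (List ℤ × ℤ × ℤ) :=
  (u.foldl (fun s _ => pass (A.map clear) (B.map clear) s) (clear u, denProd u, [])).2.2.reverse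

/-- Integer vectors. -/
abbrev Ty.vec : Ty := .list .int

/-- Integer matrices, as lists of rows. -/
abbrev Ty.mat : Ty := .list .vec

/-! ### Single list operations in polynomial time -/

namespace PolyTime

variable {a b c : Ty} {S : Set a.Val}

theorem dot {f g : a.Val → List ℤ} (hf : PolyTime (b := .vec) S f)
    (hg : PolyTime (b := .vec) S g) : PolyTime (b := .int) S (fun x => dot (f x) (g x)) :=
  foldl_of_size_le (c := .int) (b := .prod .int .int) (T := Set.univ)
    (F := fun z => (z.2.1 + z.2.2.1 * z.2.2.2 : ℤ))
    (id'.snd.fst.add (id'.snd.snd.fst.mul id'.snd.snd.snd)) (const_int 0) (hf.zip hg) .X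
    (by simp) fun x s y _ => by
      have h1 := Ty.size_add s (y.1 * y.2)
      have h2 := Ty.size_mul y.1 y.2
      simp only [Ty.size_prod, Polynomial.eval_X]
      omega

theorem comb {s t : a.Val → ℤ} {f g : a.Val → List ℤ} (hs : PolyTime (b := .int) S s)
    (ht : PolyTime (b := .int) S t) (hf : PolyTime (b := .vec) S f)
    (hg : PolyTime (b := .vec) S g) :
    PolyTime (b := .vec) S (fun x => comb (s x) (t x) (f x) (g x)) :=
  map (b := .prod .int .int) (c := .int) (T := {z | z.1 ∈ S})
    (F := fun z => (s z.1 * z.2.1 - t z.1 * z.2.2 : ℤ))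
    (((hs.comp id'.fst fun _ h => h).mul id'.snd.fst).sub
      ((ht.comp id'.fst fun _ h => h).mul id'.snd.snd)) (hf.zip hg) (fun _ h _ _ => h)

theorem content {f : a.Val → List ℤ} (hf : PolyTime (b := .vec) S f) :
    PolyTime (b := .int) S (fun x => content (f x)) :=
  foldl_of_size_le (c := .int) (b := .int) (T := Set.univ)
    (F := fun z => (Int.gcd z.2.1 z.2.2 : ℤ)) (id'.snd.fst.gcd id'.snd.snd) (const_int 0) hf
    (.X) (by simp) fun x s y _ => by
      have : Ty.int.size (Int.gcd s y : ℤ) ≤ Ty.int.size s + Ty.int.size y := by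
        by_cases hs : s = 0
        · subst hs
          refine (Ty.size_mono (z := y) ?_).trans (Nat.le_add_left _ _)
          rw [Int.gcd_zero_left]
          exact le_rfl
        · refine (Ty.size_mono (z := s) ?_).trans (Nat.le_add_right _ _)
          exact Nat.le_of_dvd (Int.natAbs_pos.2 hs) (Nat.gcd_dvd_left _ _)
      simp only [Ty.size_prod, Polynomial.eval_X]
      omega

theorem primPart {f : a.Val → List ℤ} (hf : PolyTime (b := .vec) S f) :
    PolyTime (b := .vec) S (fun x => primPart (f x)) :=
  map (b := .int) (c := .int) (T := {z | z.1 ∈ S})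
    (F := fun z => (z.2 / CircuitSum.content (f z.1) : ℤ))
    (id'.snd.div (hf.content.comp id'.fst fun _ h => h)) hf (fun _ h _ _ => h)

theorem pivot {f : a.Val → List ℤ} {K : a.Val → List (List ℤ)} (hf : PolyTime (b := .vec) S f)
    (hK : PolyTime (b := .mat) S K) : PolyTime (b := .vec) S (fun x => pivot (f x) (K x)) :=
  foldl_of_size_le (c := .vec) (b := .vec) (T := {z | z.1 ∈ S})
    (F := fun z => if CircuitSum.dot (f z.1) z.2.1 = 0 then z.2.2 else z.2.1)
    (ite_eq_zero (dot (hf.comp id'.fst fun _ h => h) id'.snd.fst) id'.snd.snd id'.snd.fst) nil hK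
    .X (fun _ h _ _ => h) fun x s y _ => by
      simp only [Ty.size_prod, Polynomial.eval_X]
      split_ifs <;> omega

theorem elim {f : a.Val → List ℤ} {K : a.Val → List (List ℤ)} (hf : PolyTime (b := .vec) S f)
    (hK : PolyTime (b := .mat) S K) : PolyTime (b := .mat) S (fun x => elim (f x) (K x)) := by
  have hp := hf.pivot hK
  refine ite_eq_zero (hf.dot hp) hK ?_
  exact map (b := .vec) (c := .vec) (T := {z | z.1 ∈ S})
    (F := fun z => CircuitSum.primPart (CircuitSum.comb
      (CircuitSum.dot (f z.1) (CircuitSum.pivot (f z.1) (K z.1))) (CircuitSum.dot (f z.1) z.2) z.2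
      (CircuitSum.pivot (f z.1) (K z.1))))
    (primPart (comb ((hf.dot hp).comp id'.fst fun _ h => h)
      (dot (hf.comp id'.fst fun _ h => h) id'.snd) id'.snd (hp.comp id'.fst fun _ h => h))) hK
    (fun _ h _ _ => h)

theorem minRatio {B : a.Val → List (List ℤ)} {f g : a.Val → List ℤ}
    (hB : PolyTime (b := .mat) S B) (hf : PolyTime (b := .vec) S f)
    (hg : PolyTime (b := .vec) S g) :
    PolyTime (b := .prod .int .int) S (fun x => minRatio (B x) (f x) (g x)) := by
  have h1 : PolyTime (a := .prod a .vec) (b := .prod .int .int) {z | z.1 ∈ S}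
      (fun z => (CircuitSum.dot z.2 (f z.1), CircuitSum.dot z.2 (g z.1))) :=
    (dot id'.snd (hf.comp id'.fst fun _ h => h)).pair (dot id'.snd (hg.comp id'.fst fun _ h => h))
  obtain ⟨q, hq⟩ := h1.size_le
  have h2 : PolyTime (a := .prod a (.prod (.prod .int .int) .vec)) (b := .prod .int .int)
      {z | z.1 ∈ S} (fun z => (CircuitSum.dot z.2.2 (f z.1), CircuitSum.dot z.2.2 (g z.1))) :=
    h1.comp (id'.fst.pair id'.snd.snd) fun _ h => h
  exact foldl_of_size_le (c := .prod .int .int) (b := .vec) (T := {z | z.1 ∈ S})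
    (F := fun z =>
      if (z.2.1.1 * CircuitSum.dot z.2.2 (g z.1)) * (z.2.1.1 * CircuitSum.dot z.2.2 (g z.1)) ≤
        (z.2.1.2 * CircuitSum.dot z.2.2 (f z.1)) * (z.2.1.2 * CircuitSum.dot z.2.2 (f z.1))
      then z.2.1 else (CircuitSum.dot z.2.2 (f z.1), CircuitSum.dot z.2.2 (g z.1)))
    (ite_le ((id'.snd.fst.fst.mul h2.snd).mul (id'.snd.fst.fst.mul h2.snd))
      ((id'.snd.fst.snd.mul h2.fst).mul (id'.snd.fst.snd.mul h2.fst)) id'.snd.fst h2)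
    ((const_int 1).pair (const_int 0)) hB q (fun _ h _ _ => h) fun x s y h => by
      have := hq _ h
      dsimp only at this ⊢
      split_ifs <;> omega

theorem subMul {p q : a.Val → ℤ} {f g : a.Val → List ℤ}
    (hp : PolyTime (b := .int) S p) (hq : PolyTime (b := .int) S q)
    (hf : PolyTime (b := .vec) S f) (hg : PolyTime (b := .vec) S g) :
    PolyTime (b := .vec) S (fun x => subMul (p x) (q x) (f x) (g x)) :=
  comb (hq.mul hq) (hp.mul hq) hf hg

theorem moveTo {B : a.Val → List (List ℤ)} {f g : a.Val → List ℤ}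
    (hB : PolyTime (b := .mat) S B) (hf : PolyTime (b := .vec) S f)
    (hg : PolyTime (b := .vec) S g) :
    PolyTime (b := .vec) S (fun x => moveTo (B x) (f x) (g x)) := by
  have h := hB.minRatio hf hg
  exact ite_eq_zero (subMul h.fst h.snd hf hg).content hf (subMul h.fst h.snd hf hg)

theorem lowest {f g : a.Val → ℤ} (hf : PolyTime (b := .int) S f) (hg : PolyTime (b := .int) S g) :
    PolyTime (b := .rat) S (fun x => lowest (f x) (g x)) :=
  (hf.div (hf.gcd hg)).pair (hg.div (hf.gcd hg))

theorem denProd {f : a.Val → List (ℤ × ℤ)} (hf : PolyTime (b := .list .rat) S f) :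
    PolyTime (b := .int) S (fun x => denProd (f x)) :=
  foldl_of_size_le (c := .int) (b := .rat) (T := Set.univ)
    (F := fun z => (z.2.1 * z.2.2.2 : ℤ)) (id'.snd.fst.mul id'.snd.snd.snd) (const_int 1) hf
    (.X) (by simp) fun x s y _ => by
      have := Ty.size_mul s y.2
      simp only [Ty.size_prod, Polynomial.eval_X]
      omega

theorem clear {f : a.Val → List (ℤ × ℤ)} (hf : PolyTime (b := .list .rat) S f) :
    PolyTime (b := .vec) S (fun x => clear (f x)) :=
  map (b := .rat) (c := .int) (T := {z | z.1 ∈ S})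
    (F := fun z => (z.2.1 * (CircuitSum.denProd (f z.1) / z.2.2) : ℤ))
    (id'.snd.fst.mul ((hf.denProd.comp id'.fst fun _ h => h).div id'.snd.snd)) hf
    (fun _ h _ _ => h)

end PolyTime
open Matrix

/-! ### Elimination with primitive integer vectors -/

section
attribute [local instance] Matrix.seminormedAddCommGroup
variable {n : ℕ}

theorem intVec_dotProduct (r k : Fin n → ℤ) : intVec r ⬝ᵥ intVec k = ((r ⬝ᵥ k : ℤ) : ℝ) := by
  simp [dotProduct, intVec]

theorem intVec_eq_zero {v : Fin n → ℤ} : intVec v = 0 ↔ v = 0 := by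
  simp [funext_iff, intVec]

/-- The integer vector divided by the greatest common divisor of its entries. -/
def vecPrim (v : Fin n → ℤ) : Fin n → ℤ := fun i => v i / Finset.univ.gcd v

theorem gcd_smul_vecPrim (v : Fin n → ℤ) : Finset.univ.gcd v • vecPrim v = v := by
  ext i
  exact Int.mul_ediv_cancel' (Finset.gcd_dvd (Finset.mem_univ i))

theorem gcd_vecPrim {v : Fin n → ℤ} (hv : v ≠ 0) : Finset.univ.gcd (vecPrim v) = 1 := by
  obtain ⟨i, hi⟩ := Function.ne_iff.1 hv
  exact Finset.gcd_div_eq_one (Finset.mem_univ i) hi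

theorem gcd_nonneg (v : Fin n → ℤ) : 0 ≤ Finset.univ.gcd v := by
  rw [← Finset.normalize_gcd, ← Int.abs_eq_normalize]; exact abs_nonneg _

theorem gcd_eq_zero_iff {v : Fin n → ℤ} : Finset.univ.gcd v = 0 ↔ v = 0 := by
  rw [Finset.gcd_eq_zero_iff, funext_iff]; simp

theorem gcd_pos {v : Fin n → ℤ} (hv : v ≠ 0) : 0 < Finset.univ.gcd v :=
  (gcd_nonneg v).lt_of_ne' (gcd_eq_zero_iff.not.2 hv)

theorem vecPrim_zero : vecPrim (0 : Fin n → ℤ) = 0 := by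
  ext; simp [vecPrim]

theorem vecPrim_apply_eq_zero {v : Fin n → ℤ} {i : Fin n} : vecPrim v i = 0 ↔ v i = 0 := by
  constructor
  · intro h
    rw [← gcd_smul_vecPrim v]; simp [h]
  · intro h
    simp [vecPrim, h]

theorem dotProduct_vecPrim_eq_zero {r v : Fin n → ℤ} (h : r ⬝ᵥ v = 0) : r ⬝ᵥ vecPrim v = 0 := by
  by_cases hv : v = 0
  · simp [hv, vecPrim_zero]
  · rw [← gcd_smul_vecPrim v, dotProduct_smul] at h
    exact (smul_eq_zero.1 h).resolve_left (gcd_pos hv).ne'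

/-- If `K i` are primitive vectors obtained by elimination with pivots `S` and pivot rows `R`, they
are a spanning set for the space orthogonal to `rows`. -/
structure IsEliminated (rows : List (Fin n → ℤ)) (K : Fin n → Fin n → ℤ) (S : Finset (Fin n))
    (R : Fin n → Fin n → ℤ) : Prop where
  mem : ∀ s ∈ S, R s ∈ rows
  orth : ∀ r ∈ rows, ∀ i, r ⬝ᵥ K i = 0
  zero : ∀ i ∈ S, K i = 0
  diag : ∀ i ∉ S, K i i ≠ 0
  gcd : ∀ i ∉ S, Finset.univ.gcd (K i) = 1
  off : ∀ i ∉ S, ∀ j ∉ S, j ≠ i → K i j = 0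
  inj : ∀ x : Fin n → ℝ, (∀ s ∈ S, intVec (R s) ⬝ᵥ x = 0) → (∀ i ∉ S, x i = 0) → x = 0

theorem isEliminated_nil :
    IsEliminated [] (fun i j : Fin n => if i = j then 1 else 0) ∅ (fun _ => 0) where
  mem := by simp
  orth := by simp
  zero := by simp
  diag := by simp
  gcd i _ := by
    have h : Finset.univ.gcd (fun j : Fin n => if i = j then (1 : ℤ) else 0) ∣ 1 := by
      simpa using Finset.gcd_dvd (f := fun j : Fin n => if i = j then (1 : ℤ) else 0)
        (Finset.mem_univ i)
    exact Int.eq_one_of_dvd_one (gcd_nonneg _) h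
  off := by intro i _ j _ h; simp [h.symm]
  inj x _ h := by ext i; simpa using h i

namespace IsEliminated
variable {rows : List (Fin n → ℤ)} {K : Fin n → Fin n → ℤ} {S : Finset (Fin n)}
  {R : Fin n → Fin n → ℤ}

theorem of_orth (h : IsEliminated rows K S R) {r : Fin n → ℤ} (hr : ∀ i, r ⬝ᵥ K i = 0) :
    IsEliminated (rows ++ [r]) K S R :=
  { h with
    mem := fun s hs => List.mem_append_left _ (h.mem s hs)
    orth := fun r' hr' => by
      rcases List.mem_append.1 hr' with hr' | hr'
      · exact h.orth r' hr'
      · rw [List.mem_singleton.1 hr']; exact hr }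

theorem pivot_notMem (h : IsEliminated rows K S R) {r : Fin n → ℤ} {p : Fin n}
    (hp : r ⬝ᵥ K p ≠ 0) : p ∉ S := fun hS => hp (by simp [h.zero p hS])

/-- Both sides are orthogonal to the pivot rows and agree on the coordinates outside `S`, so `inj`
identifies them. Thus `K p` is determined up to scaling by the pivot rows and its support; both the
elimination step and the bound on the entries rest on this. -/
theorem eq_smul (h : IsEliminated rows K S R) {p : Fin n} (hp : p ∉ S) {x : Fin n → ℝ}
    (hx : ∀ s ∈ S, intVec (R s) ⬝ᵥ x = 0) (hx' : ∀ i ∉ S, i ≠ p → x i = 0) :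
    (K p p : ℝ) • x = x p • intVec (K p) := by
  rw [← sub_eq_zero]
  apply h.inj
  · intro s hs
    rw [dotProduct_sub, dotProduct_smul, dotProduct_smul, hx s hs, intVec_dotProduct,
      h.orth _ (h.mem s hs)]
    simp
  · intro i hi
    by_cases hip : i = p
    · subst hip; simp [intVec, mul_comm]
    · simp [hx' i hi hip, intVec, h.off p hp i hi hip]

/-- The pivot vector `K p` becomes 0 and p joins `S`. Since `K p` vanishes at all free coordinates
other than p, the other vectors keep their pattern there: their diagonal entries are only multiplied
by r · K p before the common factor is removed. For `inj`, the old pivot rows force x onto the line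
of `K p`, and orthogonality to `r` then makes it vanish. -/
theorem elim (h : IsEliminated rows K S R) {r : Fin n → ℤ} {p : Fin n} (hp : r ⬝ᵥ K p ≠ 0) :
    IsEliminated (rows ++ [r]) (fun i => vecPrim ((r ⬝ᵥ K p) • K i - (r ⬝ᵥ K i) • K p))
      (insert p S) (Function.update R p r) := by
  have hpS := h.pivot_notMem hp
  have hdiag : ∀ i ∉ insert p S, ((r ⬝ᵥ K p) • K i - (r ⬝ᵥ K i) • K p) i ≠ 0 := by
    intro i hi
    rw [Finset.mem_insert, not_or] at hi
    simp [h.off p hpS i hi.2 hi.1, hp, h.diag i hi.2]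
  constructor
  · intro s hs
    by_cases hsp : s = p
    · subst hsp; simp
    · rw [Function.update_of_ne hsp]
      exact List.mem_append_left _ (h.mem s ((Finset.mem_insert.1 hs).resolve_left hsp))
  · intro r' hr' i
    apply dotProduct_vecPrim_eq_zero
    rw [dotProduct_sub, dotProduct_smul, dotProduct_smul]
    rcases List.mem_append.1 hr' with hr' | hr'
    · simp [h.orth r' hr']
    · rw [List.mem_singleton.1 hr', smul_eq_mul, smul_eq_mul]; ring
  · intro i hi
    rcases Finset.mem_insert.1 hi with rfl | hi
    · simp [vecPrim_zero]
    · simp [h.zero i hi, vecPrim_zero]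
  · intro i hi
    rw [Ne, vecPrim_apply_eq_zero]
    exact hdiag i hi
  · intro i hi
    exact gcd_vecPrim fun h0 => hdiag i hi (congrFun h0 i)
  · intro i hi j hj hji
    rw [vecPrim_apply_eq_zero]
    rw [Finset.mem_insert, not_or] at hi hj
    simp [h.off i hi.2 j hj.2 hji, h.off p hpS j hj.2 hj.1]
  · intro x hx hx'
    have h1 : ∀ s ∈ S, intVec (R s) ⬝ᵥ x = 0 := by
      intro s hs
      have := hx s (Finset.mem_insert_of_mem hs)
      rwa [Function.update_of_ne (by rintro rfl; exact hpS hs)] at this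
    have h2 := h.eq_smul hpS h1 fun i hi hip => hx' i (by simp [hi, hip])
    have h3 : intVec r ⬝ᵥ x = 0 := by
      have := hx p (Finset.mem_insert_self _ _)
      rwa [Function.update_self] at this
    have h4 := congrArg (intVec r ⬝ᵥ ·) h2
    simp only [dotProduct_smul, h3, intVec_dotProduct, smul_eq_mul, mul_zero] at h4
    have h5 : x p = 0 := by
      rcases mul_eq_zero.1 h4.symm with h5 | h5
      · exact h5
      · exact absurd (by exact_mod_cast h5) hp
    rw [h5, zero_smul] at h2
    exact (smul_eq_zero.1 h2).resolve_left (by exact_mod_cast h.diag p hpS)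

/-- The sum reproduces the free coordinates of x because each `K i` has a single nonzero free
coordinate; `inj` takes care of the pivot coordinates. -/
theorem eq_sum (h : IsEliminated rows K S R) {x : Fin n → ℝ}
    (hx : ∀ r ∈ rows, intVec r ⬝ᵥ x = 0) :
    x = ∑ i ∈ Sᶜ, (x i / K i i) • intVec (K i) := by
  rw [← sub_eq_zero]
  apply h.inj
  · intro s hs
    rw [dotProduct_sub, hx _ (h.mem s hs), dotProduct_sum]
    simp [dotProduct_smul, intVec_dotProduct, h.orth _ (h.mem s hs)]
  · intro i hi
    rw [Pi.sub_apply, Finset.sum_apply, Finset.sum_eq_single i]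
    · have : (K i i : ℝ) ≠ 0 := by exact_mod_cast h.diag i hi
      simp [intVec, this]
    · intro j hj hji
      simp [intVec, h.off j (Finset.mem_compl.1 hj) i hi hji.symm]
    · simp [hi]

/-- If all the `K i` are multiples of `x`, the space orthogonal to `rows` is the line through `x`. -/
theorem exists_smul_eq (h : IsEliminated rows K S R) {x : Fin n → ℝ}
    (hK : ∀ i, ∃ c : ℝ, intVec (K i) = c • x) {z : Fin n → ℝ}
    (hz : ∀ r ∈ rows, intVec r ⬝ᵥ z = 0) : ∃ c : ℝ, z = c • x := by
  choose c hc using hK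
  refine ⟨∑ i ∈ Sᶜ, (z i / K i i) * c i, ?_⟩
  rw [Finset.sum_smul]
  conv_lhs => rw [h.eq_sum hz]
  exact Finset.sum_congr rfl fun i _ => by rw [hc, mul_smul]

theorem exists_ne_zero (h : IsEliminated rows K S R) {x : Fin n → ℝ} (hx0 : x ≠ 0)
    (hx : ∀ r ∈ rows, intVec r ⬝ᵥ x = 0) : ∃ i, K i ≠ 0 := by
  by_contra! h0
  apply hx0
  rw [h.eq_sum hx]
  exact Finset.sum_eq_zero fun i _ => by simp [h0, intVec_eq_zero.2]

/-- A primitive vector is the shortest integer vector on its line: k i divides t i * k j for all j,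
hence divides t i times the gcd of k, which is t i, so t is a nonzero integer multiple of k. -/
theorem natAbs_le_of_smul_eq {k t : Fin n → ℤ} {i : Fin n} (hk : Finset.univ.gcd k = 1)
    (hi : k i ≠ 0) (ht : t ≠ 0) (h : k i • t = t i • k) (j : Fin n) :
    (k j).natAbs ≤ (t j).natAbs := by
  have h1 : k i ∣ t i := by
    have : k i ∣ Finset.univ.gcd (fun j => t i * k j) :=
      Finset.dvd_gcd fun j _ => ⟨t j, (congrFun h j).symm⟩
    rw [Finset.gcd_mul_left, hk, mul_one] at this
    exact this.trans (normalize_dvd_iff.2 dvd_rfl)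
  obtain ⟨c, hc⟩ := h1
  have h2 : t = c • k := by
    ext j
    have := congrFun h j
    simp only [Pi.smul_apply, smul_eq_mul, hc] at this ⊢
    exact mul_left_cancel₀ hi (by rw [this]; ring)
  have hc0 : c ≠ 0 := by rintro rfl; exact ht (by simpa using h2)
  rw [h2]
  simp only [Pi.smul_apply, smul_eq_mul, Int.natAbs_mul]
  exact Nat.le_mul_of_pos_left _ (Int.natAbs_pos.2 hc0)

/-- A bound that ignores the history of the elimination. Siegel's lemma gives a small nonzero
integer vector supported on `insert i S` and orthogonal to the pivot rows. By `eq_smul` it is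
proportional to `K i`, and `K i`, being primitive, is no longer. -/
theorem natAbs_le (h : IsEliminated rows K S R) {M : ℕ} (hM : 1 ≤ M)
    (hrows : ∀ r ∈ rows, ∀ j, (r j).natAbs ≤ M) (i j : Fin n) :
    (K i j).natAbs ≤ (n * M) ^ n := by
  have hn : 1 ≤ n * M := Nat.mul_pos (i.pos) hM
  by_cases hi : i ∈ S
  · simp [h.zero i hi]
  by_cases hS : S.Nonempty
  · let T := insert i S
    let C : Matrix S T ℤ := fun s j => R s j
    have hcS : Fintype.card S = S.card := Fintype.card_coe _
    have hcT : Fintype.card T = S.card + 1 := by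
      rw [Fintype.card_coe, Finset.card_insert_of_notMem hi]
    -- There is one more unknown than equations, so the exponent |S| / (|S| + 1 - |S|) in Siegel's
    -- bound is just |S|.
    obtain ⟨t, ht0, hCt, htn⟩ := Int.Matrix.exists_ne_zero_int_vec_norm_le C
      (by omega) (by rw [hcS]; exact hS.card_pos)
    have hcn : S.card + 1 ≤ n := by
      rw [← hcT, Fintype.card_coe]; simpa using Finset.card_le_univ T
    have hC : ‖C‖ ≤ M := (Matrix.norm_le_iff (by positivity)).2 fun s j => by
      rw [Int.norm_eq_abs]
      have := hrows _ (h.mem s s.2) j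
      zify at this; exact_mod_cast this
    let t' : Fin n → ℤ := fun j => if hj : j ∈ T then t ⟨j, hj⟩ else 0
    have ht' : ∀ j : T, t' j = t j := fun j => by simp [t']
    have htb : ∀ j, (t' j).natAbs ≤ (n * M) ^ n := by
      intro j
      by_cases hj : j ∈ T
      · simp only [t', hj, dif_pos]
        have h1 := (norm_le_pi_norm t ⟨j, hj⟩).trans htn
        rw [hcS, hcT, Nat.cast_add, Nat.cast_one, add_sub_cancel_left, div_one,
          Real.rpow_natCast] at h1
        have h2 : (((S.card : ℝ) + 1) * max 1 ‖C‖) ^ S.card ≤ ((n * M : ℕ) : ℝ) ^ n := by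
          calc (((S.card : ℝ) + 1) * max 1 ‖C‖) ^ S.card
              ≤ ((n * M : ℕ) : ℝ) ^ S.card := by
                push_cast
                gcongr
                · exact_mod_cast hcn
                · exact max_le (by exact_mod_cast hM) hC
            _ ≤ _ := pow_le_pow_right₀ (by exact_mod_cast hn) (by omega)
        have h3 := h1.trans h2
        rw [Int.norm_eq_abs] at h3
        zify
        exact_mod_cast h3
      · simp [t', hj]
    have ht'0 : t' ≠ 0 := by
      intro h0
      apply ht0
      ext j
      rw [← ht', h0]; rfl
    have horth : ∀ s ∈ S, R s ⬝ᵥ t' = 0 := by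
      intro s hs
      have h1 := congrFun hCt ⟨s, hs⟩
      refine Eq.trans ?_ h1
      simp only [Matrix.mulVec, dotProduct, C]
      rw [← Finset.sum_subset (Finset.subset_univ T) fun j _ hj => by simp [t', hj],
        ← Finset.sum_coe_sort]
      exact Finset.sum_congr rfl fun j _ => by rw [ht']
    have h1 := h.eq_smul hi (x := intVec t')
      (fun s hs => by rw [intVec_dotProduct, horth s hs]; simp)
      (fun j hj hji => by simp [intVec, t', T, hj, hji])
    refine (natAbs_le_of_smul_eq (h.gcd i hi) (h.diag i hi) ht'0 ?_ j).trans (htb j)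
    ext l
    have h2 := congrFun h1 l
    simp only [Pi.smul_apply, intVec, smul_eq_mul] at h2 ⊢
    exact_mod_cast h2
  -- Siegel's lemma requires an equation. Without pivots `K i` is a multiple of a unit vector, which
  -- serves as the short vector.
  · rw [Finset.not_nonempty_iff_eq_empty] at hS
    subst hS
    have h1 : K i = K i i • (Pi.single i 1) := by
      ext l
      by_cases hl : l = i
      · subst hl; simp
      · simp [hl, h.off i hi l (by simp) hl]
    have := natAbs_le_of_smul_eq (t := Pi.single i 1) (h.gcd i hi) (h.diag i hi)
      (by simp) (by simpa using h1.symm) j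
    refine this.trans (le_trans ?_ (Nat.one_le_pow _ _ hn))
    by_cases hj : j = i
    · subst hj; simp
    · simp [hj]

end IsEliminated
end
/-! ### Conformal vectors and circuits -/

section
variable {n mA mB : ℕ} {A : Matrix (Fin mA) (Fin n) ℝ} {B : Matrix (Fin mB) (Fin n) ℝ}

/-- The space of the vectors orthogonal to all rows of `A` and `B` to which `w` is orthogonal. -/
noncomputable def tightSpace (A : Matrix (Fin mA) (Fin n) ℝ) (B : Matrix (Fin mB) (Fin n) ℝ)
    (w : Fin n → ℝ) : Submodule ℝ (Fin n → ℝ) :=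
  LinearMap.ker ((stacked A B).submatrix
    (Subtype.val : {j // (stacked A B).mulVec w j = 0} → Fin mA ⊕ Fin mB) id).mulVecLin

theorem mem_tightSpace {w x : Fin n → ℝ} (hw : A *ᵥ w = 0) :
    x ∈ tightSpace A B w ↔ A *ᵥ x = 0 ∧ ∀ j, (B *ᵥ w) j = 0 → (B *ᵥ x) j = 0 := by
  have h1 : x ∈ tightSpace A B w ↔
      ∀ j, (stacked A B *ᵥ w) j = 0 → (stacked A B *ᵥ x) j = 0 := by
    rw [tightSpace, LinearMap.mem_ker, mulVecLin_apply, funext_iff]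
    exact ⟨fun h j hj => h ⟨j, hj⟩, fun h j => h j.1 j.2⟩
  rw [h1, stacked, fromRows_mulVec, fromRows_mulVec]
  simp [hw, funext_iff]

theorem zeroRank_add_finrank (w : Fin n → ℝ) :
    zeroRank A B w + Module.finrank ℝ (tightSpace A B w) = n := by
  have := LinearMap.finrank_range_add_finrank_ker ((stacked A B).submatrix
    (Subtype.val : {j // (stacked A B).mulVec w j = 0} → Fin mA ⊕ Fin mB) id).mulVecLin
  rwa [Module.finrank_fin_fun] at this

theorem self_mem_tightSpace {w : Fin n → ℝ} (hw : A *ᵥ w = 0) : w ∈ tightSpace A B w :=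
  (mem_tightSpace hw).2 ⟨hw, fun _ h => h⟩

/-- More zeros of Bx mean more equations, hence a smaller tight space. The inclusion is strict
because w lies in its own tight space but violates the new equation at j. This is the progress
measure of the algorithm and of the descent. -/
theorem zeroRank_lt {w x : Fin n → ℝ} (hw : A *ᵥ w = 0) (hx : A *ᵥ x = 0)
    (h : Function.support (B *ᵥ x) ⊂ Function.support (B *ᵥ w)) :
    zeroRank A B w < zeroRank A B x := by
  obtain ⟨hsub, j, hjw, hjx⟩ := Set.ssubset_iff_exists.1 h
  have hlt : tightSpace A B x < tightSpace A B w := by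
    refine lt_of_le_of_ne (fun z hz => ?_) fun heq => ?_
    · rw [mem_tightSpace hx] at hz
      rw [mem_tightSpace hw]
      refine ⟨hz.1, fun i hi => hz.2 i ?_⟩
      by_contra hxi
      exact hsub hxi hi
    · have h1 := self_mem_tightSpace (B := B) hw
      rw [← heq, mem_tightSpace hx] at h1
      exact hjw (h1.2 j (by simpa using hjx))
  have := Submodule.finrank_lt_finrank_of_lt hlt
  have := zeroRank_add_finrank (A := A) (B := B) w
  have := zeroRank_add_finrank (A := A) (B := B) x
  omega

theorem zeroRank_congr {w x : Fin n → ℝ} (hw : A *ᵥ w = 0) (hx : A *ᵥ x = 0)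
    (h : Function.support (B *ᵥ x) = Function.support (B *ᵥ w)) :
    zeroRank A B w = zeroRank A B x := by
  have heq : tightSpace A B x = tightSpace A B w := by
    ext z
    rw [mem_tightSpace hx, mem_tightSpace hw]
    have : ∀ j, (B *ᵥ x) j = 0 ↔ (B *ᵥ w) j = 0 := fun j => not_iff_not.1 (Set.ext_iff.1 h j)
    simp [this]
  have := zeroRank_add_finrank (A := A) (B := B) w
  have := zeroRank_add_finrank (A := A) (B := B) x
  rw [heq] at this
  omega

theorem zeroRank_lt_dim {w : Fin n → ℝ} (hw : A *ᵥ w = 0) (hw0 : w ≠ 0) :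
    zeroRank A B w + 1 ≤ n := by
  have h1 : 0 < Module.finrank ℝ (tightSpace A B w) :=
    Module.finrank_pos_iff_exists_ne_zero.2
      ⟨⟨w, self_mem_tightSpace hw⟩, fun h => hw0 (congrArg Subtype.val h)⟩
  have := zeroRank_add_finrank (A := A) (B := B) w
  omega

theorem rank_le_zeroRank {w : Fin n → ℝ} (hw : A *ᵥ w = 0) : A.rank ≤ zeroRank A B w := by
  have h1 := LinearMap.finrank_range_add_finrank_ker A.mulVecLin
  rw [Module.finrank_fin_fun] at h1
  have h2 : tightSpace A B w ≤ LinearMap.ker A.mulVecLin := fun z hz => by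
    rw [mem_tightSpace hw] at hz
    exact hz.1
  have := Submodule.finrank_mono h2
  have := zeroRank_add_finrank (A := A) (B := B) w
  have h3 : A.rank = Module.finrank ℝ (LinearMap.range A.mulVecLin) := rfl
  omega

/-- By rank-nullity the rank is n - 1 exactly when the tight space is one-dimensional, hence spanned
by its nonzero element w. As the rank is less than n, the truncated subtraction is harmless. -/
theorem zeroRank_eq_iff {w : Fin n → ℝ} (hw : A *ᵥ w = 0) (hw0 : w ≠ 0) :
    zeroRank A B w = n - 1 ↔ ∀ z ∈ tightSpace A B w, ∃ c : ℝ, z = c • w := by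
  have h1 := zeroRank_add_finrank (A := A) (B := B) w
  have h2 := zeroRank_lt_dim (B := B) hw hw0
  have h3 : zeroRank A B w = n - 1 ↔ Module.finrank ℝ (tightSpace A B w) = 1 := by omega
  rw [h3, finrank_eq_one_iff_of_nonzero' ⟨w, self_mem_tightSpace hw⟩
    fun h => hw0 (congrArg Subtype.val h)]
  constructor
  · intro h z hz
    obtain ⟨c, hc⟩ := h ⟨z, hz⟩
    exact ⟨c, (congrArg Subtype.val hc).symm⟩
  · rintro h ⟨z, hz⟩
    obtain ⟨c, hc⟩ := h z hz
    exact ⟨c, Subtype.ext hc.symm⟩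

theorem IsPointed.eq_zero (h : IsPointed A B) {x : Fin n → ℝ} (hA : A *ᵥ x = 0)
    (hB : B *ᵥ x = 0) : x = 0 := by
  have h1 := LinearMap.finrank_range_add_finrank_ker (stacked A B).mulVecLin
  have h2 : Module.finrank ℝ (LinearMap.range (stacked A B).mulVecLin) = n := h
  rw [Module.finrank_fin_fun, h2] at h1
  have h3 : LinearMap.ker (stacked A B).mulVecLin = ⊥ :=
    Submodule.finrank_eq_zero.1 (by omega)
  have h4 : x ∈ LinearMap.ker (stacked A B).mulVecLin := by
    rw [LinearMap.mem_ker, mulVecLin_apply, stacked, fromRows_mulVec, hA, hB]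
    ext j; cases j <;> rfl
  rwa [h3, Submodule.mem_bot] at h4

theorem IsPointed.exists_ne_zero (h : IsPointed A B) {x : Fin n → ℝ} (hA : A *ᵥ x = 0)
    (hx : x ≠ 0) : ∃ j, (B *ᵥ x) j ≠ 0 := by
  by_contra! h0
  exact hx (h.eq_zero hA (funext h0))

/-- `x` is conformal to `w`: sign-compatible, with the support of `B x` contained in that of `B w`.
-/
def Conformal (B : Matrix (Fin mB) (Fin n) ℝ) (x w : Fin n → ℝ) : Prop :=
  ∀ j, 0 ≤ (B *ᵥ x) j * (B *ᵥ w) j ∧ ((B *ᵥ w) j = 0 → (B *ᵥ x) j = 0)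

namespace Conformal

theorem refl (x : Fin n → ℝ) : Conformal B x x := fun _ => ⟨mul_self_nonneg _, fun h => h⟩

/-- Sign-compatibility alone is not transitive, since a zero coordinate of By is compatible with
both signs; the support condition excludes this case. -/
theorem trans {x y z : Fin n → ℝ} (hxy : Conformal B x y) (hyz : Conformal B y z) :
    Conformal B x z := by
  intro j
  obtain ⟨h1, h2⟩ := hxy j
  obtain ⟨h3, h4⟩ := hyz j
  refine ⟨?_, fun h => h2 (h4 h)⟩
  by_cases hy : (B *ᵥ y) j = 0
  · simp [h2 hy]
  · have hy' : 0 < (B *ᵥ y) j * (B *ᵥ y) j := mul_self_pos.2 hy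
    have : 0 ≤ ((B *ᵥ y) j * (B *ᵥ y) j) * ((B *ᵥ x) j * (B *ᵥ z) j) := by
      have := mul_nonneg h1 h3; linarith
    exact nonneg_of_mul_nonneg_right this hy'

theorem support_subset {x w : Fin n → ℝ} (h : Conformal B x w) :
    Function.support (B *ᵥ x) ⊆ Function.support (B *ᵥ w) :=
  fun j hj hw => hj ((h j).2 hw)

theorem signCompatible {x w : Fin n → ℝ} (h : Conformal B x w) : SignCompatible B x w :=
  fun j => (h j).1

theorem signCompatible_of_common {x y w : Fin n → ℝ} (hx : Conformal B x w)
    (hy : Conformal B y w) : SignCompatible B x y := by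
  intro j
  obtain ⟨h1, h2⟩ := hx j
  obtain ⟨h3, h4⟩ := hy j
  by_cases hw : (B *ᵥ w) j = 0
  · simp [h2 hw]
  · have hw' : 0 < (B *ᵥ w) j * (B *ᵥ w) j := mul_self_pos.2 hw
    have : 0 ≤ ((B *ᵥ w) j * (B *ᵥ w) j) * ((B *ᵥ x) j * (B *ᵥ y) j) := by
      have := mul_nonneg h1 h3; linarith
    exact nonneg_of_mul_nonneg_right this hw'

theorem smul {x w : Fin n → ℝ} (h : Conformal B x w) {c : ℝ} (hc : 0 ≤ c) :
    Conformal B (c • x) w := by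
  intro j
  obtain ⟨h1, h2⟩ := h j
  rw [mulVec_smul, Pi.smul_apply, smul_eq_mul, mul_assoc]
  exact ⟨mul_nonneg hc h1, fun h => by rw [h2 h, mul_zero]⟩

theorem of_smul {x w : Fin n → ℝ} {c : ℝ} (hc : 0 < c) (h : Conformal B (c • x) w) :
    Conformal B x w := by
  simpa [smul_smul, hc.ne'] using h.smul (inv_nonneg.2 hc.le)

theorem of_support {x w : Fin n → ℝ} (h : SignCompatible B x w)
    (hs : Function.support (B *ᵥ x) ⊆ Function.support (B *ᵥ w)) : Conformal B x w :=
  fun j => ⟨h j, fun hw => by by_contra hx; exact hs hx hw⟩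

end Conformal

theorem zeroRank_mono {w x : Fin n → ℝ} (hw : A *ᵥ w = 0) (hx : A *ᵥ x = 0)
    (h : Function.support (B *ᵥ x) ⊆ Function.support (B *ᵥ w)) :
    zeroRank A B w ≤ zeroRank A B x := by
  rcases h.eq_or_ssubset with h | h
  · exact (zeroRank_congr hw hx h).le
  · exact (zeroRank_lt hw hx h).le

theorem zeroRank_smul {w : Fin n → ℝ} (hw : A *ᵥ w = 0) {c : ℝ} (hc : c ≠ 0) :
    zeroRank A B (c • w) = zeroRank A B w :=
  zeroRank_congr (by rw [mulVec_smul, hw, smul_zero]) hw (by ext j; simp [mulVec_smul, hc])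

/-- Moving from `x` in direction `y` until an inequality becomes tight preserves conformality. -/
theorem conformal_sub_smul {x y : Fin n → ℝ} {j : Fin mB}
    (hj : (B *ᵥ y) j ≠ 0)
    (hmin : ∀ i, (B *ᵥ y) i ≠ 0 → |(B *ᵥ x) j| * |(B *ᵥ y) i| ≤ |(B *ᵥ x) i| * |(B *ᵥ y) j|) :
    Conformal B (x - ((B *ᵥ x) j / (B *ᵥ y) j) • y) x ∧
      (B *ᵥ (x - ((B *ᵥ x) j / (B *ᵥ y) j) • y)) j = 0 := by
  have hB : ∀ i, (B *ᵥ (x - ((B *ᵥ x) j / (B *ᵥ y) j) • y)) i =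
      (B *ᵥ x) i - (B *ᵥ x) j / (B *ᵥ y) j * (B *ᵥ y) i := fun i => by
    rw [mulVec_sub, mulVec_smul]; rfl
  refine ⟨fun i => ?_, by rw [hB]; field_simp; ring⟩
  -- By minimality of the ratio, no coordinate is changed by more than its absolute value, so no
  -- sign is reversed and zeros stay zero.
  have hle : |(B *ᵥ x) j / (B *ᵥ y) j * (B *ᵥ y) i| ≤ |(B *ᵥ x) i| := by
    by_cases hi : (B *ᵥ y) i = 0
    · simp [hi]
    · rw [abs_mul, abs_div, div_mul_eq_mul_div, div_le_iff₀ (abs_pos.2 hj)]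
      exact hmin i hi
  rw [hB]
  constructor
  · have h1 := abs_le_abs_of_nonneg (abs_nonneg _) hle
    have h2 : (B *ᵥ x) j / (B *ᵥ y) j * (B *ᵥ y) i * (B *ᵥ x) i ≤ |(B *ᵥ x) i| * |(B *ᵥ x) i| :=
      (le_abs_self _).trans (by rw [abs_mul]; gcongr)
    rw [abs_mul_abs_self] at h2
    linarith
  · intro h
    rw [h, abs_zero] at hle
    rw [h, abs_nonpos_iff.1 hle, sub_zero]

theorem exists_min_ratio {x y : Fin n → ℝ} (h : ∃ j, (B *ᵥ y) j ≠ 0) :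
    ∃ j, (B *ᵥ y) j ≠ 0 ∧ ∀ i, (B *ᵥ y) i ≠ 0 →
      |(B *ᵥ x) j| * |(B *ᵥ y) i| ≤ |(B *ᵥ x) i| * |(B *ᵥ y) j| := by
  classical
  obtain ⟨j, hj⟩ := h
  obtain ⟨i, hi, hmin⟩ := Finset.exists_min_image (Finset.univ.filter fun j => (B *ᵥ y) j ≠ 0)
    (fun j => |(B *ᵥ x) j| / |(B *ᵥ y) j|) ⟨j, by simpa using hj⟩
  simp only [Finset.mem_filter, Finset.mem_univ, true_and] at hi hmin
  refine ⟨i, hi, fun k hk => ?_⟩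
  have := hmin k hk
  rwa [div_le_div_iff₀ (abs_pos.2 hi) (abs_pos.2 hk)] at this

/-- A vector whose space of tight directions is a line is elementary. -/
theorem mem_circuits {g : Fin n → ℤ} (hA : A *ᵥ intVec g = 0) (hg : Finset.univ.gcd g = 1)
    (hg0 : intVec g ≠ 0) (hr : zeroRank A B (intVec g) = n - 1) : g ∈ circuits A B := by
  refine ⟨hA, hg0, hg, fun x hx hx0 hss => ?_⟩
  have h1 := zeroRank_lt hA hx hss
  have h2 := zeroRank_lt_dim (B := B) hx hx0
  omega

/-- `a i` is a positive multiple of the `i`-th row of `A`. -/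
def RowScaled {m : ℕ} (a : Fin m → Fin n → ℤ) (A : Matrix (Fin m) (Fin n) ℝ) : Prop :=
  ∀ i, ∃ c : ℝ, 0 < c ∧ ∀ x : Fin n → ℝ, intVec (a i) ⬝ᵥ x = c * (A *ᵥ x) i

theorem RowScaled.eq_zero_iff {m : ℕ} {a : Fin m → Fin n → ℤ} {A : Matrix (Fin m) (Fin n) ℝ}
    (h : RowScaled a A) (i : Fin m) (x : Fin n → ℝ) :
    intVec (a i) ⬝ᵥ x = 0 ↔ (A *ᵥ x) i = 0 := by
  obtain ⟨c, hc, h⟩ := h i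
  rw [h, mul_eq_zero, or_iff_right hc.ne']

/-- The rows to which `w` is orthogonal. -/
noncomputable def tightRows (a : Fin mA → Fin n → ℤ) (b : Fin mB → Fin n → ℤ) (w : Fin n → ℝ) :
    List (Fin n → ℤ) :=
  open Classical in
  (List.ofFn a).filter (fun r => intVec r ⬝ᵥ w = 0) ++
    (List.ofFn b).filter (fun r => intVec r ⬝ᵥ w = 0)

theorem mem_tightSpace_iff_rows {a : Fin mA → Fin n → ℤ} {b : Fin mB → Fin n → ℤ}
    (ha : RowScaled a A) (hb : RowScaled b B) {w x : Fin n → ℝ} (hw : A *ᵥ w = 0) :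
    x ∈ tightSpace A B w ↔ ∀ r ∈ tightRows a b w, intVec r ⬝ᵥ x = 0 := by
  classical
  rw [mem_tightSpace hw, funext_iff]
  simp only [tightRows, List.mem_append, List.mem_filter, List.mem_ofFn, decide_eq_true_eq]
  constructor
  · rintro ⟨h1, h2⟩ r (⟨⟨i, rfl⟩, -⟩ | ⟨⟨i, rfl⟩, h⟩)
    · exact (ha.eq_zero_iff _ _).2 (h1 i)
    · exact (hb.eq_zero_iff _ _).2 (h2 i ((hb.eq_zero_iff _ _).1 h))
  · intro h
    exact ⟨fun i => (ha.eq_zero_iff _ _).1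
        (h _ (Or.inl ⟨⟨i, rfl⟩, (ha.eq_zero_iff _ _).2 (congrFun hw i)⟩)),
      fun j hj => (hb.eq_zero_iff _ _).1
        (h _ (Or.inr ⟨⟨j, rfl⟩, (hb.eq_zero_iff _ _).2 hj⟩))⟩

theorem exists_isEliminated (rows : List (Fin n → ℤ)) : ∃ K S R, IsEliminated rows K S R := by
  induction rows using List.reverseRecOn with
  | nil => exact ⟨_, _, _, isEliminated_nil⟩
  | append_singleton rows r ih =>
    obtain ⟨K, S, R, h⟩ := ih
    by_cases hr : ∀ i, r ⬝ᵥ K i = 0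
    · exact ⟨_, _, _, h.of_orth hr⟩
    · push Not at hr
      obtain ⟨p, hp⟩ := hr
      exact ⟨_, _, _, h.elim hp⟩

theorem intVec_smul (c : ℤ) (v : Fin n → ℤ) : intVec (c • v) = (c : ℝ) • intVec v := by
  ext i; simp [intVec]

theorem exists_primitive_multiple {k : Fin n → ℤ} (hk : k ≠ 0) {w : Fin n → ℝ}
    {c : ℝ} (h : intVec k = c • w) :
    ∃ g : Fin n → ℤ, Finset.univ.gcd g = 1 ∧ ∃ a : ℝ, 0 < a ∧ w = a • intVec g := by
  have hc : c ≠ 0 := by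
    rintro rfl
    rw [zero_smul, intVec_eq_zero] at h
    exact hk h
  have h1 : w = (c⁻¹ * ((Finset.univ.gcd k : ℤ) : ℝ)) • intVec (vecPrim k) := by
    rw [mul_smul, ← intVec_smul, gcd_smul_vecPrim, h, smul_smul, inv_mul_cancel₀ hc, one_smul]
  have hG : (0 : ℝ) < (Finset.univ.gcd k : ℤ) := by exact_mod_cast gcd_pos hk
  rcases lt_or_gt_of_ne hc with hc | hc
  · refine ⟨-vecPrim k, ?_, -(c⁻¹ * ((Finset.univ.gcd k : ℤ) : ℝ)), ?_, ?_⟩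
    · have : Finset.univ.gcd (-vecPrim k) ∣ 1 := by
        rw [← gcd_vecPrim hk]
        exact Finset.dvd_gcd fun i hi => by
          have := Finset.gcd_dvd (f := -vecPrim k) hi
          simpa using this
      exact Int.eq_one_of_dvd_one (gcd_nonneg _) this
    · have := inv_lt_zero.2 hc
      nlinarith
    · conv_lhs => rw [h1]
      have : intVec (-vecPrim k) = -intVec (vecPrim k) := by ext; simp [intVec]
      rw [this, smul_neg, neg_smul, neg_neg]
  · exact ⟨vecPrim k, gcd_vecPrim hk, _, mul_pos (inv_pos.2 hc) hG, h1⟩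

/-- Here w may be irrational, but its tight space is cut out by integer rows, so elimination yields
a nonzero integer vector in it. On a line this vector is a multiple of w, and its primitive part
with the right sign is the circuit. -/
theorem exists_circuit {a : Fin mA → Fin n → ℤ} {b : Fin mB → Fin n → ℤ} (ha : RowScaled a A)
    (hb : RowScaled b B) {w : Fin n → ℝ} (hw : A *ᵥ w = 0) (hw0 : w ≠ 0)
    (hr : zeroRank A B w = n - 1) : ∃ g ∈ circuits A B, ∃ c : ℝ, 0 < c ∧ w = c • intVec g := by
  obtain ⟨K, S, R, h⟩ := exists_isEliminated (tightRows a b w)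
  obtain ⟨i, hi⟩ := h.exists_ne_zero hw0
    ((mem_tightSpace_iff_rows ha hb hw).1 (self_mem_tightSpace hw))
  have hK : intVec (K i) ∈ tightSpace A B w := (mem_tightSpace_iff_rows ha hb hw).2
    fun r hr => by rw [intVec_dotProduct, h.orth r hr i, Int.cast_zero]
  obtain ⟨c, hc⟩ := (zeroRank_eq_iff hw hw0).1 hr _ hK
  obtain ⟨g, hg, d, hd, hgw⟩ := exists_primitive_multiple hi hc
  have hAg : A *ᵥ intVec g = 0 := by
    rw [hgw, mulVec_smul] at hw
    exact (smul_eq_zero.1 hw).resolve_left hd.ne'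
  refine ⟨g, mem_circuits hAg hg ?_ ?_, d, hd, hgw⟩
  · rintro h0; rw [h0, smul_zero] at hgw; exact hw0 hgw
  · rw [← hr, hgw, zeroRank_smul hAg hd.ne']

/-- One elementary step towards a conformal circuit. -/
theorem exists_conformal_support_ssubset (hp : IsPointed A B) {w : Fin n → ℝ} (hw : A *ᵥ w = 0)
    (hw0 : w ≠ 0) (hr : zeroRank A B w ≠ n - 1) : ∃ x, A *ᵥ x = 0 ∧ x ≠ 0 ∧ Conformal B x w ∧
      Function.support (B *ᵥ x) ⊂ Function.support (B *ᵥ w) := by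
  rw [Ne, zeroRank_eq_iff hw hw0] at hr
  push Not at hr
  obtain ⟨y, hy, hyw⟩ := hr
  rw [mem_tightSpace hw] at hy
  have hy0 : y ≠ 0 := fun h => hyw 0 (by simp [h])
  obtain ⟨j, hj, hmin⟩ := exists_min_ratio (x := w) (hp.exists_ne_zero hy.1 hy0)
  obtain ⟨h1, h2⟩ := conformal_sub_smul hj hmin
  refine ⟨_, ?_, ?_, h1, h1.support_subset.ssubset_of_not_subset fun h => ?_⟩
  · rw [mulVec_sub, mulVec_smul, hw, hy.1, smul_zero, sub_zero]
  -- If the difference vanished, w would be a nonzero multiple of y, hence y a multiple of w,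
  -- contrary to its choice.
  · intro h
    rw [sub_eq_zero] at h
    have hc : (B *ᵥ w) j / (B *ᵥ y) j ≠ 0 := by
      intro hc
      rw [hc, zero_smul] at h
      exact hw0 h
    generalize (B *ᵥ w) j / (B *ᵥ y) j = c at h hc
    exact hyw c⁻¹ (by rw [h, smul_smul, inv_mul_cancel₀ hc, one_smul])
  -- The coordinate j lies in the support of Bw because By vanishes wherever Bw does; it becomes
  -- zero, so the support shrinks.
  · exact h (a := j) (fun hwj => hj (hy.2 j hwj)) h2

/-- Descent along smaller and smaller supports; each step raises `zeroRank`, which stays below n.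
The rank of the result is recorded because it makes supp(Bg) a proper subset of supp(Bw) whenever w
itself has a different rank. -/
theorem exists_conformal_circuit {a : Fin mA → Fin n → ℤ} {b : Fin mB → Fin n → ℤ}
    (ha : RowScaled a A) (hb : RowScaled b B) (hp : IsPointed A B) {w : Fin n → ℝ}
    (hw : A *ᵥ w = 0) (hw0 : w ≠ 0) :
    ∃ g ∈ circuits A B, Conformal B (intVec g) w ∧ zeroRank A B (intVec g) = n - 1 := by
  by_cases hr : zeroRank A B w = n - 1
  · obtain ⟨g, hg, c, hc, rfl⟩ := exists_circuit ha hb hw hw0 hr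
    exact ⟨g, hg, Conformal.of_smul hc (Conformal.refl _), by
      rw [← hr, zeroRank_smul hg.1 hc.ne']⟩
  · obtain ⟨x, hx, hx0, hxw, hss⟩ := exists_conformal_support_ssubset hp hw hw0 hr
    have h1 := zeroRank_lt hw hx hss
    have h2 := zeroRank_lt_dim (B := B) hx hx0
    obtain ⟨g, hg, hgx, hgr⟩ := exists_conformal_circuit ha hb hp hx hx0
    exact ⟨g, hg, hgx.trans hxw, hgr⟩
termination_by n - zeroRank A B w

/-- The effect of a step of the algorithm. -/
theorem reduce_spec {w : Fin n → ℝ} (hw : A *ᵥ w = 0) {g : Fin n → ℤ} {l : ℝ}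
    (hg : g ∈ circuits A B)
    (hsupp : Function.support (B *ᵥ intVec g) ⊂ Function.support (B *ᵥ w))
    (hsign : SignCompatible B (intVec g) w)
    (hl : IsLeast {r : ℝ | ∃ j, 0 < (B *ᵥ w) j * (B *ᵥ intVec g) j ∧
      r = (B *ᵥ w) j / (B *ᵥ intVec g) j} l) :
    0 < l ∧ A *ᵥ (w - l • intVec g) = 0 ∧ w - l • intVec g ≠ 0 ∧
      Conformal B (w - l • intVec g) w ∧
      Function.support (B *ᵥ (w - l • intVec g)) ⊂ Function.support (B *ᵥ w) := by
  obtain ⟨⟨j, hj, rfl⟩, hmin⟩ := hl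
  have hgj : (B *ᵥ intVec g) j ≠ 0 := fun h => by rw [h, mul_zero] at hj; exact lt_irrefl _ hj
  have hpos : ∀ {i}, (B *ᵥ intVec g) i ≠ 0 → 0 < (B *ᵥ w) i * (B *ᵥ intVec g) i := by
    intro i hi
    rw [mul_comm]
    exact lt_of_le_of_ne (hsign i) (mul_ne_zero hi (hsupp.1 hi)).symm
  have hratio : ∀ {i}, 0 < (B *ᵥ w) i * (B *ᵥ intVec g) i →
      (B *ᵥ w) i / (B *ᵥ intVec g) i = |(B *ᵥ w) i| / |(B *ᵥ intVec g) i| := by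
    intro i hi
    rw [← abs_div, abs_of_pos]
    rcases mul_pos_iff.1 hi with h | h
    · exact div_pos h.1 h.2
    · exact div_pos_of_neg_of_neg h.1 h.2
  obtain ⟨h1, h2⟩ := conformal_sub_smul (x := w) hgj fun i hi => by
    have := hmin ⟨i, hpos hi, rfl⟩
    rwa [hratio hj, hratio (hpos hi), div_le_div_iff₀ (abs_pos.2 hgj) (abs_pos.2 hi)] at this
  refine ⟨?_, ?_, ?_, h1, h1.support_subset.ssubset_of_not_subset fun h => ?_⟩
  · rw [hratio hj]
    exact div_pos (abs_pos.2 (left_ne_zero_of_mul hj.ne')) (abs_pos.2 hgj)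
  · rw [mulVec_sub, mulVec_smul, hw, hg.1, smul_zero, sub_zero]
  -- At a coordinate i of supp(Bw) outside supp(Bg) the subtraction changes nothing, so the new
  -- vector is nonzero.
  · obtain ⟨-, i, hiw, hig⟩ := Set.ssubset_iff_exists.1 hsupp
    intro h
    have h3 := congrFun (congrArg (B *ᵥ ·) h) i
    simp only [mulVec_sub, mulVec_smul, Pi.sub_apply, Pi.smul_apply, smul_eq_mul,
      mulVec_zero, Pi.zero_apply] at h3
    rw [Function.notMem_support.1 hig, mul_zero, sub_zero] at h3
    exact hiw h3
  · exact h (a := j) (left_ne_zero_of_mul hj.ne') h2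

theorem exists_least_ratio (hp : IsPointed A B) {w : Fin n → ℝ} {g : Fin n → ℤ}
    (hg : g ∈ circuits A B) (h : Conformal B (intVec g) w) :
    ∃ l, IsLeast {r : ℝ | ∃ j, 0 < (B *ᵥ w) j * (B *ᵥ intVec g) j ∧
      r = (B *ᵥ w) j / (B *ᵥ intVec g) j} l := by
  obtain ⟨j, hj⟩ := hp.exists_ne_zero hg.1 hg.2.1
  have hfin : {r : ℝ | ∃ j, 0 < (B *ᵥ w) j * (B *ᵥ intVec g) j ∧
      r = (B *ᵥ w) j / (B *ᵥ intVec g) j}.Finite :=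
    (Set.finite_range fun j => (B *ᵥ w) j / (B *ᵥ intVec g) j).subset
      fun r ⟨j, _, hr⟩ => ⟨j, hr.symm⟩
  have hne : {r : ℝ | ∃ j, 0 < (B *ᵥ w) j * (B *ᵥ intVec g) j ∧
      r = (B *ᵥ w) j / (B *ᵥ intVec g) j}.Nonempty := by
    refine ⟨_, j, ?_, rfl⟩
    rw [mul_comm]
    exact lt_of_le_of_ne (h j).1 (mul_ne_zero hj fun hw => hj ((h j).2 hw)).symm
  obtain ⟨l, hl, hmin⟩ := Set.exists_min_image _ id hfin hne
  exact ⟨l, hl, fun r hr => hmin r hr⟩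

end
/-! ### Runs of the algorithm -/

section
variable {n mA mB : ℕ} {A : Matrix (Fin mA) (Fin n) ℝ} {B : Matrix (Fin mB) (Fin n) ℝ}

/-- The invariant of the main loop after `k` passes. -/
structure MainInv (A : Matrix (Fin mA) (Fin n) ℝ) (B : Matrix (Fin mB) (Fin n) ℝ)
    (u : Fin n → ℝ) (k : ℕ) (w : Fin n → ℝ) (out : List ((Fin n → ℤ) × ℝ)) : Prop where
  ker : A *ᵥ w = 0
  ne_zero : w ≠ 0
  rank : A.rank + k ≤ zeroRank A B w
  conformal : Conformal B w u
  length : out.length = k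
  terms : ∀ e ∈ out, e.1 ∈ circuits A B ∧ 0 ≤ e.2 ∧ Conformal B (intVec e.1) u
  sum : u = w + (out.map fun e => e.2 • intVec e.1).sum

/-- The invariant of all configurations of a run. -/
def ConfigInv (A : Matrix (Fin mA) (Fin n) ℝ) (B : Matrix (Fin mB) (Fin n) ℝ)
    (u : Fin n → ℝ) (k : ℕ) : Config n → Prop
  | .main w out => MainInv A B u k w out
  | .halt out => out.length = k ∧ k ≤ n - A.rank ∧ IsSignCompatibleSum A B u out

theorem isSignCompatibleSum_of_conformal {u : Fin n → ℝ} {out : List ((Fin n → ℤ) × ℝ)}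
    (h : ∀ e ∈ out, e.1 ∈ circuits A B ∧ 0 ≤ e.2 ∧ Conformal B (intVec e.1) u)
    (hu : u = (out.map fun e => e.2 • intVec e.1).sum) : IsSignCompatibleSum A B u out :=
  ⟨fun e he => ⟨(h e he).1, (h e he).2.1, (h e he).2.2.signCompatible⟩,
    fun e he e' he' => (h e he).2.2.signCompatible_of_common (h e' he').2.2, hu⟩

theorem norm_div_norm {g : Fin n → ℤ} (hg : intVec g ≠ 0) {a : ℝ} (ha : 0 < a) :
    ‖a • intVec g‖ / ‖intVec g‖ = a := by
  rw [norm_smul, Real.norm_of_nonneg ha.le, mul_div_cancel_right₀ _ (norm_ne_zero_iff.2 hg)]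

/-- A reduction raises the rank by at least one, which pays for the additional pass; in the final
pass the bound follows from the rank of w being less than n. New circuits are conformal to w, hence
to u. -/
theorem ConfigInv.step {u : Fin n → ℝ} {k : ℕ} {c c' : Config n} (h : ConfigInv A B u k c)
    (hs : Step A B c c') : ConfigInv A B u (k + 1) c' := by
  cases hs with
  | finish w out g hrank hg hdir =>
    obtain ⟨a, ha, rfl⟩ := hdir
    have h : MainInv A B u k (a • intVec g) out := h
    have hd := zeroRank_lt_dim (B := B) h.ker h.ne_zero
    have hr := h.rank
    refine ⟨by simp [h.length], by omega, ?_⟩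
    rw [norm_div_norm hg.2.1 ha]
    apply isSignCompatibleSum_of_conformal
    · intro e he
      rcases List.mem_append.1 he with he | he
      · exact h.terms e he
      · rw [List.mem_singleton.1 he]
        exact ⟨hg, ha.le, Conformal.of_smul ha h.conformal⟩
    · rw [List.map_append, List.sum_append]
      conv_lhs => rw [h.sum]
      simp [add_comm]
  | reduce w out g l hrank hg hsupp hsign hl =>
    have h : MainInv A B u k w out := h
    obtain ⟨hl0, hA, h0, hc, hss⟩ := reduce_spec h.ker hg hsupp hsign hl
    have h1 := zeroRank_lt h.ker hA hss
    have hr := h.rank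
    refine ⟨hA, h0, by omega, hc.trans h.conformal, by simp [h.length], ?_, ?_⟩
    · intro e he
      rcases List.mem_append.1 he with he | he
      · exact h.terms e he
      · rw [List.mem_singleton.1 he]
        exact ⟨hg, hl0.le, (Conformal.of_support hsign hsupp.1).trans h.conformal⟩
    · rw [List.map_append, List.sum_append]
      conv_lhs => rw [h.sum]
      simp only [List.map_cons, List.map_nil, List.sum_cons, List.sum_nil]
      abel

theorem configInv_of_isRun {u : Fin n → ℝ} (hu : A *ᵥ u = 0) (hu0 : u ≠ 0) {k : ℕ}
    {c : ℕ → Config n} (h : IsRun A B u k c) : ConfigInv A B u k (c k) := by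
  have key : ∀ i ≤ k, ConfigInv A B u i (c i) := by
    intro i
    induction i with
    | zero =>
      intro _
      rw [h.1]
      exact ⟨hu, hu0, rank_le_zeroRank hu, Conformal.refl u, rfl, by simp, by simp⟩
    | succ i ih => exact fun hi => (ih (by omega)).step (h.2 i (by omega))
  exact key k le_rfl

theorem ConfigInv.le {u : Fin n → ℝ} {k : ℕ} {c : Config n} (h : ConfigInv A B u k c) :
    k ≤ n - A.rank := by
  cases c with
  | main w out =>
    have h : MainInv A B u k w out := h
    have := zeroRank_lt_dim (B := B) h.ker h.ne_zero
    have := h.rank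
    omega
  | halt out => exact h.2.1

theorem exists_step {a : Fin mA → Fin n → ℤ} {b : Fin mB → Fin n → ℤ} (ha : RowScaled a A)
    (hb : RowScaled b B) (hp : IsPointed A B) {w : Fin n → ℝ} (hw : A *ᵥ w = 0) (hw0 : w ≠ 0)
    (out : List ((Fin n → ℤ) × ℝ)) : ∃ c, Step A B (.main w out) c := by
  by_cases hr : zeroRank A B w = n - 1
  · obtain ⟨g, hg, hgw⟩ := exists_circuit ha hb hw hw0 hr
    exact ⟨_, .finish w out g hr hg hgw⟩
  · obtain ⟨g, hg, hgw, hgr⟩ := exists_conformal_circuit ha hb hp hw hw0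
    obtain ⟨l, hl⟩ := exists_least_ratio hp hg hgw
    refine ⟨_, .reduce w out g l hr hg (hgw.support_subset.ssubset_of_ne fun h => hr ?_)
      hgw.signCompatible hl⟩
    rw [← hgr]
    exact zeroRank_congr hw hg.1 h

theorem run_spec {a : Fin mA → Fin n → ℤ} {b : Fin mB → Fin n → ℤ} (ha : RowScaled a A)
    (hb : RowScaled b B) (hp : IsPointed A B) {u : Fin n → ℝ} (hu : A *ᵥ u = 0) (hu0 : u ≠ 0)
    {k : ℕ} {c : ℕ → Config n} (h : IsRun A B u k c) :
    k ≤ n - A.rank ∧ ((∃ c', Step A B (c k) c') ∨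
      ∃ out, c k = .halt out ∧ IsSignCompatibleSum A B u out ∧ out.length ≤ n - A.rank) := by
  have h1 := configInv_of_isRun hu hu0 h
  refine ⟨h1.le, ?_⟩
  cases hc : c k with
  | main w out =>
    rw [hc] at h1
    exact Or.inl (exists_step ha hb hp h1.ker h1.ne_zero out)
  | halt out =>
    rw [hc] at h1
    exact Or.inr ⟨out, rfl, h1.2.2, h1.1 ▸ h1.2.1⟩

theorem isRun_zero (u : Fin n → ℝ) : IsRun A B u 0 (fun _ => .main u []) :=
  ⟨rfl, fun _ h => absurd h (Nat.not_lt_zero _)⟩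

theorem IsRun.succ {u : Fin n → ℝ} {k : ℕ} {c : ℕ → Config n} (h : IsRun A B u k c)
    {c' : Config n} (hs : Step A B (c k) c') :
    IsRun A B u (k + 1) (fun i => if i ≤ k then c i else c') := by
  refine ⟨by simpa using h.1, fun i hi => ?_⟩
  rcases Nat.lt_succ_iff_lt_or_eq.1 hi with hi | rfl
  · simpa [hi.le, Nat.succ_le_of_lt hi] using h.2 i hi
  · simpa using hs

end
/-! ### The list algorithms on vectors -/

section
variable {n : ℕ}

/-- Encoding of lists of vectors. -/
def rowsList (L : List (Fin n → ℤ)) : List (List ℤ) := L.map List.ofFn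

theorem zip_ofFn {α β : Type*} (x : Fin n → α) (y : Fin n → β) :
    (List.ofFn x).zip (List.ofFn y) = List.ofFn fun i => (x i, y i) := by
  apply List.ext_getElem <;> simp

theorem dot_ofFn (x y : Fin n → ℤ) : dot (List.ofFn x) (List.ofFn y) = x ⬝ᵥ y := by
  have h : ∀ l : List (ℤ × ℤ), ∀ s, l.foldl (fun s p => s + p.1 * p.2) s =
      s + (l.map fun p => p.1 * p.2).sum := by
    intro l
    induction l with
    | nil => simp
    | cons p l ih => intro s; simp [ih, add_assoc]
  rw [dot, zip_ofFn, h, zero_add, List.map_ofFn, List.sum_ofFn]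
  rfl

theorem dot_nil (r : List ℤ) : dot r [] = 0 := by simp [dot]

theorem comb_ofFn (c d : ℤ) (x y : Fin n → ℤ) :
    comb c d (List.ofFn x) (List.ofFn y) = List.ofFn (c • x - d • y) := by
  rw [comb, zip_ofFn, List.map_ofFn]
  rfl

theorem subMul_ofFn (p q : ℤ) (x y : Fin n → ℤ) :
    subMul p q (List.ofFn x) (List.ofFn y) = List.ofFn ((q * q) • x - (p * q) • y) :=
  comb_ofFn _ _ _ _

theorem content_ofFn (x : Fin n → ℤ) : content (List.ofFn x) = Finset.univ.gcd x := by
  have h1 : ∀ (l : List ℤ) (s d : ℤ), d ∣ l.foldl (fun s z => (Int.gcd s z : ℤ)) s ↔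
      d ∣ s ∧ ∀ z ∈ l, d ∣ z := by
    intro l
    induction l with
    | nil => simp
    | cons z l ih => intro s d; simp [ih, Int.dvd_coe_gcd_iff, and_assoc]
  have h2 : ∀ (l : List ℤ) (s : ℤ), 0 ≤ s → 0 ≤ l.foldl (fun s z => (Int.gcd s z : ℤ)) s := by
    intro l
    induction l with
    | nil => simp
    | cons z l ih => intro s _; exact ih _ (Int.natCast_nonneg _)
  apply Int.dvd_antisymm (h2 _ _ le_rfl) (gcd_nonneg x)
  · refine Finset.dvd_gcd fun i _ => ?_
    exact ((h1 _ 0 _).1 dvd_rfl).2 (x i) (List.mem_ofFn.2 ⟨i, rfl⟩)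
  · refine (h1 _ _ _).2 ⟨dvd_zero _, fun z hz => ?_⟩
    obtain ⟨i, rfl⟩ := List.mem_ofFn.1 hz
    exact Finset.gcd_dvd (Finset.mem_univ i)

theorem content_eq_zero_iff {x : Fin n → ℤ} : content (List.ofFn x) = 0 ↔ x = 0 := by
  rw [content_ofFn, gcd_eq_zero_iff]

theorem primPart_ofFn (x : Fin n → ℤ) : primPart (List.ofFn x) = List.ofFn (vecPrim x) := by
  rw [primPart, content_ofFn, List.map_ofFn]
  rfl

theorem pivot_spec (r : List ℤ) (K : List (List ℤ)) :
    (dot r (pivot r K) = 0 → ∀ k ∈ K, dot r k = 0) ∧ (dot r (pivot r K) ≠ 0 → pivot r K ∈ K) := by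
  have h : ∀ (K : List (List ℤ)) (p : List ℤ),
      (dot r (K.foldl (fun p k => if dot r p = 0 then k else p) p) = 0 →
        dot r p = 0 ∧ ∀ k ∈ K, dot r k = 0) ∧
      (dot r (K.foldl (fun p k => if dot r p = 0 then k else p) p) ≠ 0 →
        dot r p = 0 → K.foldl (fun p k => if dot r p = 0 then k else p) p ∈ K) := by
    intro K
    induction K with
    | nil => simp
    | cons k K ih =>
      intro p
      rw [List.foldl_cons]
      by_cases hp : dot r p = 0
      · rw [if_pos hp]
        refine ⟨fun h => ?_, fun h _ => ?_⟩
        · obtain ⟨h1, h2⟩ := (ih k).1 h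
          exact ⟨hp, by simpa [h1] using h2⟩
        · by_cases hk : dot r k = 0
          · exact List.mem_cons_of_mem _ ((ih k).2 h hk)
          -- Once a vector not orthogonal to `r` is found, the fold never replaces it.
          · have h3 : ∀ K : List (List ℤ),
                K.foldl (fun p k => if dot r p = 0 then k else p) k = k := by
              intro K
              induction K with
              | nil => rfl
              | cons l K ih => rw [List.foldl_cons, if_neg hk, ih]
            rw [h3]
            exact List.mem_cons_self
      · rw [if_neg hp]
        exact ⟨fun h => absurd ((ih p).1 h).1 hp, fun _ h => absurd h hp⟩
  exact ⟨fun h' => ((h K []).1 h').2, fun h' => (h K []).2 h' (dot_nil r)⟩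

theorem elim_spec {rows : List (Fin n → ℤ)} {K : Fin n → Fin n → ℤ} {S : Finset (Fin n)}
    {R : Fin n → Fin n → ℤ} (h : IsEliminated rows K S R) (r : Fin n → ℤ) :
    ∃ K' S' R', elim (List.ofFn r) (rowsList (List.ofFn K)) = rowsList (List.ofFn K') ∧
      IsEliminated (rows ++ [r]) K' S' R' := by
  obtain ⟨h1, h2⟩ := pivot_spec (List.ofFn r) (rowsList (List.ofFn K))
  by_cases hp : dot (List.ofFn r) (pivot (List.ofFn r) (rowsList (List.ofFn K))) = 0
  · refine ⟨K, S, R, by rw [elim, if_pos hp], h.of_orth fun i => ?_⟩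
    rw [← dot_ofFn]
    exact h1 hp _ (List.mem_map.2 ⟨K i, List.mem_ofFn.2 ⟨i, rfl⟩, rfl⟩)
  · obtain ⟨k, hk, hkp⟩ := List.mem_map.1 (h2 hp)
    obtain ⟨p, rfl⟩ := List.mem_ofFn.1 hk
    refine ⟨_, _, _, ?_, h.elim (p := p) (by rwa [← hkp, dot_ofFn] at hp)⟩
    rw [elim, if_neg hp, ← hkp, dot_ofFn, rowsList, rowsList, List.map_map, List.map_ofFn,
      List.map_ofFn]
    congr 1
    ext1 i
    simp only [Function.comp, dot_ofFn, comb_ofFn, primPart_ofFn]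

theorem elimRows_spec (x : Fin n → ℤ) (L : List (Fin n → ℤ)) {rows : List (Fin n → ℤ)}
    {K : Fin n → Fin n → ℤ} {S : Finset (Fin n)} {R : Fin n → Fin n → ℤ}
    (h : IsEliminated rows K S R) :
    ∃ K' S' R', elimRows (List.ofFn x) (rowsList L) (rowsList (List.ofFn K)) =
        rowsList (List.ofFn K') ∧
      IsEliminated (rows ++ L.filter fun r => r ⬝ᵥ x = 0) K' S' R' := by
  induction L generalizing rows K S R with
  | nil => exact ⟨K, S, R, rfl, by simpa using h⟩
  | cons r L ih =>
    by_cases hr : r ⬝ᵥ x = 0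
    · obtain ⟨K₁, S₁, R₁, hK, h₁⟩ := elim_spec h r
      obtain ⟨K₂, S₂, R₂, hK₂, h₂⟩ := ih h₁
      refine ⟨K₂, S₂, R₂, ?_, ?_⟩
      · rw [← hK₂, ← hK]
        simp [elimRows, rowsList, dot_ofFn, hr]
      · simpa [hr] using h₂
    · obtain ⟨K₂, S₂, R₂, hK₂, h₂⟩ := ih h
      refine ⟨K₂, S₂, R₂, ?_, ?_⟩
      · rw [← hK₂]
        simp [elimRows, rowsList, dot_ofFn, hr]
      · simpa [hr] using h₂

/-- A new first row and column turn the identity matrix of size n into that of size n + 1; the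
entries of the list serve only as a counter. -/
theorem identity_eq : ∀ (n : ℕ) (l : List ℤ), l.length = n →
    identity l = rowsList (List.ofFn fun i j : Fin n => if i = j then (1 : ℤ) else 0) := by
  intro n
  induction n with
  | zero =>
    intro l hl
    rw [List.length_eq_zero_iff.1 hl]
    rfl
  | succ n ih =>
    intro l hl
    rcases List.eq_nil_or_concat l with rfl | ⟨l, y, rfl⟩
    · simp at hl
    · have h := ih l (by simpa using hl)
      have h2 : identity (l.concat y) =
          (1 :: (identity l).map fun _ => 0) :: (identity l).map fun r => 0 :: r := by
        simp [identity]
      rw [h2, h, List.ofFn_succ, rowsList, rowsList, List.map_cons, List.ofFn_succ, List.map_map,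
        List.map_map, List.map_ofFn, List.map_ofFn, List.map_ofFn]
      congr 1
      simp [Function.comp_def, Fin.succ_ne_zero, eq_comm]

theorem kernelSpan_spec (A B : List (Fin n → ℤ)) (x : Fin n → ℤ) :
    ∃ K S R, kernelSpan (rowsList A) (rowsList B) (List.ofFn x) = rowsList (List.ofFn K) ∧
      IsEliminated ((A.filter fun r => r ⬝ᵥ x = 0) ++ (B.filter fun r => r ⬝ᵥ x = 0)) K S R := by
  obtain ⟨K₁, S₁, R₁, hK₁, h₁⟩ := elimRows_spec x A isEliminated_nil
  obtain ⟨K₂, S₂, R₂, hK₂, h₂⟩ := elimRows_spec x B h₁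
  refine ⟨K₂, S₂, R₂, ?_, h₂⟩
  rw [kernelSpan, identity_eq n _ (by simp), hK₁, hK₂]

/-- Ratios are compared by squared cross products, so neither division nor absolute values are
needed. The start value (1, 0) plays the role of infinity: any row with a nonzero denominator
replaces it. -/
theorem minRatio_spec (L : List (List ℤ)) (x y : List ℤ) :
    (minRatio L x y = (1, 0) ∧ ∀ r ∈ L, dot r y = 0) ∨
    ∃ r ∈ L, minRatio L x y = (dot r x, dot r y) ∧ dot r y ≠ 0 ∧
      ∀ r' ∈ L, (dot r x * dot r' y) ^ 2 ≤ (dot r y * dot r' x) ^ 2 := by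
  induction L using List.reverseRecOn with
  | nil => left; simp [minRatio]
  | append_singleton L r ih =>
    have h : minRatio (L ++ [r]) x y =
        if ((minRatio L x y).1 * dot r y) * ((minRatio L x y).1 * dot r y) ≤
          ((minRatio L x y).2 * dot r x) * ((minRatio L x y).2 * dot r x)
        then minRatio L x y else (dot r x, dot r y) := by
      rw [minRatio, List.foldl_append]
      rfl
    rcases ih with ⟨ih1, ih2⟩ | ⟨s, hs, ih1, ih2, ih3⟩
    · rw [ih1] at h
      simp only [one_mul, zero_mul] at h
      by_cases hr : dot r y = 0
      · left
        refine ⟨by simpa [hr] using h, fun r' hr' => ?_⟩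
        rcases List.mem_append.1 hr' with hr' | hr'
        · exact ih2 r' hr'
        · rw [List.mem_singleton.1 hr', hr]
      · right
        refine ⟨r, by simp, by rwa [if_neg (not_le.2 (mul_self_pos.2 hr))] at h, hr,
          fun r' hr' => ?_⟩
        rcases List.mem_append.1 hr' with hr' | hr'
        · rw [ih2 r' hr', mul_zero]; positivity
        · rw [List.mem_singleton.1 hr', mul_comm]
    · right
      rw [ih1] at h
      simp only at h
      by_cases hr : (dot s x * dot r y) * (dot s x * dot r y) ≤
          (dot s y * dot r x) * (dot s y * dot r x)
      · rw [if_pos hr] at h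
        refine ⟨s, List.mem_append_left _ hs, h, ih2, fun r' hr' => ?_⟩
        rcases List.mem_append.1 hr' with hr' | hr'
        · exact ih3 r' hr'
        · rw [List.mem_singleton.1 hr', sq, sq]; exact hr
      · rw [if_neg hr] at h
        push Not at hr
        have hr0 : dot r y ≠ 0 := by
          intro h0
          rw [h0, mul_zero] at hr
          exact absurd hr (not_lt.2 (by simpa using mul_self_nonneg _))
        refine ⟨r, by simp, h, hr0, fun r' hr' => ?_⟩
        rcases List.mem_append.1 hr' with hr' | hr'
        · have h1 := ih3 r' hr'
          by_contra! h2
          have h3 : 0 < dot s y ^ 2 := by positivity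
          have h4 : 0 < dot r y ^ 2 := by positivity
          have h5 : 0 ≤ dot r' x ^ 2 := sq_nonneg _
          have h6 : 0 ≤ dot r' y ^ 2 := sq_nonneg _
          have h7 : 0 ≤ dot s x ^ 2 := sq_nonneg _
          have h8 : 0 ≤ dot r x ^ 2 := sq_nonneg _
          have e1 : dot s x ^ 2 * dot r' y ^ 2 ≤ dot s y ^ 2 * dot r' x ^ 2 := by
            rw [← mul_pow, ← mul_pow]; exact h1
          have e2 : dot s y ^ 2 * dot r x ^ 2 < dot s x ^ 2 * dot r y ^ 2 := by
            rw [← mul_pow, ← mul_pow, sq, sq]; exact hr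
          have e3 : dot r y ^ 2 * dot r' x ^ 2 < dot r x ^ 2 * dot r' y ^ 2 := by
            rw [← mul_pow, ← mul_pow]; exact h2
          have h9 : 0 < dot r' y ^ 2 := by
            rcases h6.eq_or_lt with h6 | h6
            · rw [← h6, mul_zero] at e3
              exact absurd e3 (not_lt.2 (by positivity))
            · exact h6
          have f1 := mul_le_mul_of_nonneg_left e1 h4.le
          have f2 := mul_lt_mul_of_pos_left e2 h9
          have f3 := mul_lt_mul_of_pos_left e3 h3
          nlinarith
        · rw [List.mem_singleton.1 hr', mul_comm]

/-! ### Bounds on the entries -/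

/-- All entries have absolute value at most `2 ^ e`. -/
def Bounded (e : ℕ) (x : Fin n → ℤ) : Prop := ∀ i, (x i).natAbs ≤ 2 ^ e

theorem Bounded.mono {e e' : ℕ} {x : Fin n → ℤ} (h : Bounded e x) (he : e ≤ e') : Bounded e' x :=
  fun i => (h i).trans (Nat.pow_le_pow_right (by norm_num) he)

theorem natAbs_dotProduct_le {N e e' : ℕ} {x y : Fin n → ℤ} (hn : n ≤ N) (hx : Bounded e x)
    (hy : Bounded e' y) : (x ⬝ᵥ y).natAbs ≤ 2 ^ (N + e + e') := by
  calc (x ⬝ᵥ y).natAbs ≤ ∑ i, (x i * y i).natAbs := Int.natAbs_sum_le _ _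
    _ ≤ ∑ _i : Fin n, 2 ^ (e + e') := Finset.sum_le_sum fun i _ => by
        rw [Int.natAbs_mul, pow_add]; exact Nat.mul_le_mul (hx i) (hy i)
    _ = n * 2 ^ (e + e') := by simp
    _ ≤ 2 ^ N * 2 ^ (e + e') := Nat.mul_le_mul_right _ (hn.trans Nat.lt_two_pow_self.le)
    _ = 2 ^ (N + e + e') := by rw [← pow_add, add_assoc]

theorem minRatio_bound {N β e κ : ℕ} (hn : n ≤ N) {L : List (Fin n → ℤ)}
    (hL : ∀ r ∈ L, Bounded β r) {x y : Fin n → ℤ} (hx : Bounded e x) (hy : Bounded κ y) :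
    (minRatio (rowsList L) (List.ofFn x) (List.ofFn y)).1.natAbs ≤ 2 ^ (N + β + e) ∧
    (minRatio (rowsList L) (List.ofFn x) (List.ofFn y)).2.natAbs ≤ 2 ^ (N + β + κ) := by
  rcases minRatio_spec (rowsList L) (List.ofFn x) (List.ofFn y) with ⟨h, -⟩ | ⟨r, hr, h, -⟩
  · rw [h]
    exact ⟨Nat.one_le_two_pow, by simp⟩
  · obtain ⟨r, hr', rfl⟩ := List.mem_map.1 hr
    rw [h, dot_ofFn, dot_ofFn]
    exact ⟨natAbs_dotProduct_le hn (hL r hr') hx, natAbs_dotProduct_le hn (hL r hr') hy⟩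

theorem natAbs_mul_le {x y : ℤ} {e e' : ℕ} (hx : x.natAbs ≤ 2 ^ e) (hy : y.natAbs ≤ 2 ^ e') :
    (x * y).natAbs ≤ 2 ^ (e + e') := by
  rw [Int.natAbs_mul, pow_add]; exact Nat.mul_le_mul hx hy

/-- The exponent e enters each of the two products once: through x in q²x and through p in pqy.
Hence a move adds a number of bits independent of e, and the final 1 accounts for the subtraction.
-/
theorem subMul_bound {N β e κ : ℕ} {p q : ℤ} {x y : Fin n → ℤ} (hx : Bounded e x)
    (hy : Bounded κ y) (hp : p.natAbs ≤ 2 ^ (N + β + e)) (hq : q.natAbs ≤ 2 ^ (N + β + κ)) :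
    Bounded (e + (2 * N + 2 * β + 2 * κ + 1)) ((q * q) • x - (p * q) • y) := by
  intro i
  have h1 := natAbs_mul_le (natAbs_mul_le hq hq) (hx i)
  have h2 := natAbs_mul_le (natAbs_mul_le hp hq) (hy i)
  have h3 : N + β + κ + (N + β + κ) + e = e + (2 * N + 2 * β + 2 * κ) := by ring
  have h4 : N + β + e + (N + β + κ) + κ = e + (2 * N + 2 * β + 2 * κ) := by ring
  rw [h3] at h1
  rw [h4] at h2
  rw [← add_assoc, pow_succ, mul_two]
  exact (Int.natAbs_sub_le _ _).trans (Nat.add_le_add h1 h2)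

theorem IsEliminated.bounded {rows : List (Fin n → ℤ)} {K : Fin n → Fin n → ℤ}
    {S : Finset (Fin n)} {R : Fin n → Fin n → ℤ} (h : IsEliminated rows K S R) {N β : ℕ}
    (hn : n ≤ N) (hrows : ∀ r ∈ rows, Bounded β r) (i : Fin n) : Bounded ((N + β) * N) (K i) := by
  intro j
  calc (K i j).natAbs ≤ (n * 2 ^ β) ^ n :=
        h.natAbs_le Nat.one_le_two_pow (fun r hr j => hrows r hr j) i j
    _ ≤ (2 ^ N * 2 ^ β) ^ n := by
        gcongr
        exact hn.trans Nat.lt_two_pow_self.le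
    _ = 2 ^ ((N + β) * n) := by rw [← pow_add, ← pow_mul]
    _ ≤ 2 ^ ((N + β) * N) := Nat.pow_le_pow_right (by norm_num) (by gcongr)

theorem moveTo_ofFn (L : List (Fin n → ℤ)) (x y : Fin n → ℤ) :
    ∃ x' : Fin n → ℤ, moveTo (rowsList L) (List.ofFn x) (List.ofFn y) = List.ofFn x' ∧
      (∀ {N β e κ : ℕ}, n ≤ N → (∀ r ∈ L, Bounded β r) → Bounded e x → Bounded κ y →
        Bounded (e + (2 * N + 2 * β + 2 * κ + 1)) x') ∧
      let m := minRatio (rowsList L) (List.ofFn x) (List.ofFn y)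
      let z := (m.2 * m.2) • x - (m.1 * m.2) • y
      (z = 0 ∧ x' = x) ∨ (z ≠ 0 ∧ x' = z) := by
  by_cases hz : ((minRatio (rowsList L) (List.ofFn x) (List.ofFn y)).2 *
      (minRatio (rowsList L) (List.ofFn x) (List.ofFn y)).2) • x -
      ((minRatio (rowsList L) (List.ofFn x) (List.ofFn y)).1 *
      (minRatio (rowsList L) (List.ofFn x) (List.ofFn y)).2) • y = 0
  · refine ⟨x, ?_, fun _ _ hx _ => hx.mono (Nat.le_add_right _ _), Or.inl ⟨hz, rfl⟩⟩
    rw [moveTo, subMul_ofFn, if_pos (content_eq_zero_iff.2 hz)]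
  · refine ⟨_, ?_, fun hn hL hx hy => ?_, Or.inr ⟨hz, rfl⟩⟩
    · rw [moveTo, subMul_ofFn, if_neg (content_eq_zero_iff.not.2 hz)]
    · obtain ⟨hp, hq⟩ := minRatio_bound hn hL hx hy
      exact subMul_bound hx hy hp hq

end
/-! ### Correctness of the descent -/

section
variable {n mA mB : ℕ} {A : Matrix (Fin mA) (Fin n) ℝ} {B : Matrix (Fin mB) (Fin n) ℝ}
  {a : Fin mA → Fin n → ℤ} {b : Fin mB → Fin n → ℤ}

/-- The growth of the entries in one move. -/
def growth (N β : ℕ) : ℕ := 2 * N + 2 * β + 2 * ((N + β) * N) + 1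

theorem moves_bounded {N β e : ℕ} (hn : n ≤ N) {L : List (Fin n → ℤ)}
    (hL : ∀ r ∈ L, Bounded β r) (K : List (Fin n → ℤ)) (hK : ∀ k ∈ K, Bounded ((N + β) * N) k)
    {x : Fin n → ℤ} (hx : Bounded e x) : ∃ x' : Fin n → ℤ,
      moves (rowsList L) (List.ofFn x) (rowsList K) = List.ofFn x' ∧
      Bounded (e + K.length * growth N β) x' := by
  induction K generalizing e x with
  | nil => exact ⟨x, rfl, by simpa using hx⟩
  | cons k K ih =>
    obtain ⟨x₁, h₁, hb₁, -⟩ := moveTo_ofFn L x k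
    obtain ⟨x₂, h₂, hb₂⟩ := ih (fun k hk => hK k (List.mem_cons_of_mem _ hk))
      (hb₁ hn hL hx (hK k List.mem_cons_self))
    refine ⟨x₂, ?_, hb₂.mono (le_of_eq ?_)⟩
    · rw [← h₂, ← h₁]; rfl
    · rw [List.length_cons, growth]; ring

/-- The spanning set is recomputed in every round, but its entries are bounded in terms of the rows
alone, however large x has become. So each round adds at most N times `growth N β` bits. -/
theorem descend_bounded {N β e : ℕ} (hn : n ≤ N) {LA LB : List (Fin n → ℤ)}
    (hA : ∀ r ∈ LA, Bounded β r) (hB : ∀ r ∈ LB, Bounded β r) (l : List ℤ) {x : Fin n → ℤ}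
    (hx : Bounded e x) : ∃ x' : Fin n → ℤ,
      l.foldl (fun x _ => moves (rowsList LB) x (kernelSpan (rowsList LA) (rowsList LB) x))
        (List.ofFn x) = List.ofFn x' ∧ Bounded (e + l.length * (N * growth N β)) x' := by
  induction l generalizing e x with
  | nil => exact ⟨x, rfl, by simpa using hx⟩
  | cons z l ih =>
    obtain ⟨K, S, R, hK, h⟩ := kernelSpan_spec LA LB x
    obtain ⟨x₁, h₁, hb₁⟩ := moves_bounded hn hB (List.ofFn K) (fun k hk => by
      obtain ⟨i, rfl⟩ := List.mem_ofFn.1 hk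
      refine h.bounded hn (fun r hr => ?_) i
      rcases List.mem_append.1 hr with hr | hr
      · exact hA r (List.mem_of_mem_filter hr)
      · exact hB r (List.mem_of_mem_filter hr)) hx
    obtain ⟨x₂, h₂, hb₂⟩ := ih hb₁
    refine ⟨x₂, ?_, hb₂.mono ?_⟩
    · rw [List.foldl_cons, hK, h₁, h₂]
    · rw [List.length_cons, List.length_ofFn, Nat.succ_mul]
      have := Nat.mul_le_mul_right (growth N β) hn
      omega

/-- The positive scaling factor of a row appears in both numerator and denominator, so the integer
rows yield the same ratios and the same minimum as `B`. -/
theorem minRatio_real (hb : RowScaled b B) {x y : Fin n → ℤ}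
    (hy : ∃ j, (B *ᵥ intVec y) j ≠ 0) :
    ∃ j, (B *ᵥ intVec y) j ≠ 0 ∧
      (∀ i, (B *ᵥ intVec y) i ≠ 0 → |(B *ᵥ intVec x) j| * |(B *ᵥ intVec y) i| ≤
        |(B *ᵥ intVec x) i| * |(B *ᵥ intVec y) j|) ∧
      let m := minRatio (rowsList (List.ofFn b)) (List.ofFn x) (List.ofFn y)
      m.2 ≠ 0 ∧ (m.1 : ℝ) / m.2 = (B *ᵥ intVec x) j / (B *ᵥ intVec y) j := by
  have hmem : ∀ i, List.ofFn (b i) ∈ rowsList (List.ofFn b) := fun i =>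
    List.mem_map.2 ⟨b i, List.mem_ofFn.2 ⟨i, rfl⟩, rfl⟩
  rcases minRatio_spec (rowsList (List.ofFn b)) (List.ofFn x) (List.ofFn y) with
    ⟨-, h⟩ | ⟨r, hr, hm, hr0, h⟩
  · exfalso
    obtain ⟨j, hj⟩ := hy
    apply hj
    rw [← hb.eq_zero_iff, intVec_dotProduct, ← dot_ofFn, h _ (hmem j), Int.cast_zero]
  · obtain ⟨r, hr', rfl⟩ := List.mem_map.1 hr
    obtain ⟨j, rfl⟩ := List.mem_ofFn.1 hr'
    rw [dot_ofFn] at hr0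
    obtain ⟨c, hc, hcj⟩ := hb j
    have e1 : ((b j ⬝ᵥ x : ℤ) : ℝ) = c * (B *ᵥ intVec x) j := by rw [← intVec_dotProduct, hcj]
    have e2 : ((b j ⬝ᵥ y : ℤ) : ℝ) = c * (B *ᵥ intVec y) j := by rw [← intVec_dotProduct, hcj]
    refine ⟨j, ?_, fun i hi => ?_, ?_, ?_⟩
    · rw [Ne, ← hb.eq_zero_iff, intVec_dotProduct]
      exact_mod_cast hr0
    · obtain ⟨d, hd, hdi⟩ := hb i
      have e3 : ((b i ⬝ᵥ x : ℤ) : ℝ) = d * (B *ᵥ intVec x) i := by rw [← intVec_dotProduct, hdi]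
      have e4 : ((b i ⬝ᵥ y : ℤ) : ℝ) = d * (B *ᵥ intVec y) i := by rw [← intVec_dotProduct, hdi]
      have h1 := sq_le_sq.1 (h _ (hmem i))
      rw [dot_ofFn, dot_ofFn, dot_ofFn, dot_ofFn] at h1
      have h2 : |((b j ⬝ᵥ x : ℤ) : ℝ) * ((b i ⬝ᵥ y : ℤ) : ℝ)| ≤
          |((b j ⬝ᵥ y : ℤ) : ℝ) * ((b i ⬝ᵥ x : ℤ) : ℝ)| := by exact_mod_cast h1
      rw [e1, e2, e3, e4] at h2
      simp only [abs_mul, abs_of_pos hc, abs_of_pos hd] at h2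
      have h3 : 0 < c * d := mul_pos hc hd
      refine le_of_mul_le_mul_left ?_ h3
      linarith
    · rw [hm, dot_ofFn, dot_ofFn]; exact hr0
    · rw [hm, dot_ofFn, dot_ofFn]
      dsimp only
      rw [e1, e2, mul_div_mul_left _ _ hc.ne']

theorem intVec_subMul {p q : ℤ} (hq : q ≠ 0) (x y : Fin n → ℤ) :
    intVec ((q * q) • x - (p * q) • y) =
      ((q : ℝ) * q) • (intVec x - ((p : ℝ) / q) • intVec y) := by
  have hq' : (q : ℝ) ≠ 0 := by exact_mod_cast hq
  ext i
  simp [intVec]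
  field_simp

/-- The last clause detects stagnation. An accepted move along a tight direction kills a coordinate
of the support; if the support survives, the move was rejected, and this happens only when y is a
multiple of x. -/
theorem moveTo_spec (hb : RowScaled b B) (hp : IsPointed A B) {x y : Fin n → ℤ}
    (hx : A *ᵥ intVec x = 0) (hx0 : x ≠ 0) (hy : A *ᵥ intVec y = 0) :
    ∃ x' : Fin n → ℤ, moveTo (rowsList (List.ofFn b)) (List.ofFn x) (List.ofFn y) = List.ofFn x' ∧
      A *ᵥ intVec x' = 0 ∧ x' ≠ 0 ∧ Conformal B (intVec x') (intVec x) ∧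
      (Function.support (B *ᵥ intVec x) ⊆ Function.support (B *ᵥ intVec x') →
        intVec y ∈ tightSpace A B (intVec x) → x' = x ∧ ∃ c : ℝ, intVec y = c • intVec x) := by
  obtain ⟨x', h, -, hz⟩ := moveTo_ofFn (List.ofFn b) x y
  refine ⟨x', h, ?_⟩
  -- The members of the spanning set that were used up as pivots are zero; for them the ratio is (1,
  -- 0), the candidate vector is 0 and x is kept.
  by_cases hy0 : intVec y = 0
  · rcases minRatio_spec (rowsList (List.ofFn b)) (List.ofFn x) (List.ofFn y) with
      ⟨hm, -⟩ | ⟨r, hr, -, hr0, -⟩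
    · rw [hm] at hz
      simp only [mul_zero, zero_smul, sub_zero, true_and, ne_eq, not_true_eq_false, false_and,
        or_false] at hz
      subst hz
      exact ⟨hx, hx0, Conformal.refl _, fun _ _ => ⟨rfl, 0, by simp [hy0]⟩⟩
    · obtain ⟨r, -, rfl⟩ := List.mem_map.1 hr
      rw [dot_ofFn, intVec_eq_zero.1 hy0] at hr0
      simp at hr0
  obtain ⟨j, hj, hmin, hm0, hm⟩ := minRatio_real (x := x) hb (hp.exists_ne_zero hy hy0)
  simp only at hz hm0 hm
  set m := minRatio (rowsList (List.ofFn b)) (List.ofFn x) (List.ofFn y) with hmdef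
  have hzr := intVec_subMul (p := m.1) hm0 x y
  have hm0' : (0 : ℝ) < (m.2 : ℝ) * m.2 := mul_self_pos.2 (by exact_mod_cast hm0)
  rw [hm] at hzr
  rcases hz with ⟨hz, rfl⟩ | ⟨hz, rfl⟩
  · refine ⟨hx, hx0, Conformal.refl _, fun _ _ => ⟨rfl, ?_⟩⟩
    rw [intVec_eq_zero.2 hz] at hzr
    have h1 := (smul_eq_zero.1 hzr.symm).resolve_left hm0'.ne'
    rw [sub_eq_zero] at h1
    generalize (B *ᵥ intVec x') j / (B *ᵥ intVec y) j = c at h1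
    have hc : c ≠ 0 := by
      rintro rfl
      rw [zero_smul, intVec_eq_zero] at h1
      exact hx0 h1
    exact ⟨c⁻¹, by rw [h1, smul_smul, inv_mul_cancel₀ hc, one_smul]⟩
  · obtain ⟨h1, h2⟩ := conformal_sub_smul hj hmin
    rw [hzr]
    refine ⟨?_, hz, h1.smul hm0'.le, fun hs hyt => ?_⟩
    · rw [mulVec_smul, mulVec_sub, mulVec_smul, hx, hy, smul_zero, sub_zero, smul_zero]
    -- The coordinate j has become zero although it belonged to the support of Bx, y being tight at
    -- x.
    · exfalso
      refine hs (a := j) (fun hxj => hj (((mem_tightSpace hx).1 hyt).2 j hxj)) ?_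
      rw [mulVec_smul, Pi.smul_apply, h2, smul_zero]

/-- Supports can only decrease along the moves. If the final support is the initial one, no single
move shrank it, so x stayed fixed throughout and every direction is a multiple of the same x. -/
theorem moves_spec (hb : RowScaled b B) (hp : IsPointed A B) (K : List (Fin n → ℤ))
    (hK : ∀ k ∈ K, A *ᵥ intVec k = 0) {x : Fin n → ℤ} (hx : A *ᵥ intVec x = 0) (hx0 : x ≠ 0) :
    ∃ x' : Fin n → ℤ, moves (rowsList (List.ofFn b)) (List.ofFn x) (rowsList K) = List.ofFn x' ∧
      A *ᵥ intVec x' = 0 ∧ x' ≠ 0 ∧ Conformal B (intVec x') (intVec x) ∧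
      (Function.support (B *ᵥ intVec x) ⊆ Function.support (B *ᵥ intVec x') →
        (∀ k ∈ K, intVec k ∈ tightSpace A B (intVec x)) →
        ∀ k ∈ K, ∃ c : ℝ, intVec k = c • intVec x) := by
  induction K generalizing x with
  | nil => exact ⟨x, rfl, hx, hx0, Conformal.refl _, by simp⟩
  | cons k K ih =>
    obtain ⟨x₁, h₁, hA₁, hn₁, hc₁, hs₁⟩ := moveTo_spec hb hp hx hx0 (hK k List.mem_cons_self)
    obtain ⟨x₂, h₂, hA₂, hn₂, hc₂, hs₂⟩ := ih (fun k hk => hK k (List.mem_cons_of_mem _ hk)) hA₁ hn₁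
    refine ⟨x₂, ?_, hA₂, hn₂, hc₂.trans hc₁, fun hs hKt => ?_⟩
    · rw [← h₂, ← h₁]; rfl
    · obtain ⟨rfl, hk⟩ := hs₁ (hs.trans hc₂.support_subset) (hKt k List.mem_cons_self)
      intro k' hk'
      rcases List.mem_cons.1 hk' with rfl | hk'
      · exact hk
      · exact hs₂ hs (fun k hk => hKt k (List.mem_cons_of_mem _ hk)) k' hk'

theorem filter_eq_tightRows (a : Fin mA → Fin n → ℤ) (b : Fin mB → Fin n → ℤ) (x : Fin n → ℤ) :
    ((List.ofFn a).filter fun r => r ⬝ᵥ x = 0) ++ ((List.ofFn b).filter fun r => r ⬝ᵥ x = 0) =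
      tightRows a b (intVec x) := by
  simp [tightRows, intVec_dotProduct]

theorem kernelSpan_real (ha : RowScaled a A) (hb : RowScaled b B) {x : Fin n → ℤ}
    (hx : A *ᵥ intVec x = 0) : ∃ K : Fin n → Fin n → ℤ,
      kernelSpan (rowsList (List.ofFn a)) (rowsList (List.ofFn b)) (List.ofFn x) =
        rowsList (List.ofFn K) ∧
      (∀ i, intVec (K i) ∈ tightSpace A B (intVec x)) ∧
      ((∀ i, ∃ c : ℝ, intVec (K i) = c • intVec x) →
        ∀ z ∈ tightSpace A B (intVec x), ∃ c : ℝ, z = c • intVec x) := by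
  obtain ⟨K, S, R, hK, h⟩ := kernelSpan_spec (List.ofFn a) (List.ofFn b) x
  rw [filter_eq_tightRows] at h
  refine ⟨K, hK, fun i => (mem_tightSpace_iff_rows ha hb hx).2 fun r hr => ?_, fun hi z hz => ?_⟩
  · rw [intVec_dotProduct, h.orth r hr, Int.cast_zero]
  · exact h.exists_smul_eq hi ((mem_tightSpace_iff_rows ha hb hx).1 hz)

/-- A round that shrinks the support raises the rank. A round that does not shows that all spanning
vectors of the tight space are multiples of x, so the rank was n - 1 already. The list only counts
the rounds. -/
theorem descend_spec_aux (ha : RowScaled a A) (hb : RowScaled b B) (hp : IsPointed A B)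
    (l : List ℤ) {x : Fin n → ℤ} (hx : A *ᵥ intVec x = 0) (hx0 : x ≠ 0) :
    ∃ x' : Fin n → ℤ,
      l.foldl (fun x _ => moves (rowsList (List.ofFn b)) x
        (kernelSpan (rowsList (List.ofFn a)) (rowsList (List.ofFn b)) x))
        (List.ofFn x) = List.ofFn x' ∧
      A *ᵥ intVec x' = 0 ∧ x' ≠ 0 ∧ Conformal B (intVec x') (intVec x) ∧
      min (zeroRank A B (intVec x) + l.length) (n - 1) ≤ zeroRank A B (intVec x') := by
  induction l generalizing x with
  | nil => exact ⟨x, rfl, hx, hx0, Conformal.refl _, by simp⟩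
  | cons z l ih =>
    obtain ⟨K, hK, hKt, hspan⟩ := kernelSpan_real ha hb hx
    obtain ⟨x₁, h₁, hA₁, hn₁, hc₁, hs₁⟩ := moves_spec hb hp (List.ofFn K) (fun k hk => by
      obtain ⟨i, rfl⟩ := List.mem_ofFn.1 hk
      exact ((mem_tightSpace hx).1 (hKt i)).1) hx hx0
    obtain ⟨x₂, h₂, hA₂, hn₂, hc₂, hr₂⟩ := ih hA₁ hn₁
    refine ⟨x₂, ?_, hA₂, hn₂, hc₂.trans hc₁, le_trans ?_ hr₂⟩
    · rw [List.foldl_cons, hK, h₁, h₂]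
    · have hx0' : intVec x ≠ 0 := intVec_eq_zero.not.2 hx0
      by_cases hs : Function.support (B *ᵥ intVec x) ⊆ Function.support (B *ᵥ intVec x₁)
      · have h3 := hs₁ hs fun k hk => by
          obtain ⟨i, rfl⟩ := List.mem_ofFn.1 hk
          exact hKt i
        have h4 := (zeroRank_eq_iff hx hx0').2
          (hspan fun i => h3 _ (List.mem_ofFn.2 ⟨i, rfl⟩))
        have h5 := zeroRank_mono hx hA₁ hc₁.support_subset
        have h6 : min (zeroRank A B (intVec x) + (z :: l).length) (n - 1) ≤ n - 1 :=
          min_le_right _ _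
        exact le_min (by omega) h6
      · have h5 := zeroRank_lt hx hA₁ (hc₁.support_subset.ssubset_of_not_subset hs)
        rw [List.length_cons]
        omega

/-- The descent finds a conformal circuit. -/
theorem descend_spec (ha : RowScaled a A) (hb : RowScaled b B) (hp : IsPointed A B)
    {v : Fin n → ℤ} (hv : A *ᵥ intVec v = 0) (hv0 : v ≠ 0) : ∃ g : Fin n → ℤ,
      primPart (descend (rowsList (List.ofFn a)) (rowsList (List.ofFn b)) (List.ofFn v)) =
        List.ofFn g ∧
      g ∈ circuits A B ∧ Conformal B (intVec g) (intVec v) ∧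
      zeroRank A B (intVec g) = n - 1 := by
  obtain ⟨x, h, hA, h0, hc, hr⟩ := descend_spec_aux ha hb hp (List.ofFn v) hv hv0
  have hlt := zeroRank_lt_dim (B := B) hA (intVec_eq_zero.not.2 h0)
  rw [List.length_ofFn] at hr
  have hx : intVec x = ((Finset.univ.gcd x : ℤ) : ℝ) • intVec (vecPrim x) := by
    rw [← intVec_smul, gcd_smul_vecPrim]
  have hG : (0 : ℝ) < (Finset.univ.gcd x : ℤ) := by exact_mod_cast gcd_pos h0
  have hgA : A *ᵥ intVec (vecPrim x) = 0 := by
    rw [hx, mulVec_smul] at hA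
    exact (smul_eq_zero.1 hA).resolve_left hG.ne'
  have hgr : zeroRank A B (intVec (vecPrim x)) = n - 1 := by
    have := zeroRank_smul (B := B) hgA hG.ne'
    rw [← hx] at this
    omega
  refine ⟨vecPrim x, ?_, mem_circuits hgA (gcd_vecPrim h0) ?_ hgr, ?_, hgr⟩
  · rw [descend, h, primPart_ofFn]
  · intro hg
    rw [hg, smul_zero, intVec_eq_zero] at hx
    exact h0 hx
  · exact Conformal.of_smul hG (hx ▸ hc)

/-- The tight space of g is a line containing a nonzero vector from the elimination. Being
primitive, g is no longer than that vector, so the bound does not depend on the current vector w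
from which g was computed. -/
theorem bounded_of_mem_circuits (ha : RowScaled a A) (hb : RowScaled b B) {N β : ℕ} (hn : n ≤ N)
    (hβa : ∀ i, Bounded β (a i)) (hβb : ∀ i, Bounded β (b i)) {g : Fin n → ℤ}
    (hg : g ∈ circuits A B) (hr : zeroRank A B (intVec g) = n - 1) :
    Bounded ((N + β) * N) g := by
  obtain ⟨K, S, R, h⟩ := exists_isEliminated (tightRows a b (intVec g))
  obtain ⟨i, hi⟩ := h.exists_ne_zero hg.2.1
    ((mem_tightSpace_iff_rows ha hb hg.1).1 (self_mem_tightSpace hg.1))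
  have hK : intVec (K i) ∈ tightSpace A B (intVec g) := (mem_tightSpace_iff_rows ha hb hg.1).2
    fun r hr => by rw [intVec_dotProduct, h.orth r hr i, Int.cast_zero]
  obtain ⟨c, hc⟩ := (zeroRank_eq_iff hg.1 hg.2.1).1 hr _ hK
  obtain ⟨j, hj⟩ := Function.ne_iff.1 (intVec_eq_zero.not.1 hg.2.1)
  have h1 : g j • K i = K i j • g := by
    ext l
    have e1 := congrFun hc l
    have e2 := congrFun hc j
    simp only [intVec, Pi.smul_apply, smul_eq_mul] at e1 e2 ⊢
    have : (g j : ℝ) * K i l = K i j * g l := by rw [e1, e2]; ring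
    exact_mod_cast this
  intro l
  refine (IsEliminated.natAbs_le_of_smul_eq hg.2.2.1 hj hi h1 l).trans
    (h.bounded hn (fun r hr => ?_) i l)
  classical
  simp only [tightRows, List.mem_append, List.mem_filter, List.mem_ofFn] at hr
  rcases hr with ⟨⟨i, rfl⟩, -⟩ | ⟨⟨i, rfl⟩, -⟩
  · exact hβa i
  · exact hβb i

end
/-! ### Correctness of the whole algorithm -/

section
variable {n mA mB : ℕ} {A : Matrix (Fin mA) (Fin n) ℝ} {B : Matrix (Fin mB) (Fin n) ℝ}
  {a : Fin mA → Fin n → ℤ} {b : Fin mB → Fin n → ℤ}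

theorem lowest_eq (x y : ℤ) (hy : 0 < y) : lowest x y = encodeRat ((x : ℚ) / y) := by
  rw [← Rat.divInt_eq_div, encodeRat, Rat.num_divInt, Rat.den_divInt]
  simp only [lowest, hy.ne', Int.sign_eq_one_of_pos hy, if_false, one_mul]
  rw [Int.gcd_comm]
  simp [abs_of_pos hy]

/-- The real vector `v / Q`. -/
noncomputable def scaledVec (v : Fin n → ℤ) (Q : ℤ) : Fin n → ℝ := (Q : ℝ)⁻¹ • intVec v

theorem isLeast_ratio {w : Fin n → ℝ} {g : Fin n → ℤ} (hgw : Conformal B (intVec g) w) {j : Fin mB}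
    (hj : (B *ᵥ intVec g) j ≠ 0)
    (hmin : ∀ i, (B *ᵥ intVec g) i ≠ 0 →
      |(B *ᵥ w) j| * |(B *ᵥ intVec g) i| ≤ |(B *ᵥ w) i| * |(B *ᵥ intVec g) j|) :
    IsLeast {r : ℝ | ∃ j, 0 < (B *ᵥ w) j * (B *ᵥ intVec g) j ∧
      r = (B *ᵥ w) j / (B *ᵥ intVec g) j} ((B *ᵥ w) j / (B *ᵥ intVec g) j) := by
  have hratio : ∀ {i}, 0 < (B *ᵥ w) i * (B *ᵥ intVec g) i →
      (B *ᵥ w) i / (B *ᵥ intVec g) i = |(B *ᵥ w) i| / |(B *ᵥ intVec g) i| := by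
    intro i hi
    rw [← abs_div, abs_of_pos]
    rcases mul_pos_iff.1 hi with h | h
    · exact div_pos h.1 h.2
    · exact div_pos_of_neg_of_neg h.1 h.2
  have hjpos : 0 < (B *ᵥ w) j * (B *ᵥ intVec g) j := by
    rw [mul_comm]
    exact lt_of_le_of_ne (hgw j).1 (mul_ne_zero hj fun hw => hj ((hgw j).2 hw)).symm
  refine ⟨⟨j, hjpos, rfl⟩, ?_⟩
  rintro r ⟨i, hi, rfl⟩
  have hi0 : (B *ᵥ intVec g) i ≠ 0 := right_ne_zero_of_mul hi.ne'
  rw [hratio hjpos, hratio hi, div_le_div_iff₀ (abs_pos.2 hj) (abs_pos.2 hi0)]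
  exact hmin i hi0

theorem mulVec_scaledVec {v : Fin n → ℤ} {Q : ℤ} (hQ : 0 < Q) :
    A *ᵥ scaledVec v Q = 0 ↔ A *ᵥ intVec v = 0 := by
  have : (Q : ℝ)⁻¹ ≠ 0 := inv_ne_zero (by exact_mod_cast hQ.ne')
  rw [scaledVec, mulVec_smul, smul_eq_zero, or_iff_right this]

theorem scaledVec_eq_zero {v : Fin n → ℤ} {Q : ℤ} (hQ : 0 < Q) :
    scaledVec v Q = 0 ↔ v = 0 := by
  have : (Q : ℝ)⁻¹ ≠ 0 := inv_ne_zero (by exact_mod_cast hQ.ne')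
  rw [scaledVec, smul_eq_zero, or_iff_right this, intVec_eq_zero]

/-- A pass of the program is a step of the algorithm. -/
theorem pass_spec (ha : RowScaled a A) (hb : RowScaled b B) (hp : IsPointed A B)
    {v : Fin n → ℤ} (hv : A *ᵥ intVec v = 0) (hv0 : v ≠ 0) {Q : ℤ} (hQ : 0 < Q)
    (O : List (List ℤ × ℤ × ℤ)) :
    ∃ (g v' : Fin n → ℤ) (l : ℚ) (Q' : ℤ),
      pass (rowsList (List.ofFn a)) (rowsList (List.ofFn b)) (List.ofFn v, Q, O) =
        (List.ofFn v', Q', (List.ofFn g, encodeRat l) :: O) ∧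
      0 < Q' ∧ A *ᵥ intVec v' = 0 ∧
      (∀ {N β e f : ℕ}, n ≤ N → (∀ i, Bounded β (a i)) → (∀ i, Bounded β (b i)) → Bounded e v →
        Q.natAbs ≤ 2 ^ f → Bounded (e + growth N β) v' ∧ Q'.natAbs ≤ 2 ^ (f + growth N β) ∧
        Bounded ((N + β) * N) g ∧ (encodeRat l).1.natAbs ≤ 2 ^ (e + growth N β) ∧
        (encodeRat l).2.natAbs ≤ 2 ^ (f + growth N β)) ∧
      ∀ out, (v' ≠ 0 ∧ Step A B (.main (scaledVec v Q) out)
          (.main (scaledVec v' Q') (out ++ [(g, (l : ℝ))]))) ∨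
        (v' = 0 ∧ Step A B (.main (scaledVec v Q) out) (.halt (out ++ [(g, (l : ℝ))]))) := by
  obtain ⟨g, hg, hgc, hgv, hgr⟩ := descend_spec ha hb hp hv hv0
  obtain ⟨j, hj, hmin, hm0, hm⟩ := minRatio_real (x := v) hb (hp.exists_ne_zero hgc.1 hgc.2.1)
  set m := minRatio (rowsList (List.ofFn b)) (List.ofFn v) (List.ofFn g) with hmdef
  have hmm : 0 < m.2 * m.2 := mul_self_pos.2 hm0
  have hQ' : 0 < m.2 * m.2 * Q := mul_pos hmm hQ
  have hQr : (0 : ℝ) < Q := by exact_mod_cast hQ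
  have hmr : (m.2 : ℝ) ≠ 0 := by exact_mod_cast hm0
  have hl : (((m.1 * m.2 : ℤ) : ℚ) / ((m.2 * m.2 * Q : ℤ) : ℚ) : ℚ) = ((m.1 : ℚ) / m.2 / Q) := by
    have : (m.2 : ℚ) ≠ 0 := by exact_mod_cast hm0
    have : (Q : ℚ) ≠ 0 := by exact_mod_cast hQ.ne'
    push_cast
    field_simp
  have hcont : content (List.ofFn v) ≠ 0 := content_eq_zero_iff.not.2 hv0
  refine ⟨g, (m.2 * m.2) • v - (m.1 * m.2) • g, (m.1 : ℚ) / m.2 / Q, m.2 * m.2 * Q, ?_, hQ', ?_,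
    ?_, fun out => ?_⟩
  · rw [pass, if_neg hcont]
    simp only [hg, ← hmdef, subMul_ofFn]
    rw [lowest_eq _ _ hQ', hl]
  · rw [intVec_subMul hm0, mulVec_smul, mulVec_sub, mulVec_smul, hv, hgc.1]
    simp
  · intro N β e f hn hβa hβb hev hQf
    have hgb := bounded_of_mem_circuits ha hb hn hβa hβb hgc hgr
    obtain ⟨hm1, hm2⟩ := minRatio_bound hn (L := List.ofFn b) (fun r hr => by
      obtain ⟨i, rfl⟩ := List.mem_ofFn.1 hr
      exact hβb i) hev hgb
    have hQb : (m.2 * m.2 * Q).natAbs ≤ 2 ^ (f + growth N β) :=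
      (natAbs_mul_le (natAbs_mul_le hm2 hm2) hQf).trans
        (Nat.pow_le_pow_right (by norm_num) (by rw [growth]; omega))
    refine ⟨subMul_bound hev hgb hm1 hm2, hQb, hgb, ?_, ?_⟩
    · rw [← hl, ← lowest_eq _ _ hQ', lowest]
      refine (Int.natAbs_ediv_le_natAbs _ _).trans ((natAbs_mul_le hm1 hm2).trans
        (Nat.pow_le_pow_right (by norm_num) (by rw [growth]; omega)))
    · rw [← hl, ← lowest_eq _ _ hQ', lowest]
      exact (Int.natAbs_ediv_le_natAbs _ _).trans hQb
  · have hw : A *ᵥ scaledVec v Q = 0 := (mulVec_scaledVec hQ).2 hv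
    have hw0 : scaledVec v Q ≠ 0 := (scaledVec_eq_zero hQ).not.2 hv0
    have hgw : Conformal B (intVec g) (scaledVec v Q) := by
      intro i
      rw [scaledVec, mulVec_smul, Pi.smul_apply, smul_eq_mul]
      obtain ⟨h1, h2⟩ := hgv i
      refine ⟨?_, fun h => h2 ((mul_eq_zero.1 h).resolve_left (inv_ne_zero hQr.ne'))⟩
      have := mul_nonneg (inv_pos.2 hQr).le h1
      linarith
    have hBw : ∀ i, (B *ᵥ scaledVec v Q) i = (Q : ℝ)⁻¹ * (B *ᵥ intVec v) i := fun i => by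
      rw [scaledVec, mulVec_smul]; rfl
    have hlr : (((m.1 : ℚ) / m.2 / Q : ℚ) : ℝ) = (B *ᵥ scaledVec v Q) j / (B *ᵥ intVec g) j := by
      push_cast
      rw [hm, hBw]
      field_simp
    have hleast := isLeast_ratio hgw hj fun i hi => by
      rw [hBw, hBw, abs_mul, abs_mul, mul_assoc, mul_assoc]
      exact mul_le_mul_of_nonneg_left (hmin i hi) (abs_nonneg _)
    rw [← hlr] at hleast
    have hnext : scaledVec ((m.2 * m.2) • v - (m.1 * m.2) • g) (m.2 * m.2 * Q) =
        scaledVec v Q - (((m.1 : ℚ) / m.2 / Q : ℚ) : ℝ) • intVec g := by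
      rw [scaledVec, intVec_subMul hm0, scaledVec]
      ext i
      simp only [Pi.smul_apply, Pi.sub_apply, smul_eq_mul]
      push_cast
      field_simp
    by_cases hr : zeroRank A B (scaledVec v Q) = n - 1
    · right
      -- When the tight space of the current vector is a line, g lies on it. The minimal ratio is
      -- then the exact coefficient, so it equals the quotient of norms and the remainder 0 marks
      -- termination.
      obtain ⟨c, hc⟩ := (zeroRank_eq_iff hw hw0).1 hr (intVec g)
        ((mem_tightSpace hw).2 ⟨hgc.1, fun i hi => (hgw i).2 hi⟩)
      have hBg : ∀ i, (B *ᵥ intVec g) i = c * (B *ᵥ scaledVec v Q) i := fun i => by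
        rw [hc, mulVec_smul]; rfl
      have hc0 : 0 < c := by
        have h1 := (hgw j).1
        rw [hBg, mul_assoc] at h1
        rw [hBg] at hj
        exact lt_of_le_of_ne (nonneg_of_mul_nonneg_left h1
          (mul_self_pos.2 (right_ne_zero_of_mul hj))) (left_ne_zero_of_mul hj).symm
      have hlc : (((m.1 : ℚ) / m.2 / Q : ℚ) : ℝ) = c⁻¹ := by
        have hj' := hj
        rw [hBg] at hj'
        rw [hlr, hBg, div_mul_cancel_right₀ (right_ne_zero_of_mul hj')]
      have hwc : scaledVec v Q = c⁻¹ • intVec g := by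
        rw [hc, smul_smul, inv_mul_cancel₀ hc0.ne', one_smul]
      refine ⟨?_, ?_⟩
      · rw [← scaledVec_eq_zero hQ', hnext, hlc, ← hwc, sub_self]
      · have h1 := Step.finish (A := A) (B := B) (scaledVec v Q) out g hr hgc
          ⟨c⁻¹, inv_pos.2 hc0, hwc⟩
        have h2 : ‖scaledVec v Q‖ / ‖intVec g‖ = c⁻¹ := by
          rw [hwc]; exact norm_div_norm hgc.2.1 (inv_pos.2 hc0)
        rwa [h2, ← hlc] at h1
    · left
      have hss : Function.support (B *ᵥ intVec g) ⊂ Function.support (B *ᵥ scaledVec v Q) :=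
        hgw.support_subset.ssubset_of_ne fun h => hr (by rw [← hgr]; exact zeroRank_congr hw hgc.1 h)
      obtain ⟨-, -, h0, -⟩ := reduce_spec hw hgc hss hgw.signCompatible hleast
      refine ⟨?_, ?_⟩
      · rwa [← hnext, Ne, scaledVec_eq_zero hQ'] at h0
      · rw [hnext]
        exact .reduce _ out g _ hr hgc hss hgw.signCompatible hleast

/-- Passes after termination change nothing, so the program may perform a fixed number of them. -/
theorem pass_of_eq_zero (LA LB : List (List ℤ)) (Q : ℤ) (O : List (List ℤ × ℤ × ℤ)) :
    pass LA LB (List.ofFn (0 : Fin n → ℤ), Q, O) = (List.ofFn (0 : Fin n → ℤ), Q, O) := by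
  rw [pass, if_pos (content_eq_zero_iff.2 rfl)]

theorem encodeOutput_append (out : List ((Fin n → ℤ) × ℚ)) (g : Fin n → ℤ) (l : ℚ) :
    (encodeOutput (out ++ [(g, l)])).reverse =
      (List.ofFn g, encodeRat l) :: (encodeOutput out).reverse := by
  simp [encodeOutput]

theorem realOut_append (out : List ((Fin n → ℤ) × ℚ)) (g : Fin n → ℤ) (l : ℚ) :
    realOut (out ++ [(g, l)]) = realOut out ++ [(g, (l : ℝ))] := by
  simp [realOut]

/-- The state of the program after some passes. -/
theorem passes_spec (ha : RowScaled a A) (hb : RowScaled b B) (hp : IsPointed A B)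
    {v₀ : Fin n → ℤ} (hv : A *ᵥ intVec v₀ = 0) (hv0 : v₀ ≠ 0) {Q₀ : ℤ} (hQ : 0 < Q₀)
    {N β e : ℕ} (hn : n ≤ N) (hβa : ∀ i, Bounded β (a i)) (hβb : ∀ i, Bounded β (b i))
    (hev : Bounded e v₀) (hQe : Q₀.natAbs ≤ 2 ^ e) {α : Type*} (l : List α) :
    ∃ (v : Fin n → ℤ) (Q : ℤ) (out : List ((Fin n → ℤ) × ℚ)),
      l.foldl (fun s _ => pass (rowsList (List.ofFn a)) (rowsList (List.ofFn b)) s)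
        (List.ofFn v₀, Q₀, []) = (List.ofFn v, Q, (encodeOutput out).reverse) ∧
      0 < Q ∧ A *ᵥ intVec v = 0 ∧ Bounded (e + l.length * growth N β) v ∧
      Q.natAbs ≤ 2 ^ (e + l.length * growth N β) ∧ out.length ≤ l.length ∧
      (∀ t ∈ out, Bounded ((N + β) * N) t.1 ∧
        (encodeRat t.2).1.natAbs ≤ 2 ^ (e + l.length * growth N β) ∧
        (encodeRat t.2).2.natAbs ≤ 2 ^ (e + l.length * growth N β)) ∧
      ((v ≠ 0 ∧ ∃ c, IsRun A B (scaledVec v₀ Q₀) l.length c ∧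
          c l.length = .main (scaledVec v Q) (realOut out)) ∨
        (v = 0 ∧ ∃ k c, IsRun A B (scaledVec v₀ Q₀) k c ∧ c k = .halt (realOut out))) := by
  induction l using List.reverseRecOn with
  | nil =>
    exact ⟨v₀, Q₀, [], rfl, hQ, hv, by simpa using hev, by simpa using hQe, le_rfl, by simp,
      Or.inl ⟨hv0, _, isRun_zero _, rfl⟩⟩
  | append_singleton l z ih =>
    obtain ⟨v, Q, out, hfold, hQ1, hv1, hvb, hQb, hlen, hout, hrun⟩ := ih
    rw [List.foldl_append, hfold, List.length_append, List.length_singleton]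
    have hpow : 2 ^ (e + l.length * growth N β) ≤ 2 ^ (e + (l.length + 1) * growth N β) :=
      Nat.pow_le_pow_right (by norm_num) (by rw [Nat.succ_mul]; omega)
    have hsucc : e + l.length * growth N β + growth N β = e + (l.length + 1) * growth N β := by ring
    rcases hrun with ⟨hv0, c, hc, hcl⟩ | ⟨rfl, hrun⟩
    · obtain ⟨g, v', r, Q', hpass, hQ', hv', hbd, hstep⟩ :=
        pass_spec ha hb hp hv1 hv0 hQ1 (encodeOutput out).reverse
      obtain ⟨b1, b2, b3, b4, b5⟩ := hbd hn hβa hβb hvb hQb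
      rw [hsucc] at b1 b2 b4 b5
      refine ⟨v', Q', out ++ [(g, r)], ?_, hQ', hv', b1, b2, ?_, ?_, ?_⟩
      · rw [encodeOutput_append, List.foldl_cons, List.foldl_nil, hpass]
      · simpa using hlen
      · intro t ht
        rcases List.mem_append.1 ht with ht | ht
        · obtain ⟨h1, h2, h3⟩ := hout t ht
          exact ⟨h1, h2.trans hpow, h3.trans hpow⟩
        · rw [List.mem_singleton.1 ht]
          exact ⟨b3, b4, b5⟩
      · rw [realOut_append]
        rcases hstep (realOut out) with ⟨h0, hs⟩ | ⟨h0, hs⟩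
        · rw [← hcl] at hs
          exact Or.inl ⟨h0, _, hc.succ hs, by simp⟩
        · rw [← hcl] at hs
          exact Or.inr ⟨h0, _, _, hc.succ hs, by simp⟩
    · refine ⟨0, Q, out, ?_, hQ1, hv1, hvb.mono (by omega), hQb.trans hpow, by omega,
        fun t ht => ?_, Or.inr ⟨rfl, hrun⟩⟩
      · rw [List.foldl_cons, List.foldl_nil, pass_of_eq_zero]
      · obtain ⟨h1, h2, h3⟩ := hout t ht
        exact ⟨h1, h2.trans hpow, h3.trans hpow⟩

/-- A run still in the main loop after n passes would have rank at least n, while the rank at a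
nonzero vector is less than n. So n passes are enough for the program to finish. -/
theorem passes_halt (ha : RowScaled a A) (hb : RowScaled b B) (hp : IsPointed A B)
    {v₀ : Fin n → ℤ} (hv : A *ᵥ intVec v₀ = 0) (hv0 : v₀ ≠ 0) {Q₀ : ℤ} (hQ : 0 < Q₀)
    {N β e : ℕ} (hn : n ≤ N) (hβa : ∀ i, Bounded β (a i)) (hβb : ∀ i, Bounded β (b i))
    (hev : Bounded e v₀) (hQe : Q₀.natAbs ≤ 2 ^ e) {α : Type*} (l : List α) (hl : l.length = n) :
    ∃ out : List ((Fin n → ℤ) × ℚ),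
      (l.foldl (fun s _ => pass (rowsList (List.ofFn a)) (rowsList (List.ofFn b)) s)
        (List.ofFn v₀, Q₀, [])).2.2.reverse = encodeOutput out ∧
      (∃ k c, IsRun A B (scaledVec v₀ Q₀) k c ∧ c k = .halt (realOut out)) ∧
      IsSignCompatibleSum A B (scaledVec v₀ Q₀) (realOut out) ∧ out.length ≤ n - A.rank := by
  obtain ⟨v, Q, out, hfold, hQ1, -, -, -, -, -, hrun⟩ :=
    passes_spec ha hb hp hv hv0 hQ hn hβa hβb hev hQe l
  have hu := (mulVec_scaledVec (A := A) hQ).2 hv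
  have hu0 := (scaledVec_eq_zero hQ).not.2 hv0
  rcases hrun with ⟨-, c, hc, hcl⟩ | ⟨-, k, c, hc, hck⟩
  · exfalso
    have h1 := configInv_of_isRun hu hu0 hc
    rw [hcl] at h1
    have h2 := h1.rank
    have h3 := zeroRank_lt_dim (B := B) h1.ker h1.ne_zero
    omega
  · have h1 := configInv_of_isRun hu hu0 hc
    rw [hck] at h1
    obtain ⟨h2, h3, h4⟩ := h1
    refine ⟨out, by rw [hfold, List.reverse_reverse], ⟨k, c, hc, hck⟩, h4, ?_⟩
    rw [realOut, List.length_map] at h2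
    omega

end

/-! ### Clearing denominators -/

theorem natAbs_denProd_le (r : List (ℤ × ℤ)) :
    (denProd r).natAbs ≤ 2 ^ (Ty.list .rat).size r := by
  have h : ∀ (r : List (ℤ × ℤ)) (s : ℤ),
      (r.foldl (fun s z => s * z.2) s).natAbs ≤ s.natAbs * 2 ^ (Ty.list .rat).size r := by
    intro r
    induction r with
    | nil => intro s; rw [List.foldl_nil]; exact Nat.le_mul_of_pos_right _ (Nat.two_pow_pos _)
    | cons z r ih =>
      intro s
      refine (ih _).trans ?_
      have h1 := Ty.size_cons (a := .rat) z r
      have h2 : (Ty.rat).size z = Ty.int.size z.1 + Ty.int.size z.2 + 1 := rfl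
      rw [h1, Int.natAbs_mul, mul_assoc]
      refine Nat.mul_le_mul_left _ ?_
      calc z.2.natAbs * 2 ^ (Ty.list .rat).size r
          ≤ 2 ^ Ty.int.size z.2 * 2 ^ (Ty.list .rat).size r :=
            Nat.mul_le_mul_right _ (Ty.natAbs_lt_two_pow_size _).le
        _ ≤ _ := by
            rw [← pow_add]
            exact Nat.pow_le_pow_right (by norm_num) (by omega)
  exact (h r 1).trans (by rw [Int.natAbs_one, one_mul])

/-- Numerator and cofactor each contribute at most the size of the encoded vector; the division can
only decrease the absolute value of the product of denominators. -/
theorem natAbs_le_of_mem_clear {r : List (ℤ × ℤ)} {z : ℤ} (hz : z ∈ clear r) :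
    z.natAbs ≤ 2 ^ (2 * (Ty.list .rat).size r) := by
  obtain ⟨y, hy, rfl⟩ := List.mem_map.1 hz
  rw [two_mul]
  refine natAbs_mul_le ?_ ((Int.natAbs_ediv_le_natAbs _ _).trans (natAbs_denProd_le r))
  have h1 := Ty.size_le_of_mem (a := .rat) hy
  have h2 : (Ty.rat).size y = Ty.int.size y.1 + Ty.int.size y.2 + 1 := rfl
  exact (Ty.natAbs_lt_two_pow_size _).le.trans (Nat.pow_le_pow_right (by norm_num) (by omega))

section
variable {n : ℕ}

theorem denProd_encodeVec (r : Fin n → ℚ) : denProd (encodeVec r) = ∏ i, ((r i).den : ℤ) := by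
  have h : ∀ (r : List (ℤ × ℤ)) (s : ℤ),
      r.foldl (fun s z => s * z.2) s = s * (r.map fun z => z.2).prod := by
    intro r
    induction r with
    | nil => simp
    | cons z r ih => intro s; simp [ih, mul_assoc]
  rw [denProd, h, one_mul, encodeVec, List.map_ofFn, List.prod_ofFn]
  rfl

theorem denProd_pos (r : Fin n → ℚ) : 0 < denProd (encodeVec r) := by
  rw [denProd_encodeVec]
  exact Finset.prod_pos fun i _ => by exact_mod_cast (r i).den_pos

/-- The integer vector obtained by clearing denominators. -/
def clearVec (r : Fin n → ℚ) : Fin n → ℤ := fun i =>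
  (r i).num * (denProd (encodeVec r) / (r i).den)

theorem clear_encodeVec (r : Fin n → ℚ) : clear (encodeVec r) = List.ofFn (clearVec r) := by
  rw [clear]
  conv_lhs => rw [encodeVec]
  rw [List.map_ofFn]
  rfl

theorem intVec_clearVec (r : Fin n → ℚ) :
    intVec (clearVec r) = (denProd (encodeVec r) : ℝ) • realVec r := by
  ext i
  have h1 : ((r i).den : ℤ) ∣ denProd (encodeVec r) := by
    rw [denProd_encodeVec]
    exact Finset.dvd_prod_of_mem _ (Finset.mem_univ i)
  obtain ⟨c, hc⟩ := h1
  have h2 : ((r i).den : ℤ) ≠ 0 := by exact_mod_cast (r i).den_nz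
  have h2' : ((r i).den : ℝ) ≠ 0 := by exact_mod_cast (r i).den_nz
  have h3 : (realVec r i : ℝ) = (r i).num / (r i).den := by
    rw [realVec]; exact Rat.cast_def _
  rw [Pi.smul_apply, smul_eq_mul, h3]
  simp only [intVec, clearVec, hc, Int.mul_ediv_cancel_left _ h2]
  push_cast
  field_simp

theorem scaledVec_clearVec (r : Fin n → ℚ) :
    scaledVec (clearVec r) (denProd (encodeVec r)) = realVec r := by
  have : (denProd (encodeVec r) : ℝ) ≠ 0 := by exact_mod_cast (denProd_pos r).ne'
  rw [scaledVec, intVec_clearVec, smul_smul, inv_mul_cancel₀ this, one_smul]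

theorem rowScaled_clearVec {m : ℕ} (M : Matrix (Fin m) (Fin n) ℚ) :
    RowScaled (fun i => clearVec (M i)) (realMat M) := by
  intro i
  refine ⟨denProd (encodeVec (M i)), by exact_mod_cast denProd_pos (M i), fun x => ?_⟩
  rw [intVec_clearVec, smul_dotProduct]
  rfl

theorem bounded_clearVec (r : Fin n → ℚ) :
    Bounded (2 * (Ty.list .rat).size (encodeVec r)) (clearVec r) := fun i =>
  natAbs_le_of_mem_clear (by rw [clear_encodeVec]; exact List.mem_ofFn.2 ⟨i, rfl⟩)

theorem map_clear_encodeMat {m : ℕ} (M : Matrix (Fin m) (Fin n) ℚ) :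
    (encodeMat M).map clear = rowsList (List.ofFn fun i => clearVec (M i)) := by
  rw [encodeMat, rowsList, List.map_ofFn, List.map_ofFn]
  congr 1
  ext1 i
  exact clear_encodeVec _

end
/-! ### The algorithm runs in polynomial time -/

section
variable {n : ℕ}

theorem size_ofFn_le {N e : ℕ} (hn : n ≤ N) {x : Fin n → ℤ} (hx : Bounded e x) :
    Ty.vec.size (List.ofFn x) ≤ N * (e + 3) + 1 :=
  Ty.size_le_of_forall (a := .int) (by simpa using hn) fun z hz => by
    obtain ⟨i, rfl⟩ := List.mem_ofFn.1 hz
    exact Ty.size_int_le_of_natAbs_le (hx i)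

theorem size_rowsList_le {N e m : ℕ} (hn : n ≤ N) {L : List (Fin n → ℤ)} (hm : L.length ≤ m)
    (hL : ∀ r ∈ L, Bounded e r) : Ty.mat.size (rowsList L) ≤ m * (N * (e + 3) + 2) + 1 :=
  Ty.size_le_of_forall (a := .vec) (by simpa [rowsList] using hm) fun z hz => by
    obtain ⟨r, hr, rfl⟩ := List.mem_map.1 hz
    exact size_ofFn_le hn (hL r hr)

theorem bounded_of_size_le {x : Fin n → ℤ} {s : ℕ} (h : Ty.vec.size (List.ofFn x) ≤ s) :
    Bounded s x := fun i =>
  (Ty.natAbs_lt_two_pow_size (x i)).le.trans (Nat.pow_le_pow_right (by norm_num)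
    ((Ty.size_le_of_mem (a := .int) (List.mem_ofFn.2 ⟨i, rfl⟩)).trans h))

theorem bounded_of_mem_of_size_le {L : List (Fin n → ℤ)} {s : ℕ}
    (h : Ty.mat.size (rowsList L) ≤ s) : ∀ r ∈ L, Bounded s r := fun r hr =>
  bounded_of_size_le ((Ty.size_le_of_mem (a := .vec) (List.mem_map.2 ⟨r, hr, rfl⟩)).trans h)

theorem dim_le_of_size_le {x : Fin n → ℤ} {s : ℕ} (h : Ty.vec.size (List.ofFn x) ≤ s) : n ≤ s := by
  simpa using (Ty.length_le_size (a := .int) (List.ofFn x)).trans h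

theorem length_le_of_size_le {L : List (Fin n → ℤ)} {s : ℕ} (h : Ty.mat.size (rowsList L) ≤ s) :
    L.length ≤ s := by
  simpa [rowsList] using (Ty.length_le_size (a := .vec) (rowsList L)).trans h

theorem size_kernelSpan_le {N β : ℕ} (hn : n ≤ N) {LA LB : List (Fin n → ℤ)}
    (hA : ∀ r ∈ LA, Bounded β r) (hB : ∀ r ∈ LB, Bounded β r) (x : Fin n → ℤ) :
    Ty.mat.size (kernelSpan (rowsList LA) (rowsList LB) (List.ofFn x)) ≤
      N * (N * ((N + β) * N + 3) + 2) + 1 := by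
  obtain ⟨K, S, R, hK, h⟩ := kernelSpan_spec LA LB x
  rw [hK]
  refine size_rowsList_le hn (by simpa using hn) fun k hk => ?_
  obtain ⟨i, rfl⟩ := List.mem_ofFn.1 hk
  refine h.bounded hn (fun r hr => ?_) i
  rcases List.mem_append.1 hr with hr | hr
  · exact hA r (List.mem_of_mem_filter hr)
  · exact hB r (List.mem_of_mem_filter hr)

end

theorem rowsList_eq_append {n : ℕ} {L : List (Fin n → ℤ)} {l₁ l₂ : List (List ℤ)}
    (h : rowsList L = l₁ ++ l₂) :
    ∃ L₁ L₂, L = L₁ ++ L₂ ∧ l₁ = rowsList L₁ ∧ l₂ = rowsList L₂ := by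
  obtain ⟨L₁, L₂, h1, h2, h3⟩ := List.map_eq_append_iff.1 h
  exact ⟨L₁, L₂, h1, h2.symm, h3.symm⟩

/-- Two matrices and a vector with the same number of columns. -/
def Shaped : Set (Ty.prod .mat (.prod .mat .vec)).Val :=
  {z | ∃ (n : ℕ) (LA LB : List (Fin n → ℤ)) (x : Fin n → ℤ),
    z = (rowsList LA, (rowsList LB, List.ofFn x))}

/-- A matrix, a vector and a list of vectors with the same number of columns. -/
def movable : Set (Ty.prod .mat (.prod .vec .mat)).Val :=
  {z | ∃ (n : ℕ) (L K : List (Fin n → ℤ)) (x : Fin n → ℤ),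
    z = (rowsList L, (List.ofFn x, rowsList K))}

/-! ### Iterated list algorithms in polynomial time -/

namespace PolyTime

theorem identity : PolyTime (a := .vec) (b := .mat) Set.univ identity := by
  refine foldl (a := .vec) (b := .int) (c := .mat) (T := Set.univ)
    (F := fun z => ((1 : ℤ) :: z.2.1.map fun _ => (0 : ℤ)) :: z.2.1.map fun r => (0 : ℤ) :: r)
    ?_ nil id' (.X * (.X * 3 + 2) + 1) (by simp) ?_
  · refine cons (cons (const_int 1) ?_) ?_
    · exact map_univ (b := .vec) (c := .int) (F := fun _ => (0 : ℤ)) (const_int 0) id'.snd.fst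
    · exact map_univ (b := .vec) (c := .vec) (F := fun z => (0 : ℤ) :: z.2)
        ((const_int 0).cons id'.snd) id'.snd.fst
  · intro x _ l₁ l₂ h
    have h1 : l₁.length ≤ Ty.vec.size x := by
      refine le_trans ?_ (Ty.length_le_size (a := .int) x)
      rw [h]; simp
    -- The intermediate accumulators are identity matrices of smaller size.
    have h2 := identity_eq _ l₁ rfl
    have h3 := size_rowsList_le (e := 0) h1 (L := List.ofFn fun i j : Fin l₁.length =>
      if i = j then (1 : ℤ) else 0) (by simpa using h1) (fun r hr i => by
        obtain ⟨j, rfl⟩ := List.mem_ofFn.1 hr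
        dsimp only
        split_ifs <;> simp)
    rw [← h2] at h3
    refine le_of_le_of_eq h3 ?_
    simp only [Polynomial.eval_add, Polynomial.eval_mul, Polynomial.eval_X, Polynomial.eval_one,
      Polynomial.eval_ofNat, Nat.zero_add]

theorem elimRows {a : Ty} {S : Set a.Val} {f : a.Val → List ℤ} {M K : a.Val → List (List ℤ)}
    (hf : PolyTime (b := .vec) S f) (hM : PolyTime (b := .mat) S M)
    (hK : PolyTime (b := .mat) S K) (q : Polynomial ℕ)
    (hq : ∀ x ∈ S, ∀ l₁ l₂, M x = l₁ ++ l₂ →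
      Ty.mat.size (elimRows (f x) l₁ (K x)) ≤ q.eval (a.size x)) :
    PolyTime (b := .mat) S (fun x => elimRows (f x) (M x) (K x)) :=
  foldl (b := .vec) (c := .mat) (T := {z | z.1 ∈ S})
    (F := fun z => if CircuitSum.dot z.2.2 (f z.1) = 0 then CircuitSum.elim z.2.2 z.2.1 else z.2.1)
    (ite_eq_zero (dot id'.snd.snd (hf.comp id'.fst fun _ h => h)) (id'.snd.snd.elim id'.snd.fst)
      id'.snd.fst) hK hM q (fun _ h _ _ _ _ => h) hq

/-- An intermediate result of the elimination is the final result for a matrix with fewer rows (no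
rows of B during the first fold), so `size_kernelSpan_le` covers it as well. -/
theorem kernelSpan : PolyTime (b := .mat) Shaped (fun z => kernelSpan z.1 z.2.1 z.2.2) := by
  let q : Polynomial ℕ := .X * (.X * ((.X + .X) * .X + 3) + 2) + 1
  have hq : ∀ s, q.eval s = s * (s * ((s + s) * s + 3) + 2) + 1 := fun s => by
    simp only [q, Polynomial.eval_add, Polynomial.eval_mul, Polynomial.eval_X, Polynomial.eval_one,
      Polynomial.eval_ofNat]
  refine elimRows (q := q) id'.snd.snd id'.snd.fst (elimRows (q := q) id'.snd.snd id'.fst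
    (identity.comp_univ id'.snd.snd) ?_) ?_
  · rintro z ⟨n, LA, LB, x, rfl⟩ l₁ l₂ h
    obtain ⟨L₁, L₂, rfl, rfl, -⟩ := rowsList_eq_append h
    rw [hq]
    refine size_kernelSpan_le (dim_le_of_size_le (x := x) ?_) (LB := [])
      (fun r hr => bounded_of_mem_of_size_le (L := L₁ ++ L₂) ?_ r (List.mem_append_left _ hr)) (by simp) x
    · simp only [Ty.size_prod]; omega
    · simp only [Ty.size_prod]; omega
  · rintro z ⟨n, LA, LB, x, rfl⟩ l₁ l₂ h
    obtain ⟨L₁, L₂, rfl, rfl, -⟩ := rowsList_eq_append h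
    rw [hq]
    refine size_kernelSpan_le (dim_le_of_size_le (x := x) ?_) (bounded_of_mem_of_size_le ?_)
      (fun r hr => bounded_of_mem_of_size_le (L := L₁ ++ L₂) ?_ r (List.mem_append_left _ hr)) x
    · simp only [Ty.size_prod]; omega
    · simp only [Ty.size_prod]; omega
    · simp only [Ty.size_prod]; omega

theorem moves : PolyTime (a := .prod .mat (.prod .vec .mat)) (b := .vec) movable
    (fun z : (Ty.prod .mat (.prod .vec .mat)).Val => moves z.1 z.2.1 z.2.2) := by
  refine foldl (a := .prod .mat (.prod .vec .mat)) (b := .vec) (c := .vec) (T := Set.univ)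
    (F := fun z => CircuitSum.moveTo z.1.1 z.2.1 z.2.2)
    (id'.fst.fst.moveTo id'.snd.fst id'.snd.snd) id'.snd.fst id'.snd.snd
    (.X * (.X + .X * (2 * .X + 2 * .X + 2 * ((.X + .X) * .X) + 1) + 3) + 1) (by simp) ?_
  rintro z ⟨n, L, K, x, rfl⟩ l₁ l₂ h
  obtain ⟨K₁, K₂, rfl, rfl, -⟩ := rowsList_eq_append h
  set s := (Ty.prod .mat (.prod .vec .mat)).size (rowsList L, (List.ofFn x, rowsList (K₁ ++ K₂)))
    with hs
  simp only [Ty.size_prod] at hs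
  have hx : Ty.vec.size (List.ofFn x) ≤ s := by omega
  have hK : Ty.mat.size (rowsList (K₁ ++ K₂)) ≤ s := by omega
  have hn := dim_le_of_size_le hx
  have hlen : K₁.length ≤ s :=
    le_trans (by rw [List.length_append]; omega) (length_le_of_size_le hK)
  -- The given directions have entries bounded through their own size; this weakens the bound to the
  -- form (N + β) * N with N = β = s that `moves_bounded` expects.
  have hle : s ≤ (s + s) * s := by nlinarith
  obtain ⟨x', h1, h2⟩ := moves_bounded (β := s) hn
    (bounded_of_mem_of_size_le (L := L) (by omega)) K₁
    (fun k hk => (bounded_of_mem_of_size_le hK k (List.mem_append_left _ hk)).mono hle)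
    (bounded_of_size_le hx)
  have h3 := size_ofFn_le hn
    (h2.mono (Nat.add_le_add_left (Nat.mul_le_mul_right (growth s s) hlen) s))
  rw [← h1, growth] at h3
  refine le_of_le_of_eq h3 ?_
  simp only [Polynomial.eval_add, Polynomial.eval_mul, Polynomial.eval_X, Polynomial.eval_one,
    Polynomial.eval_ofNat]

theorem foldl_descend_size {n : ℕ} (LA LB : List (Fin n → ℤ)) (x : Fin n → ℤ) (l₁ l₂ : List ℤ)
    (h : List.ofFn x = l₁ ++ l₂) {s : ℕ}
    (hs : (Ty.prod .mat (.prod .mat .vec)).size (rowsList LA, (rowsList LB, List.ofFn x)) = s) :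
    ∃ x' : Fin n → ℤ, l₁.foldl (fun x _ => CircuitSum.moves (rowsList LB) x
        (CircuitSum.kernelSpan (rowsList LA) (rowsList LB) x)) (List.ofFn x) = List.ofFn x' ∧
      Ty.vec.size (List.ofFn x') ≤ s * (s + s * (s * growth s s) + 3) + 1 := by
  simp only [Ty.size_prod] at hs
  have hx : Ty.vec.size (List.ofFn x) ≤ s := by omega
  have hn := dim_le_of_size_le hx
  have hlen : l₁.length ≤ s := by
    have := congrArg List.length h
    rw [List.length_ofFn, List.length_append] at this
    omega
  obtain ⟨x', h1, h2⟩ := descend_bounded (β := s) hn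
    (bounded_of_mem_of_size_le (L := LA) (by omega))
    (bounded_of_mem_of_size_le (L := LB) (by omega)) l₁ (bounded_of_size_le hx)
  exact ⟨x', h1, size_ofFn_le hn
    (h2.mono (Nat.add_le_add_left (Nat.mul_le_mul_right (s * growth s s) hlen) s))⟩

/-- A round is known to be polynomial only on vectors of the right length, so each intermediate
vector needs both its shape and its size controlled; `foldl_descend_size` gives both. -/
theorem descend : PolyTime (b := .vec) Shaped (fun z => descend z.1 z.2.1 z.2.2) := by
  let T : Set (Ty.prod (.prod .mat (.prod .mat .vec)) (.prod .vec .int)).Val :=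
    {z | (z.1.1, (z.1.2.1, z.2.1)) ∈ Shaped}
  have hK : PolyTime (b := .mat) T (fun z => CircuitSum.kernelSpan z.1.1 z.1.2.1 z.2.1) :=
    kernelSpan.comp (id'.fst.fst.pair (id'.fst.snd.fst.pair id'.snd.fst)) fun _ h => h
  have hF : PolyTime (b := .vec) T
      (fun z => CircuitSum.moves z.1.2.1 z.2.1 (CircuitSum.kernelSpan z.1.1 z.1.2.1 z.2.1)) := by
    have hf : PolyTime (b := .prod .mat (.prod .vec .mat)) T (fun z =>
        (z.1.2.1, (z.2.1, CircuitSum.kernelSpan z.1.1 z.1.2.1 z.2.1))) :=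
      (id'.fst.snd.fst).pair ((id'.snd.fst).pair hK)
    have hT : ∀ z ∈ T, (z.1.2.1, (z.2.1, CircuitSum.kernelSpan z.1.1 z.1.2.1 z.2.1)) ∈ movable := by
      intro z hz
      obtain ⟨n, LA, LB, x, h⟩ : (z.1.1, (z.1.2.1, z.2.1)) ∈ Shaped := hz
      have h1 : z.1.1 = rowsList LA := congrArg (fun t => t.1) h
      have h2 : z.1.2.1 = rowsList LB := congrArg (fun t => t.2.1) h
      have h3 : z.2.1 = List.ofFn x := congrArg (fun t => t.2.2) h
      obtain ⟨K, S, R, hK, -⟩ := kernelSpan_spec LA LB x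
      refine ⟨n, LB, List.ofFn K, x, ?_⟩
      rw [← hK, ← h1, ← h2, ← h3]
    have := comp moves hf hT
    exact this
  refine foldl (a := .prod .mat (.prod .mat .vec)) (b := .int) (c := .vec) (T := T) (F := fun z =>
    CircuitSum.moves z.1.2.1 z.2.1 (CircuitSum.kernelSpan z.1.1 z.1.2.1 z.2.1)) hF
    id'.snd.snd id'.snd.snd
    (.X * (.X + .X * (.X * (2 * .X + 2 * .X + 2 * ((.X + .X) * .X) + 1)) + 3) + 1) ?_ ?_
  · rintro z ⟨n, LA, LB, x, rfl⟩ l₁ y l₂ h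
    obtain ⟨x', h1, -⟩ := foldl_descend_size LA LB x l₁ (y :: l₂) h rfl
    exact ⟨n, LA, LB, x', by simp only [h1]⟩
  · rintro z ⟨n, LA, LB, x, rfl⟩ l₁ l₂ h
    obtain ⟨x', h1, h2⟩ := foldl_descend_size LA LB x l₁ l₂ h rfl
    rw [← h1, growth] at h2
    refine le_of_le_of_eq h2 ?_
    simp only [Polynomial.eval_add, Polynomial.eval_mul, Polynomial.eval_X, Polynomial.eval_one,
      Polynomial.eval_ofNat]

/-- The states of the main loop. -/
abbrev stateTy : Ty := .prod .vec (.prod .int .output)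

theorem pass {a : Ty} {S : Set a.Val} {MA MB : a.Val → List (List ℤ)} {f : a.Val → stateTy.Val}
    (hA : PolyTime (b := .mat) S MA) (hB : PolyTime (b := .mat) S MB) (hf : PolyTime S f)
    (h : ∀ x ∈ S, (MA x, (MB x, (f x).1)) ∈ Shaped) :
    PolyTime (b := stateTy) S (fun x => pass (MA x) (MB x) (f x)) := by
  have hg := (descend.comp (hA.pair (hB.pair hf.fst)) h).primPart
  have hm := hB.minRatio hf.fst hg
  have hQ := (hm.snd.mul hm.snd).mul hf.snd.fst
  exact ite_eq_zero (b := stateTy) hf.fst.content hf ((subMul hm.fst hm.snd hf.fst hg).pair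
    (hQ.pair ((hg.pair (lowest (hm.fst.mul hm.snd) hQ)).cons hf.snd.snd)))

end PolyTime

/-- The encodings of valid inputs. -/
def validInputs : Set Ty.input.Val :=
  {z | ∃ (n mA mB : ℕ) (A : Matrix (Fin mA) (Fin n) ℚ) (B : Matrix (Fin mB) (Fin n) ℚ)
    (u : Fin n → ℚ), IsPointed (realMat A) (realMat B) ∧ (realMat A) *ᵥ (realVec u) = 0 ∧ u ≠ 0 ∧
      z = encodeInput A B u}

/-! ### Sizes of the states and the whole program -/

section
variable {n mA mB : ℕ} {A : Matrix (Fin mA) (Fin n) ℚ} {B : Matrix (Fin mB) (Fin n) ℚ}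
  {u : Fin n → ℚ}

theorem mulVec_clearVec (hu : (realMat A) *ᵥ (realVec u) = 0) :
    (realMat A) *ᵥ (intVec (clearVec u)) = 0 := by
  rw [intVec_clearVec, mulVec_smul, hu, smul_zero]

theorem clearVec_ne_zero (hu : u ≠ 0) : clearVec u ≠ 0 := by
  intro h
  apply hu
  have h1 := scaledVec_clearVec u
  rw [h, (scaledVec_eq_zero (denProd_pos u)).2 rfl] at h1
  ext i
  have h2 := congrFun h1 i
  exact_mod_cast (show (u i : ℝ) = 0 from h2.symm)

theorem size_encodeInput :
    Ty.input.size (encodeInput A B u) = (Ty.list (.list .rat)).size (encodeMat A) +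
      ((Ty.list (.list .rat)).size (encodeMat B) + (Ty.list .rat).size (encodeVec u) + 1) + 1 :=
  rfl

theorem bounded_row {m : ℕ} (M : Matrix (Fin m) (Fin n) ℚ) {s : ℕ}
    (h : (Ty.list (.list .rat)).size (encodeMat M) ≤ s) (i : Fin m) :
    Bounded (2 * s) (clearVec (M i)) :=
  (bounded_clearVec (M i)).mono (Nat.mul_le_mul_left _
    ((Ty.size_le_of_mem (a := .list .rat) (List.mem_ofFn.2 ⟨i, rfl⟩)).trans h))

theorem size_state_le {N E κ : ℕ} (hn : n ≤ N) {v : Fin n → ℤ} (hv : Bounded E v) {Q : ℤ}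
    (hQ : Q.natAbs ≤ 2 ^ E) {out : List ((Fin n → ℤ) × ℚ)} (hlen : out.length ≤ N)
    (hout : ∀ t ∈ out, Bounded κ t.1 ∧ (encodeRat t.2).1.natAbs ≤ 2 ^ E ∧
      (encodeRat t.2).2.natAbs ≤ 2 ^ E) :
    PolyTime.stateTy.size (List.ofFn v, (Q, (encodeOutput out).reverse)) ≤
      (N * (E + 3) + 1) + ((E + 2) + (N * ((N * (κ + 3) + 1) + (E + 2 + (E + 2) + 1) + 1 + 1) + 1) +
        1) + 1 := by
  have h1 := size_ofFn_le hn hv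
  have h2 := Ty.size_int_le_of_natAbs_le hQ
  have h3 : Ty.output.size (encodeOutput out).reverse ≤
      N * ((N * (κ + 3) + 1) + (E + 2 + (E + 2) + 1) + 1 + 1) + 1 := by
    refine (Ty.size_reverse (a := .prod .vec .rat) _).le.trans ?_
    refine Ty.size_le_of_forall (a := .prod .vec .rat) (by simpa [encodeOutput] using hlen) ?_
    intro z hz
    obtain ⟨t, ht, rfl⟩ := List.mem_map.1 hz
    obtain ⟨b1, b2, b3⟩ := hout t ht
    have c1 := size_ofFn_le hn b1
    have c2 := Ty.size_int_le_of_natAbs_le b2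
    have c3 := Ty.size_int_le_of_natAbs_le b3
    simp only [Ty.size_prod]
    omega
  simp only [Ty.size_prod]
  omega

theorem passes_size (hp : IsPointed (realMat A) (realMat B))
    (hu : (realMat A) *ᵥ (realVec u) = 0) (hu0 : u ≠ 0) {α : Type*} (l : List α) {s : ℕ}
    (hl : l.length ≤ s) (hs : Ty.input.size (encodeInput A B u) = s) :
    ∃ (v : Fin n → ℤ) (r : ℤ × List (List ℤ × ℤ × ℤ)),
      l.foldl (fun s _ => pass ((encodeMat A).map clear) ((encodeMat B).map clear) s)
        (clear (encodeVec u), denProd (encodeVec u), []) = (List.ofFn v, r) ∧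
      PolyTime.stateTy.size (List.ofFn v, r) ≤
        (s * ((2 * s + s * growth s (2 * s)) + 3) + 1) + (((2 * s + s * growth s (2 * s)) + 2) +
          (s * ((s * ((s + 2 * s) * s + 3) + 1) + ((2 * s + s * growth s (2 * s)) + 2 +
            ((2 * s + s * growth s (2 * s)) + 2) + 1) + 1 + 1) + 1) + 1) + 1 := by
  rw [size_encodeInput] at hs
  have hn : n ≤ s := by
    have := Ty.length_le_size (a := .rat) (encodeVec u)
    rw [encodeVec, List.length_ofFn, ← encodeVec] at this
    omega
  obtain ⟨v, Q, out, hfold, -, -, hv, hQ, hlen, hout, -⟩ := passes_spec (rowScaled_clearVec A)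
    (rowScaled_clearVec B) hp (mulVec_clearVec hu) (clearVec_ne_zero hu0) (denProd_pos u)
    (N := s) (β := 2 * s) (e := 2 * s) hn (bounded_row A (by omega)) (bounded_row B (by omega))
    ((bounded_clearVec u).mono (by omega))
    ((natAbs_denProd_le _).trans (Nat.pow_le_pow_right (by norm_num) (by omega))) l
  have hE : 2 * s + l.length * growth s (2 * s) ≤ 2 * s + s * growth s (2 * s) :=
    Nat.add_le_add_left (Nat.mul_le_mul_right _ hl) _
  have hpow := Nat.pow_le_pow_right (n := 2) (by norm_num) hE
  refine ⟨v, (Q, (encodeOutput out).reverse), ?_, ?_⟩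
  · rw [map_clear_encodeMat, map_clear_encodeMat, clear_encodeVec, hfold]
  · refine size_state_le hn (hv.mono hE) (hQ.trans hpow) (hlen.trans hl) fun t ht => ?_
    obtain ⟨b1, b2, b3⟩ := hout t ht
    exact ⟨b1, b2.trans hpow, b3.trans hpow⟩

end

theorem polyTime_decompose : PolyTime (b := Ty.output) validInputs
    (fun z => decompose z.1 z.2.1 z.2.2) := by
  have hclear : ∀ {a : Ty} {S : Set a.Val} {f : a.Val → List (List (ℤ × ℤ))},
      PolyTime (b := .list (.list .rat)) S f → PolyTime (b := .mat) S (fun x => (f x).map clear) :=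
    fun hf => PolyTime.map_univ (b := .list .rat) (c := .vec) (F := fun z => clear z.2)
      (PolyTime.clear PolyTime.id'.snd) hf
  let T : Set (Ty.prod .input (.prod PolyTime.stateTy .rat)).Val :=
    {z | (z.1.1.map clear, (z.1.2.1.map clear, z.2.1.1)) ∈ Shaped}
  have hF : PolyTime (b := PolyTime.stateTy) T
      (fun z => pass (z.1.1.map clear) (z.1.2.1.map clear) z.2.1) :=
    PolyTime.pass (hclear PolyTime.id'.fst.fst) (hclear PolyTime.id'.fst.snd.fst)
      PolyTime.id'.snd.fst fun _ h => h
  have hi : PolyTime (b := PolyTime.stateTy) validInputs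
      (fun z => (clear z.2.2, (denProd z.2.2, []))) :=
    PolyTime.id'.snd.snd.clear.pair (PolyTime.id'.snd.snd.denProd.pair PolyTime.nil)
  -- With s the input size, `E` is 2s + s * growth s (2s): 2s bits after clearing denominators, then
  -- at most s passes.
  let E : Polynomial ℕ := 2 * .X + .X * (2 * .X + 2 * (2 * .X) + 2 * ((.X + 2 * .X) * .X) + 1)
  have hfold := PolyTime.foldl (c := PolyTime.stateTy) (b := .rat) hF hi PolyTime.id'.snd.snd
    ((.X * (E + 3) + 1) + ((E + 2) + (.X * ((.X * ((.X + 2 * .X) * .X + 3) + 1) +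
      (E + 2 + (E + 2) + 1) + 1 + 1) + 1) + 1) + 1)
    (by
      rintro z ⟨n, mA, mB, A, B, u, hp, hu, hu0, rfl⟩ l₁ y l₂ h
      replace h : encodeVec u = l₁ ++ y :: l₂ := h
      obtain ⟨v, r, h1, -⟩ := passes_size hp hu hu0 l₁
        (le_trans (by rw [h, List.length_append]; omega) (
          (Ty.length_le_size (a := .rat) (encodeVec u)).trans (by rw [size_encodeInput]; omega)))
        rfl
      change ((encodeMat A).map clear, ((encodeMat B).map clear,
        (l₁.foldl (fun s _ => pass ((encodeMat A).map clear) ((encodeMat B).map clear) s)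
          (clear (encodeVec u), denProd (encodeVec u), [])).1)) ∈ Shaped
      rw [h1, map_clear_encodeMat, map_clear_encodeMat]
      exact ⟨n, _, _, v, rfl⟩)
    (by
      rintro z ⟨n, mA, mB, A, B, u, hp, hu, hu0, rfl⟩ l₁ l₂ h
      replace h : encodeVec u = l₁ ++ l₂ := h
      obtain ⟨v, r, h1, h2⟩ := passes_size hp hu hu0 l₁
        (le_trans (by rw [h, List.length_append]; omega) (
          (Ty.length_le_size (a := .rat) (encodeVec u)).trans (by rw [size_encodeInput]; omega)))
        rfl
      rw [← h1, growth] at h2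
      refine le_of_le_of_eq h2 ?_
      simp only [E, Polynomial.eval_add, Polynomial.eval_mul, Polynomial.eval_X,
        Polynomial.eval_one, Polynomial.eval_ofNat])
  exact hfold.snd.snd.reverse

end CircuitSum

/-- First part: on every input, with every choice of circuits, the algorithm never gets stuck, stops
after at most `n - rank A` passes, and returns a sign-compatible sum of at most `n - rank A`
circuits. Second part: some implementation of the algorithm runs in polynomial time in the bit
size of a rational input. -/
theorem theorem4p11 :
    (∀ (n mA mB : ℕ) (A : Matrix (Fin mA) (Fin n) ℚ) (B : Matrix (Fin mB) (Fin n) ℚ)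
        (u : Fin n → ℝ),
      IsPointed (realMat A) (realMat B) → (realMat A).mulVec u = 0 → u ≠ 0 →
      ∀ (k : ℕ) (c : ℕ → Config n), IsRun (realMat A) (realMat B) u k c →
        k ≤ n - (realMat A).rank ∧
        ((∃ c', Step (realMat A) (realMat B) (c k) c') ∨
          ∃ out, c k = .halt out ∧ IsSignCompatibleSum (realMat A) (realMat B) u out ∧
            out.length ≤ n - (realMat A).rank)) ∧
    (∃ (prog : Prog Ty.input Ty.output) (p : Polynomial ℕ),
      ∀ (n mA mB : ℕ) (A : Matrix (Fin mA) (Fin n) ℚ) (B : Matrix (Fin mB) (Fin n) ℚ)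
        (u : Fin n → ℚ),
      IsPointed (realMat A) (realMat B) → (realMat A).mulVec (realVec u) = 0 → u ≠ 0 →
      ∃ (out : List ((Fin n → ℤ) × ℚ)) (cost : ℕ),
        prog.Eval (encodeInput A B u) (encodeOutput out) cost ∧
        cost ≤ p.eval (Ty.input.size (encodeInput A B u)) ∧
        (∃ (k : ℕ) (c : ℕ → Config n),
          IsRun (realMat A) (realMat B) (realVec u) k c ∧ c k = .halt (realOut out)) ∧
        IsSignCompatibleSum (realMat A) (realMat B) (realVec u) (realOut out) ∧
        out.length ≤ n - (realMat A).rank) := by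
  constructor
  · intro n mA mB A B u hp hu hu0 k c hc
    exact run_spec (rowScaled_clearVec A) (rowScaled_clearVec B) hp hu hu0 hc
  · obtain ⟨P, p, h⟩ := polyTime_decompose
    refine ⟨P, p, fun n mA mB A B u hp hu hu0 => ?_⟩
    obtain ⟨c, hc, hcp⟩ := h _ ⟨n, mA, mB, A, B, u, hp, hu, hu0, rfl⟩
    -- The bounds supplied here do not occur in the conclusion; any valid ones would do.
    obtain ⟨out, h1, h2, h3, h4⟩ := passes_halt (rowScaled_clearVec A) (rowScaled_clearVec B) hp
      (mulVec_clearVec hu) (clearVec_ne_zero hu0) (denProd_pos u)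
      (N := n + Ty.input.size (encodeInput A B u)) (β := 2 * Ty.input.size (encodeInput A B u))
      (e := 2 * Ty.input.size (encodeInput A B u)) (by omega)
      (bounded_row A (by rw [size_encodeInput]; omega))
      (bounded_row B (by rw [size_encodeInput]; omega))
      ((bounded_clearVec u).mono (by rw [size_encodeInput]; omega))
      ((natAbs_denProd_le _).trans
        (Nat.pow_le_pow_right (by norm_num) (by rw [size_encodeInput]; omega)))
      (encodeVec u) (by rw [encodeVec, List.length_ofFn])
    rw [scaledVec_clearVec] at h2 h3
    refine ⟨out, c, ?_, hcp, h2, h3, h4⟩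
    rw [← h1, ← map_clear_encodeMat, ← map_clear_encodeMat, ← clear_encodeVec]
    exact hc
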